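/- All functions are defined on $\mathbb{R}^3$; derivatives are taken in the sense of distributions. For $p>3$, the homogeneous Morrey space $\dot M^{2,p}$ is the set of measurable functions $f$ with $$\sup_{x_0\in\mathbb{R}^3,\,R>0} R^{3/p}\Big(\tfrac{1}{|B(x_0,R)|}\int_{B(x_0,R)}|f|^2\,dx\Big)^{1/2}<\infty ,$$ and for $m\ge 0$, $\mathcal{W}^{m,p}=\{f\in\dot M^{2,p}:\ \partial^\alpha f\in\dot M^{2,p}\ \text{for all } |\alpha|\le m\}$; $W^{m,\infty}$ is the usual Sobolev space of bounded functions with bounded weak derivatives up to order $m$. Membership of a vector or tensor field means membership of all its components, and $[\operatorname{div}\mathbb{F}]_i=\sum_j\partial_jF_{ij}$. A distribution is said to be Hölder continuous if it is given by a function that is (after modification on a null set) Hölder continuous on $\mathbb{R}^3$. Let $p>3$ (finite) and let $k\ge 0$ be an integer. (1) Let $\mathbb{F}=(F_{ij})_{1\le i,j\le3}\in\mathcal{W}^{k+1,p}\cap W^{k+1,\infty}$, and let $(U,P)\in L^2_{loc}(\mathbb{R}^3;\mathbb{R}^3)\times\mathcal{D}'(\mathbb{R}^3)$ satisfy $$-\Delta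 U+\operatorname{div}(U\otimes U)+\nabla P=\operatorname{div}(\mathbb{F}),\qquad \operatorname{div}U=0$$ in the sense of distributions. If $U\in\dot M^{2,p}$, then $U\in\mathcal{W}^{k+2,p}$ and, up to an additive constant, $P\in\mathcal{W}^{k+1,p}$ (that is, $P-c\in\mathcal{W}^{k+1,p}$ for some $c\in\mathbb{R}$). Moreover, $\partial^\alpha U$ is Hölder continuous with exponent $1-3/p$ for all $|\alpha|\le k+1$, and $\partial^\alpha P$ is Hölder continuous with exponent $1-3/p$ for all $|\alpha|\le k$. (2) Let $\mathbb{G}=(G_{ij})_{1\le i,j\le3}\in\mathcal{W}^{k+1,p}\cap W^{k+1,\infty}$, and let $V:\mathbb{R}^3\to\mathbb{R}^3$ be measurable with $|V(x)|=1$ for almost every $x$, with $\nabla\otimes V=(\partial_iV_j)_{1\le i,j\le 3}\in L^2_{loc}$, and with $$-\Delta V-|\nabla\otimes V|^2V=\operatorname{div}(\mathbb{G})$$ in the sense of distributions. If $\nabla\otimes V\in\dot M^{2,p}$, then $\partial^\alpha V\in\dot M^{2,p}$ for all multi-indices $1\le|\alpha|\le k+2$ (that is, $\nabla\otimes V\in\mathcal{W}^{k+1,p}$),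 and $\partial^\alpha V$ is Hölder continuous with exponent $1-3/p$ for all $|\alpha|\le k+1$. -/

import Mathlib

open MeasureTheory Set
open scoped ENNReal NNReal Distributions LineDeriv

noncomputable section

namespace MorreyRegularity

/-- The Euclidean space `ℝ³`. -/
abbrev E3 : Type := EuclideanSpace ℝ (Fin 3)

/-- The space `𝓓'(ℝ³)` of real distributions on `ℝ³`. -/
abbrev Distr : Type := 𝓓'((⊤ : TopologicalSpace.Opens E3), ℝ)

/-- The `i`-th vector of the canonical basis of `ℝ³`. -/
def e (i : Fin 3) : E3 := EuclideanSpace.single i 1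

/-- The distribution `φ ↦ ∫ φ f` of a locally integrable function `f`. (It is the zero distribution
if `f` is not locally integrable; below it is only used for locally integrable functions.) -/
def toDistr (f : E3 → ℝ) : Distr :=
  (TestFunction.integralAgainstBilinCLM (ContinuousLinearMap.mul ℝ ℝ) volume f :
    𝓓((⊤ : TopologicalSpace.Opens E3), ℝ) →L[ℝ] ℝ)

lemma toDistr_apply {f : E3 → ℝ} (hf : LocallyIntegrable f)
    (φ : 𝓓((⊤ : TopologicalSpace.Opens E3), ℝ)) : toDistr f φ = ∫ x, φ x * f x := by
  have h : LocallyIntegrableOn f ((⊤ : TopologicalSpace.Opens E3) : Set E3) :=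
    hf.locallyIntegrableOn _
  exact TestFunction.integralAgainstBilinCLM_eq_integral h

/-- The length `|α| = α₁ + α₂ + α₃` of a multi-index. -/
def order (α : Fin 3 → ℕ) : ℕ := ∑ i, α i

/-- The derivative `∂^α T = ∂₁^{α₁} ∂₂^{α₂} ∂₃^{α₃} T` of a distribution. -/
def multiDeriv (α : Fin 3 → ℕ) (T : Distr) : Distr :=
  (fun S : Distr => ∂_{e 0} S)^[α 0]
    ((fun S : Distr => ∂_{e 1} S)^[α 1] ((fun S : Distr => ∂_{e 2} S)^[α 2] T))

/-- `g` is the weak derivative `∂^α f`: both are locally integrable functions and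
`∂^α f = g` in `𝓓'(ℝ³)`. It determines `g` almost everywhere. -/
structure IsWeakDeriv (α : Fin 3 → ℕ) (f g : E3 → ℝ) : Prop where
  locallyIntegrable_left : LocallyIntegrable f
  locallyIntegrable_right : LocallyIntegrable g
  deriv_eq : multiDeriv α (toDistr f) = toDistr g

/-- `f ∈ L²_loc(ℝ³)`. -/
def MemL2Loc (f : E3 → ℝ) : Prop :=
  ∀ K : Set E3, IsCompact K → MemLp f 2 (volume.restrict K)

/-- The homogeneous Morrey norm
`sup_{x₀, R > 0} R^{3/p} (|B(x₀,R)|⁻¹ ∫_{B(x₀,R)} |f|²)^{1/2}`, with values in `[0, ∞]`. -/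
def morreyNorm (p : ℝ) (f : E3 → ℝ) : ℝ≥0∞ :=
  ⨆ (x₀ : E3) (R : ℝ) (_ : 0 < R),
    ENNReal.ofReal (R ^ (3 / p)) *
      ((volume (Metric.ball x₀ R))⁻¹ * ∫⁻ x in Metric.ball x₀ R, ‖f x‖ₑ ^ 2) ^ (1 / 2 : ℝ)

/-- `f ∈ Ṁ^{2,p}(ℝ³)`. -/
def MemMorrey (p : ℝ) (f : E3 → ℝ) : Prop :=
  AEStronglyMeasurable f volume ∧ morreyNorm p f < ∞

/-- `f ∈ 𝒲^{m,p}(ℝ³)`: `f` and all its weak derivatives of order at most `m` are in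
`Ṁ^{2,p}(ℝ³)`. -/
def MemSobolevMorrey (m : ℕ) (p : ℝ) (f : E3 → ℝ) : Prop :=
  MemMorrey p f ∧
    ∀ α : Fin 3 → ℕ, order α ≤ m → ∃ g : E3 → ℝ, IsWeakDeriv α f g ∧ MemMorrey p g

/-- `f ∈ W^{m,∞}(ℝ³)`: `f` and all its weak derivatives of order at most `m` are bounded. -/
def MemSobolevInfty (m : ℕ) (f : E3 → ℝ) : Prop :=
  MemLp f ∞ volume ∧
    ∀ α : Fin 3 → ℕ, order α ≤ m → ∃ g : E3 → ℝ, IsWeakDeriv α f g ∧ MemLp g ∞ volume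

/-- For `|α| ≤ m`, the weak derivative `∂^α f` exists and is (almost everywhere equal to)
a Hölder continuous function on `ℝ³` with exponent `γ`. -/
def HolderDerivs (m : ℕ) (γ : ℝ≥0) (f : E3 → ℝ) : Prop :=
  ∀ α : Fin 3 → ℕ, order α ≤ m →
    ∃ g : E3 → ℝ, IsWeakDeriv α f g ∧ ∃ C : ℝ≥0, HolderWith C γ g

/-- The condition on a tensor of forces: all entries are in
`𝒲^{k+1,p}(ℝ³) ∩ W^{k+1,∞}(ℝ³)`. -/
def ForceCondition (k : ℕ) (p : ℝ) (F : Fin 3 → Fin 3 → E3 → ℝ) : Prop :=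
  ∀ i j, MemSobolevMorrey (k + 1) p (F i j) ∧ MemSobolevInfty (k + 1) (F i j)

/-- `(U, P)` is a weak solution of `-Δ U + div (U ⊗ U) + ∇ P = div F`, `div U = 0`:
`U ∈ L²_loc`, `P ∈ 𝓓'`, and the equations hold in `𝓓'(ℝ³)`. -/
structure IsWeakSolutionNS (F : Fin 3 → Fin 3 → Distr) (U : E3 → E3) (P : Distr) : Prop where
  memL2Loc : ∀ i, MemL2Loc (fun x => U x i)
  momentum : ∀ i,
    -(∑ j, ∂_{e j} (∂_{e j} (toDistr (fun x => U x i))))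
      + (∑ j, ∂_{e j} (toDistr (fun x => U x i * U x j))) + ∂_{e i} P
      = ∑ j, ∂_{e j} (F i j)
  div_eq_zero : ∑ i, ∂_{e i} (toDistr (fun x => U x i)) = 0

/-- `D = (∂_i V_j)_{i,j}` is the weak gradient `∇ ⊗ V` of the vector field `V`. -/
def IsWeakGradient (V : E3 → E3) (D : Fin 3 → Fin 3 → E3 → ℝ) : Prop :=
  ∀ i j, IsWeakDeriv (Pi.single i 1) (fun x => V x j) (D i j)

/-- `V`, with weak gradient `D = ∇ ⊗ V`, is a weak solution of
`-Δ V - |∇ ⊗ V|² V = div G`: `|V| = 1` a.e., `∇ ⊗ V ∈ L²_loc`,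
and the equation holds in `𝓓'(ℝ³)`. -/
structure IsWeakSolutionHarmonicMap (G : Fin 3 → Fin 3 → Distr) (V : E3 → E3)
    (D : Fin 3 → Fin 3 → E3 → ℝ) : Prop where
  measurable : AEStronglyMeasurable V volume
  norm_eq_one : ∀ᵐ x, ‖V x‖ = 1
  gradient : IsWeakGradient V D
  memL2Loc : ∀ i j, MemL2Loc (D i j)
  equation : ∀ i,
    -(∑ j, ∂_{e j} (∂_{e j} (toDistr (fun x => V x i))))
      - toDistr (fun x => (∑ a, ∑ b, D a b x ^ 2) * V x i)
      = ∑ j, ∂_{e j} (G i j)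

end MorreyRegularity

end

open MeasureTheory Set
open scoped ENNReal NNReal Distributions LineDeriv

noncomputable section

namespace MorreyRegularity

/-! Both systems reduce to one linear equation with quadratic data. The divergence of the momentum
equation is `ΔP = ∑ ∂_a ∂_b T_ab` with `T = F - U ⊗ U`. Eliminating `P` gives `Δ² U_i = ∑ ∂_a ∂_b
∂_c h_abc` with `h` linear in `T`. Applying `∂_i Δ` to the harmonic map equation gives the same form
for the components of `∇ ⊗ V`, with `h` built from `|∇ ⊗ V|² V + div G`. In both cases `|h| ≤ |f| +
C |u|²`, where `f` is a Morrey function and `u` is the unknown.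

Three facts carry the proof. Boundedness (`exists_ae_bound_of_quadratic`): `u` is at most a constant
plus a truncated Riesz potential of order one of `w = |u|²`. Since `p > 3`, the integral of `w` over
balls of radius `t` is `O(t^(1+δ))` with `δ > 0`. Each use of the inequality replaces `δ` by `3δ/2`,
and once `δ > 1` the potential is bounded. Gain of a derivative (`exists_deriv_memMorrey`): if `u`
and `h` are Morrey functions, so is `∇u`, because `Δ² ∇u` consists of fourth derivatives of `h` and
`∇u` vanishes at infinity. Hölder continuity (`exists_holder`): a Morrey gradient with `p > 3` gives
the exponent `1 - 3/p`.

Bounded Morrey functions multiply well (`Reg.mul`, `Reg.mul_bdd`), so `h` inherits the regularity of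
`u` and `Reg.of_bilap` gains one derivative per round, as far as the force permits. The pressure has
a Morrey gradient and `Δ² P` consists of fourth derivatives of `T`. By `exists_memMorrey_add_const`
it is then a Morrey function up to a constant.

All kernel bounds come from one explicit parametrix. In `ℝ³` a multiple of `‖x‖` is a fundamental
solution of `Δ²`. Smoothing it near the origin and subtracting two dilates gives a test function
`kern ε R` with `Δ² (kern ε R) = chi ε - chi R` (`bilap_kern`). It can be paired with any
distribution, and its third and fourth derivatives are `O(‖x‖⁻²)` and `O(‖x‖⁻³)` uniformly in `ε`
and `R`. -/

/-- Real test functions on `ℝ³`. -/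
abbrev TF : Type := 𝓓((⊤ : TopologicalSpace.Opens E3), ℝ)

/-! ### Derivatives of test functions and of distributions. -/

/-- The `i`-th partial derivative of a function. -/
def pd (i : Fin 3) (f : E3 → ℝ) : E3 → ℝ := fun x => fderiv ℝ f x (e i)

/-- Smooth real functions on `ℝ³`. -/
abbrev Smooth (f : E3 → ℝ) : Prop := ContDiff ℝ ((⊤ : ℕ∞) : WithTop ℕ∞) f

/-- The `i`-th partial derivative of a test function. -/
def D (i : Fin 3) : TF →L[ℝ] TF := TestFunction.lineDerivCLM ℝ (e i)

lemma coe_D (i : Fin 3) (φ : TF) : ⇑(D i φ) = pd i φ := by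
  ext x
  rw [D, TestFunction.lineDerivCLM_eq_fderivCLM, TestFunction.fderivCLM_apply_of_le _ (by simp)]
  rfl

lemma TF.smooth (φ : TF) : Smooth φ := φ.contDiff

lemma contDiff_pd {f : E3 → ℝ} (hf : Smooth f) (i : Fin 3) : Smooth (pd i f) :=
  (hf.fderiv_right (m := (⊤ : ℕ∞)) (by simp)).clm_apply contDiff_const

lemma pd_comm {f : E3 → ℝ} (hf : Smooth f) (i j : Fin 3) : pd i (pd j f) = pd j (pd i f) := by
  have hd : Differentiable ℝ (fderiv ℝ f) :=
    (hf.fderiv_right (m := (⊤ : ℕ∞)) (by simp)).differentiable (by simp)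
  ext x
  have key : ∀ k l, pd k (pd l f) x = fderiv ℝ (fderiv ℝ f) x (e k) (e l) := by
    intro k l
    have := ((hd x).hasFDerivAt.clm_apply (hasFDerivAt_const (e l) x)).fderiv
    unfold pd
    rw [this]; simp
  rw [key, key]
  exact (hf.contDiffAt.isSymmSndFDerivAt (by simpa using WithTop.coe_le_coe.2 (le_top : (2 : ℕ∞) ≤ ⊤))) _ _

lemma TF.D_comm (i j : Fin 3) (φ : TF) : D i (D j φ) = D j (D i φ) := by
  apply DFunLike.coe_injective
  rw [coe_D, coe_D, coe_D, coe_D, pd_comm φ.smooth]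

lemma Distr.deriv_apply (i : Fin 3) (T : Distr) (φ : TF) : (∂_{e i} T) φ = -T (D i φ) := by
  rfl

lemma Distr.deriv_comm (i j : Fin 3) (T : Distr) : ∂_{e i} (∂_{e j} T) = ∂_{e j} (∂_{e i} T) := by
  ext φ
  simp only [Distr.deriv_apply, TF.D_comm i j φ]

lemma Distr.deriv_add (i : Fin 3) (S T : Distr) : ∂_{e i} (S + T) = ∂_{e i} S + ∂_{e i} T :=
  LineDerivAdd.lineDerivOp_add _ _ _

lemma Distr.deriv_zero (i : Fin 3) : ∂_{e i} (0 : Distr) = 0 := by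
  ext φ; rw [Distr.deriv_apply]; exact neg_zero

lemma Distr.deriv_neg (i : Fin 3) (T : Distr) : ∂_{e i} (-T) = -∂_{e i} T := by
  ext φ; rw [Distr.deriv_apply]; change - -T _ = - (∂_{e i} T) φ; rw [Distr.deriv_apply]

lemma Distr.deriv_sub (i : Fin 3) (S T : Distr) : ∂_{e i} (S - T) = ∂_{e i} S - ∂_{e i} T := by
  rw [sub_eq_add_neg, Distr.deriv_add, Distr.deriv_neg, ← sub_eq_add_neg]

lemma Distr.deriv_sum {ι : Type*} (i : Fin 3) (s : Finset ι) (T : ι → Distr) :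
    ∂_{e i} (∑ j ∈ s, T j) = ∑ j ∈ s, ∂_{e i} (T j) := by
  classical
  induction s using Finset.induction_on with
  | empty => simp
  | insert a s ha ih => rw [Finset.sum_insert ha, Finset.sum_insert ha, Distr.deriv_add, ih]

/-! ### Locally integrable functions as distributions. -/

lemma TF.integrable_mul {f : E3 → ℝ} (hf : LocallyIntegrable f) (φ : TF) :
    Integrable (fun x => φ x * f x) := by
  have := hf.integrable_smul_left_of_hasCompactSupport φ.continuous φ.hasCompactSupport
  simpa using this

lemma TF.integrable (φ : TF) : Integrable (φ : E3 → ℝ) :=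
  φ.continuous.integrable_of_hasCompactSupport φ.hasCompactSupport

lemma TF.locallyIntegrable (φ : TF) : LocallyIntegrable (φ : E3 → ℝ) :=
  φ.continuous.locallyIntegrable

lemma toDistr_add {f g : E3 → ℝ} (hf : LocallyIntegrable f) (hg : LocallyIntegrable g) :
    toDistr (fun x => f x + g x) = toDistr f + toDistr g := by
  ext φ
  change _ = toDistr f φ + toDistr g φ
  rw [toDistr_apply (f := fun x => f x + g x) (hf.add hg), toDistr_apply hf, toDistr_apply hg,
    ← integral_add (TF.integrable_mul hf φ) (TF.integrable_mul hg φ)]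
  simp only [mul_add]

lemma toDistr_const_mul {f : E3 → ℝ} (hf : LocallyIntegrable f) (c : ℝ) :
    toDistr (fun x => c * f x) = c • toDistr f := by
  ext φ
  change _ = c * toDistr f φ
  rw [toDistr_apply (f := fun x => c * f x) (hf.smul c), toDistr_apply hf, ← integral_const_mul]
  congr 1; ext x; ring

lemma toDistr_neg {f : E3 → ℝ} (hf : LocallyIntegrable f) :
    toDistr (fun x => - f x) = - toDistr f := by
  have := toDistr_const_mul hf (-1)
  simpa using this

lemma toDistr_sub {f g : E3 → ℝ} (hf : LocallyIntegrable f) (hg : LocallyIntegrable g) :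
    toDistr (fun x => f x - g x) = toDistr f - toDistr g := by
  simp only [sub_eq_add_neg]
  rw [toDistr_add (g := fun x => -g x) hf hg.neg, ← toDistr_neg hg]

lemma toDistr_zero : toDistr (fun _ => 0) = 0 := by
  have := toDistr_const_mul (f := fun _ => 0) (locallyIntegrable_const 0) 0
  simpa using this

lemma locallyIntegrable_sum {ι : Type*} (s : Finset ι) {f : ι → E3 → ℝ}
    (hf : ∀ i ∈ s, LocallyIntegrable (f i)) : LocallyIntegrable (fun x => ∑ i ∈ s, f i x) := by
  classical
  induction s using Finset.induction_on with
  | empty => simpa using (locallyIntegrable_const (0 : ℝ))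
  | insert a s ha ih =>
    simp only [Finset.sum_insert ha]
    exact (hf a (by simp)).add (ih fun i hi => hf i (by simp [hi]))

lemma toDistr_sum {ι : Type*} (s : Finset ι) {f : ι → E3 → ℝ}
    (hf : ∀ i ∈ s, LocallyIntegrable (f i)) :
    toDistr (fun x => ∑ i ∈ s, f i x) = ∑ i ∈ s, toDistr (f i) := by
  classical
  induction s using Finset.induction_on with
  | empty => simpa using toDistr_zero
  | insert a s ha ih =>
    simp only [Finset.sum_insert ha]
    rw [toDistr_add (hf a (by simp)) (locallyIntegrable_sum s fun i hi => hf i (by simp [hi])),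
      ih fun i hi => hf i (by simp [hi])]

lemma toDistr_congr {f g : E3 → ℝ} (hf : LocallyIntegrable f) (h : f =ᵐ[volume] g) :
    toDistr f = toDistr g := by
  have hg : LocallyIntegrable g := (locallyIntegrable_congr h).1 hf
  ext φ
  rw [toDistr_apply hf, toDistr_apply hg]
  exact integral_congr_ae (h.mono fun x hx => by simp [hx])

/-- A distribution given by a function determines it almost everywhere. -/
lemma ae_eq_of_toDistr_eq {f g : E3 → ℝ} (hf : LocallyIntegrable f) (hg : LocallyIntegrable g)
    (h : toDistr f = toDistr g) : f =ᵐ[volume] g := by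
  refine ae_eq_of_integral_contDiff_smul_eq hf hg fun φ hφ hc => ?_
  let ψ : TF := ⟨φ, hφ, hc, by simp⟩
  have := congrArg (fun T : Distr => T ψ) h
  simp only [toDistr_apply hf, toDistr_apply hg] at this
  exact this

/-! ### Reflection and convolution of test functions. -/

/-- A reflected translate `y ↦ β (x - y)` of a test function. -/
def reflect (β : TF) (x : E3) : TF :=
  ⟨fun y => β (x - y), β.contDiff.comp (contDiff_const.sub contDiff_id),
    β.hasCompactSupport.comp_homeomorph (Homeomorph.subLeft x), by simp⟩

@[simp] lemma TF.reflect_apply (β : TF) (x y : E3) : reflect β x y = β (x - y) := rfl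

lemma TF.D_reflect (i : Fin 3) (β : TF) (x : E3) :
    D i (reflect β x) = - reflect (D i β) x := by
  ext y
  rw [coe_D]
  change _ = - (D i β) (x - y)
  rw [coe_D]
  have h1 : HasFDerivAt β (fderiv ℝ β (x - y)) (x - y) :=
    (β.smooth.differentiable (by simp) _).hasFDerivAt
  have h2 : HasFDerivAt (fun y : E3 => x - y) (-ContinuousLinearMap.id ℝ E3) y :=
    (hasFDerivAt_id y).const_sub x
  have h3 := (h1.comp y h2).fderiv
  change fderiv ℝ (β ∘ fun y => x - y) y (e i) = - fderiv ℝ β (x - y) (e i)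
  rw [h3]; simp

open scoped Convolution in
/-- The convolution of two test functions. -/
def conv (β φ : TF) : TF :=
  ⟨(β : E3 → ℝ) ⋆[ContinuousLinearMap.lsmul ℝ ℝ, volume] φ,
    φ.hasCompactSupport.contDiff_convolution_right _ β.locallyIntegrable φ.contDiff,
    β.hasCompactSupport.convolution _ φ.hasCompactSupport, by simp⟩

lemma TF.conv_apply (β φ : TF) (x : E3) : conv β φ x = ∫ y, β y * φ (x - y) := rfl

lemma TF.conv_comm (β φ : TF) : conv β φ = conv φ β := by
  ext x
  rw [TF.conv_apply, TF.conv_apply, ← integral_sub_left_eq_self _ volume x]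
  congr 1; ext y; rw [mul_comm]; simp

lemma TF.D_conv_right (i : Fin 3) (β φ : TF) : D i (conv β φ) = conv β (D i φ) := by
  ext x
  rw [coe_D, TF.conv_apply]
  have := φ.hasCompactSupport.hasFDerivAt_convolution_right (ContinuousLinearMap.lsmul ℝ ℝ)
    β.locallyIntegrable (φ.smooth.of_le (by simp)) x
  change fderiv ℝ (conv β φ) x (e i) = _
  rw [show ⇑(conv β φ) = MeasureTheory.convolution β φ (ContinuousLinearMap.lsmul ℝ ℝ) volume
    from rfl, this.fderiv, convolution_precompR_apply _ β.locallyIntegrable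
    (φ.hasCompactSupport.fderiv ℝ) (φ.smooth.continuous_fderiv (by simp))]
  simp only [coe_D]
  rfl

lemma TF.D_conv_left (i : Fin 3) (β φ : TF) : D i (conv β φ) = conv (D i β) φ := by
  rw [TF.conv_comm, TF.D_conv_right, TF.conv_comm]

lemma TF.conv_sub_left (β β' φ : TF) : conv (β - β') φ = conv β φ - conv β' φ := by
  ext x
  rw [TF.conv_apply]
  change _ = conv β φ x - conv β' φ x
  have hI : ∀ b : TF, Integrable fun y => b y * φ (x - y) := fun b =>
    b.integrable_mul (TF.locallyIntegrable (reflect φ x))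
  rw [TF.conv_apply, TF.conv_apply, ← integral_sub (hI β) (hI β')]
  congr 1; ext y; change (β y - β' y) * _ = _; ring

lemma TF.conv_apply' (β φ : TF) (x : E3) : conv β φ x = ∫ y, φ y * β (x - y) := by
  rw [TF.conv_comm]; rfl

open scoped Pointwise in
/-- Fubini for the pairing of a convolution with a locally integrable function. -/
lemma TF.integral_conv_mul {f : E3 → ℝ} (hf : LocallyIntegrable f) (β φ : TF) :
    ∫ y, conv β φ y * f y = ∫ x, φ x * ∫ y, f y * β (y - x) := by
  have hK : IsCompact (tsupport φ + tsupport β) := φ.hasCompactSupport.isCompact.add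
    β.hasCompactSupport.isCompact
  have hsupp : ∀ x y, φ x * β (y - x) ≠ 0 → y ∈ tsupport φ + tsupport β := by
    intro x y h
    refine ⟨x, subset_tsupport _ (left_ne_zero_of_mul h), y - x,
      subset_tsupport _ (right_ne_zero_of_mul h), by simp⟩
  set K := tsupport φ + tsupport β
  have hfK : Integrable (K.indicator f) :=
    (integrable_indicator_iff hK.measurableSet).2 (hf.integrableOn_isCompact hK)
  have hprod : Integrable (fun z : E3 × E3 => φ z.1 * β (z.2 - z.1) * K.indicator f z.2)
      (volume.prod volume) := by
    obtain ⟨C, hC⟩ := β.continuous.bounded_above_of_compact_support β.hasCompactSupport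
    have h1 : Integrable (fun z : E3 × E3 => φ z.1 * K.indicator f z.2) (volume.prod volume) :=
      φ.integrable.mul_prod hfK
    refine (h1.bdd_mul (f := fun z : E3 × E3 => β (z.2 - z.1)) (c := C)
      (by fun_prop) (Filter.Eventually.of_forall fun z => hC _)).congr
      (Filter.Eventually.of_forall fun z => by simp only; ring)
  have hL : ∀ y, conv β φ y * f y = ∫ x, φ x * β (y - x) * K.indicator f y := by
    intro y
    rw [TF.conv_apply', ← integral_mul_const]
    congr 1; ext x
    by_cases h : φ x * β (y - x) = 0
    · simp [h]
    · rw [indicator_of_mem (hsupp x y h)]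
  have hR : ∀ x, φ x * ∫ y, f y * β (y - x) = ∫ y, φ x * β (y - x) * K.indicator f y := by
    intro x
    rw [← integral_const_mul]
    congr 1; ext y
    by_cases h : φ x * β (y - x) = 0
    · rw [h, zero_mul]; linear_combination f y * h
    · rw [indicator_of_mem (hsupp x y h)]; ring
  simp only [hL, hR]
  rw [integral_integral_swap]
  exact hprod.swap

/-! ### Radial functions and the regularized fundamental solution of the bilaplacian. -/

/-- The Laplacian of a function. -/
def lap (f : E3 → ℝ) : E3 → ℝ := fun x => ∑ i, pd i (pd i f) x

/-- The radial function with profile `F` in the variable `‖x‖²`. -/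
def radial (F : ℝ → ℝ) : E3 → ℝ := fun x => F (‖x‖ ^ 2)

/-- The action of the Laplacian on profiles of radial functions. -/
def lapProfile (F : ℝ → ℝ) : ℝ → ℝ := fun s => 6 * deriv F s + 4 * s * deriv (deriv F) s

lemma smooth_deriv {F : ℝ → ℝ} (hF : ContDiff ℝ ((⊤ : ℕ∞) : WithTop ℕ∞) F) :
    ContDiff ℝ ((⊤ : ℕ∞) : WithTop ℕ∞) (deriv F) := (contDiff_infty_iff_deriv.1 hF).2

lemma smooth_lapProfile {F : ℝ → ℝ} (hF : ContDiff ℝ ((⊤ : ℕ∞) : WithTop ℕ∞) F) :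
    ContDiff ℝ ((⊤ : ℕ∞) : WithTop ℕ∞) (lapProfile F) :=
  (contDiff_const.mul (smooth_deriv hF)).add
    ((contDiff_const.mul contDiff_id).mul (smooth_deriv (smooth_deriv hF)))

lemma smooth_radial {F : ℝ → ℝ} (hF : ContDiff ℝ ((⊤ : ℕ∞) : WithTop ℕ∞) F) :
    Smooth (radial F) := hF.comp (contDiff_norm_sq ℝ)

lemma pd_radial {F : ℝ → ℝ} (hF : Differentiable ℝ F) (i : Fin 3) :
    pd i (radial F) = fun x => 2 * x i * deriv F (‖x‖ ^ 2) := by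
  ext x
  have h := (hF (‖x‖ ^ 2)).hasDerivAt.comp_hasFDerivAt x (hasStrictFDerivAt_norm_sq x).hasFDerivAt
  change fderiv ℝ (F ∘ fun x : E3 => ‖x‖ ^ 2) x (e i) = _
  rw [h.fderiv]
  simp [e, EuclideanSpace.inner_single_right]
  ring

lemma lap_radial {F : ℝ → ℝ} (hF : ContDiff ℝ ((⊤ : ℕ∞) : WithTop ℕ∞) F) :
    lap (radial F) = radial (lapProfile F) := by
  have hd := smooth_deriv hF
  have h2 : ∀ i, pd i (pd i (radial F)) = fun x =>
      2 * deriv F (‖x‖ ^ 2) + 4 * x i ^ 2 * deriv (deriv F) (‖x‖ ^ 2) := by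
    intro i
    rw [pd_radial (hF.differentiable (by simp))]
    ext x
    have h := (hd.differentiable (by simp) (‖x‖ ^ 2)).hasDerivAt.comp_hasFDerivAt x
      (hasStrictFDerivAt_norm_sq x).hasFDerivAt
    have hx : HasFDerivAt (fun x : E3 => 2 * x i) ((2 : ℝ) • (EuclideanSpace.proj i : E3 →L[ℝ] ℝ)) x :=
      (EuclideanSpace.proj i : E3 →L[ℝ] ℝ).hasFDerivAt.const_mul 2
    have hm := (hx.mul h).fderiv
    change fderiv ℝ (fun x : E3 => 2 * x i * (deriv F ∘ fun x : E3 => ‖x‖ ^ 2) x) x (e i) = _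
    erw [hm]
    simp [e, EuclideanSpace.inner_single_right]
    ring
  ext x
  simp only [lap, h2, radial, lapProfile, Finset.sum_add_distrib, ← Finset.sum_mul,
    ← Finset.mul_sum, ← EuclideanSpace.real_norm_sq_eq]
  simp only [Finset.sum_const, Finset.card_univ, Fintype.card_fin, nsmul_eq_mul]
  push_cast
  ring

/-- The bilaplacian of a function. -/
def bilapFun (f : E3 → ℝ) : E3 → ℝ := fun x => ∑ a, ∑ b, pd a (pd a (pd b (pd b f))) x

lemma pd_sum {ι : Type*} (s : Finset ι) {f : ι → E3 → ℝ} (hf : ∀ j ∈ s, Smooth (f j)) (i : Fin 3) :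
    pd i (fun x => ∑ j ∈ s, f j x) = fun x => ∑ j ∈ s, pd i (f j) x := by
  ext x
  unfold pd
  rw [fderiv_fun_sum fun j hj => (hf j hj).differentiable (by simp) x]
  simp

lemma bilapFun_eq {f : E3 → ℝ} (hf : Smooth f) : bilapFun f = lap (lap f) := by
  ext x
  have h1 : ∀ i, pd i (lap f) = fun x => ∑ j, pd i (pd j (pd j f)) x := fun i =>
    pd_sum _ (fun j _ => contDiff_pd (contDiff_pd hf j) j) i
  have h2 : ∀ i, pd i (pd i (lap f)) = fun x => ∑ j, pd i (pd i (pd j (pd j f))) x := fun i => by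
    rw [h1]; exact pd_sum _ (fun j _ => contDiff_pd (contDiff_pd (contDiff_pd hf j) j) i) i
  simp only [lap, bilapFun]
  exact Finset.sum_congr rfl fun i _ => (congrFun (h2 i) x).symm

/-- A smooth profile equal to `√s` for `s ≥ 1/4`. -/
def sqrtProfile (s : ℝ) : ℝ := Real.smoothTransition (8 * s - 1) * s ^ (1 / 2 : ℝ)

lemma sqrtProfile_eq {s : ℝ} (hs : 1 / 4 ≤ s) : sqrtProfile s = s ^ (1 / 2 : ℝ) := by
  rw [sqrtProfile, Real.smoothTransition.one_of_one_le (by linarith), one_mul]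

lemma smooth_sqrtProfile : ContDiff ℝ ((⊤ : ℕ∞) : WithTop ℕ∞) sqrtProfile := by
  rw [contDiff_iff_contDiffAt]
  intro s
  rcases lt_or_ge s (1 / 8) with h | h
  -- The cutoff vanishes for `s ≤ 1/8`, so the singularity of the square root at the origin is never
  -- met.
  · refine contDiffAt_const (c := (0 : ℝ)) |>.congr_of_eventuallyEq ?_
    filter_upwards [Iio_mem_nhds h] with t ht
    rw [sqrtProfile, Real.smoothTransition.zero_of_nonpos (by linarith [mem_Iio.1 ht]), zero_mul]
  · have h0 : s ≠ 0 := by linarith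
    exact (Real.smoothTransition.contDiff.contDiffAt.comp s
      ((contDiffAt_const.mul contDiffAt_id).sub contDiffAt_const)).mul
      (Real.contDiffAt_rpow_const_of_ne h0)

/-- The factor `q (6 + 4 (q - 1))` is `2` at `q = 1/2` and `0` at `q = -1/2`. This encodes `Δ‖x‖ =
2/‖x‖` and the harmonicity of `1/‖x‖` away from the origin in dimension three. -/
lemma lapProfile_power {F : ℝ → ℝ} {c q : ℝ} (hF : ∀ s, 1 / 4 < s → F s = c * s ^ q) :
    ∀ s, 1 / 4 < s → lapProfile F s = c * q * (6 + 4 * (q - 1)) * s ^ (q - 1) := by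
  have h1 : ∀ s, 1 / 4 < s → deriv F s = c * q * s ^ (q - 1) := by
    intro s hs
    have he : F =ᶠ[nhds s] fun s => c * s ^ q := by
      filter_upwards [Ioi_mem_nhds hs] with t ht using hF t ht
    rw [he.deriv_eq, deriv_const_mul_field, Real.deriv_rpow_const]; ring
  intro s hs
  have he : deriv F =ᶠ[nhds s] fun s => c * q * s ^ (q - 1) := by
    filter_upwards [Ioi_mem_nhds hs] with t ht using h1 t ht
  rw [lapProfile, he.deriv_eq, h1 s hs, deriv_const_mul_field, Real.deriv_rpow_const,
    Real.rpow_sub_one (by linarith) (q - 1)]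
  field_simp

lemma lapProfile_sqrtProfile {s : ℝ} (hs : 1 / 4 < s) :
    lapProfile sqrtProfile s = 2 * s ^ (-1 / 2 : ℝ) := by
  rw [lapProfile_power (c := 1) (q := 1 / 2) (fun s hs => by rw [sqrtProfile_eq hs.le, one_mul]) s hs]
  norm_num

lemma lapProfile_lapProfile_sqrtProfile {s : ℝ} (hs : 1 / 4 < s) :
    lapProfile (lapProfile sqrtProfile) s = 0 := by
  rw [lapProfile_power (c := 2) (q := -1 / 2) (fun s hs => lapProfile_sqrtProfile hs) s hs]
  norm_num

/-- A smooth function equal to `‖x‖` for `‖x‖ ≥ 1/2`. -/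
def smoothNorm : E3 → ℝ := radial sqrtProfile

lemma smooth_smoothNorm : Smooth smoothNorm := smooth_radial smooth_sqrtProfile

lemma smoothNorm_eq {x : E3} (hx : 1 / 2 ≤ ‖x‖) : smoothNorm x = ‖x‖ := by
  rw [smoothNorm, radial, sqrtProfile_eq (by nlinarith), ← Real.sqrt_eq_rpow,
    Real.sqrt_sq (norm_nonneg x)]

lemma bilapFun_smoothNorm :
    bilapFun smoothNorm = radial (lapProfile (lapProfile sqrtProfile)) := by
  rw [bilapFun_eq smooth_smoothNorm, smoothNorm, lap_radial smooth_sqrtProfile,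
    lap_radial (smooth_lapProfile smooth_sqrtProfile)]

/-- A flux computation in polar coordinates: with `Y` the profile of the Laplacian, `r²` times the
integrand is the derivative of `2 r³ Y'(r²)`. This primitive is `0` at the origin and `-2` for large
`r`, so the integral depends only on the behaviour of `‖x‖` at infinity. -/
lemma integral_bilapFun_smoothNorm : ∫ x, bilapFun smoothNorm x ≠ 0 := by
  set Y := lapProfile sqrtProfile with hY
  have hYs : ContDiff ℝ ((⊤ : ℕ∞) : WithTop ℕ∞) Y := smooth_lapProfile smooth_sqrtProfile
  have hX : ContDiff ℝ ((⊤ : ℕ∞) : WithTop ℕ∞) (lapProfile Y) := smooth_lapProfile hYs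
  have hX0 : ∀ s, 1 / 4 < s → lapProfile Y s = 0 := fun s hs =>
    lapProfile_lapProfile_sqrtProfile hs
  have hY' : ∀ s, 1 / 4 < s → deriv Y s = - s ^ (-3 / 2 : ℝ) := by
    intro s hs
    have he : Y =ᶠ[nhds s] fun s => 2 * s ^ (-1 / 2 : ℝ) := by
      filter_upwards [Ioi_mem_nhds hs] with t ht using lapProfile_sqrtProfile ht
    rw [he.deriv_eq, deriv_const_mul_field, Real.deriv_rpow_const]
    norm_num
    ring
  have key : ∫ r in Ioi (0 : ℝ), r ^ 2 * lapProfile Y (r ^ 2) = -2 - 2 * 0 ^ 3 * deriv Y (0 ^ 2) := by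
    refine integral_Ioi_of_hasDerivAt_of_tendsto (f := fun r => 2 * r ^ 3 * deriv Y (r ^ 2))
      ?_ ?_ ?_ ?_
    · have := (smooth_deriv hYs).continuous
      exact Continuous.continuousWithinAt (by fun_prop)
    · intro r _
      have h1 := ((smooth_deriv hYs).differentiable (by simp) (r ^ 2)).hasDerivAt
      have h2 : HasDerivAt (fun r : ℝ => deriv Y (r ^ 2)) (deriv (deriv Y) (r ^ 2) * (2 * r)) r := by
        have := h1.comp (h := fun r : ℝ => r ^ 2) r (hasDerivAt_pow 2 r)
        exact this.congr_deriv (by simp)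
      have h3 : HasDerivAt (fun r : ℝ => 2 * r ^ 3) (2 * (3 * r ^ 2)) r := by
        simpa using (hasDerivAt_pow 3 r).const_mul 2
      refine (h3.mul h2).congr_deriv ?_
      rw [lapProfile]; ring
    · have hc : Continuous fun r : ℝ => r ^ 2 * lapProfile Y (r ^ 2) := by
        have := hX.continuous
        fun_prop
      refine (hc.integrable_of_hasCompactSupport ?_).integrableOn
      refine HasCompactSupport.intro (isCompact_Icc (a := (-1 : ℝ)) (b := 1)) fun r hr => ?_
      have : 1 / 4 < r ^ 2 := by
        rw [mem_Icc, not_and_or, not_le, not_le] at hr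
        rcases hr with h | h <;> nlinarith
      rw [hX0 _ this, mul_zero]
    · refine tendsto_const_nhds.congr' ?_
      filter_upwards [Filter.eventually_gt_atTop (1 : ℝ)] with r hr
      have h0 : (0 : ℝ) < r := by linarith
      rw [hY' _ (by nlinarith), ← Real.rpow_natCast r 2, ← Real.rpow_mul h0.le,
        ← Real.rpow_natCast r 3]
      have : r ^ ((3 : ℕ) : ℝ) * r ^ (((2 : ℕ) : ℝ) * (-3 / 2)) = 1 := by
        rw [← Real.rpow_add h0]; norm_num
      linear_combination 2 * this
  rw [bilapFun_smoothNorm]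
  have := integral_fun_norm_addHaar (volume : Measure E3)
    (fun r => lapProfile Y (r ^ 2))
  simp only [radial]
  rw [this]
  simp only [finrank_euclideanSpace, Fintype.card_fin, smul_eq_mul]
  norm_num at key ⊢
  rw [key]
  norm_num
  rw [Measure.real, ENNReal.toReal_eq_zero_iff]
  push Not
  exact ⟨(Metric.measure_ball_pos volume _ one_pos).ne', measure_ball_lt_top.ne⟩

/-! ### The truncated parametrix and its kernel bounds. -/

/-- The bilaplacian of a test function. -/
def bilap (φ : TF) : TF := ∑ a, ∑ b, D a (D a (D b (D b φ)))

lemma TF.sum_apply {ι : Type*} (s : Finset ι) (φ : ι → TF) (x : E3) :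
    (∑ j ∈ s, φ j) x = ∑ j ∈ s, φ j x := by
  classical
  induction s using Finset.induction_on with
  | empty => rfl
  | insert a s ha ih => rw [Finset.sum_insert ha, Finset.sum_insert ha, ← ih]; rfl

/-- A smooth function, a multiple of `‖x‖` for `‖x‖ ≥ 1/2`, whose bilaplacian has integral one. -/
def profile : E3 → ℝ := fun x => (∫ x, bilapFun smoothNorm x)⁻¹ * smoothNorm x

lemma smooth_profile : Smooth profile := contDiff_const.mul smooth_smoothNorm

lemma pd_const_mul_comp_smul {f : E3 → ℝ} (hf : Smooth f) (c r : ℝ) (i : Fin 3) :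
    pd i (fun x => c * f (r • x)) = fun x => c * r * pd i f (r • x) := by
  ext x
  unfold pd
  have hd : DifferentiableAt ℝ (fun x => f (r • x)) x :=
    (hf.differentiable (by simp) _).comp x (differentiableAt_id.const_smul r)
  rw [fderiv_const_mul hd, fderiv_comp_smul]
  simp [mul_assoc]

lemma pd_const_mul {f : E3 → ℝ} (hf : Smooth f) (c : ℝ) (i : Fin 3) :
    pd i (fun x => c * f x) = fun x => c * pd i f x := by
  simpa using pd_const_mul_comp_smul hf c 1 i

lemma pd_sub {f g : E3 → ℝ} (hf : Smooth f) (hg : Smooth g) (i : Fin 3) :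
    pd i (fun x => f x - g x) = fun x => pd i f x - pd i g x := by
  ext x
  unfold pd
  rw [fderiv_fun_sub (hf.differentiable (by simp) x) (hg.differentiable (by simp) x)]
  rfl

/-- `f` is positively homogeneous of degree `d` outside the ball of radius `1/2`. -/
def HomogeneousOutside (d : ℤ) (f : E3 → ℝ) : Prop :=
  ∀ x : E3, 1 / 2 < ‖x‖ → ∀ l : ℝ, 1 ≤ l → f (l • x) = l ^ d * f x

/-- The region `1/2 < ‖x‖` is open, so the homogeneity relation can be differentiated there; the
chain rule costs one factor `l`. -/
lemma HomogeneousOutside.pd {d : ℤ} {f : E3 → ℝ} (hs : Smooth f) (hf : HomogeneousOutside d f)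
    (i : Fin 3) : HomogeneousOutside (d - 1) (pd i f) := by
  intro x hx l hl
  have h0 : l ≠ 0 := by linarith
  have he : (fun y => 1 * f (l • y)) =ᶠ[nhds x] fun y => l ^ d * f y := by
    filter_upwards [(isOpen_lt continuous_const continuous_norm).mem_nhds hx] with y hy
    rw [one_mul, hf y hy l hl]
  have h1 : MorreyRegularity.pd i (fun y => 1 * f (l • y)) x
      = MorreyRegularity.pd i (fun y => l ^ d * f y) x := by
    unfold MorreyRegularity.pd
    rw [he.fderiv_eq]
  rw [pd_const_mul_comp_smul hs, pd_const_mul hs] at h1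
  rw [zpow_sub_one₀ h0]
  field_simp
  linarith

/-- Compactness handles the unit ball. Outside it, homogeneity along the ray through `x` reduces to
the unit sphere and the powers of `‖x‖` cancel. -/
lemma HomogeneousOutside.bound {n : ℕ} {f : E3 → ℝ} (hc : Continuous f)
    (hf : HomogeneousOutside (-n) f) : ∃ C, 0 ≤ C ∧ ∀ x, ‖x‖ ^ n * |f x| ≤ C := by
  obtain ⟨C, hC⟩ := (isCompact_closedBall (0 : E3) 1).exists_bound_of_continuousOn hc.continuousOn
  have hC0 : 0 ≤ C := (norm_nonneg _).trans (hC 0 (by simp))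
  refine ⟨C, hC0, fun x => ?_⟩
  rcases le_total ‖x‖ 1 with h | h
  · have h1 : ‖x‖ ^ n ≤ 1 := pow_le_one₀ (norm_nonneg _) h
    have h2 := hC x (by simpa using h)
    rw [Real.norm_eq_abs] at h2
    nlinarith [abs_nonneg (f x), pow_nonneg (norm_nonneg x) n]
  · have hx : ‖x‖ ≠ 0 := by linarith
    set u : E3 := ‖x‖⁻¹ • x
    have hu : ‖u‖ = 1 := by rw [norm_smul, norm_inv, norm_norm, inv_mul_cancel₀ hx]
    have h2 := hf u (by rw [hu]; norm_num) ‖x‖ h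
    rw [show ‖x‖ • u = x by rw [smul_smul, mul_inv_cancel₀ hx, one_smul]] at h2
    have h3 := hC u (by simp [hu])
    rw [Real.norm_eq_abs] at h3
    rw [h2, abs_mul, abs_of_nonneg (by positivity), ← mul_assoc, zpow_neg, zpow_natCast,
      mul_inv_cancel₀ (pow_ne_zero _ hx), one_mul]
    exact h3

lemma homogeneousOutside_profile : HomogeneousOutside 1 profile := by
  intro x hx l hl
  have h : ‖l • x‖ = l * ‖x‖ := by rw [norm_smul, Real.norm_of_nonneg (by linarith)]
  simp only [profile]
  rw [smoothNorm_eq hx.le, smoothNorm_eq (by rw [h]; nlinarith), h, zpow_one]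
  ring

/-- The dilate `t * profile (x / t)`. -/
def dilate (t : ℝ) : E3 → ℝ := fun x => t * profile (t⁻¹ • x)

lemma smooth_dilate (t : ℝ) : Smooth (dilate t) :=
  contDiff_const.mul (smooth_profile.comp (contDiff_const_smul _))

/-- The profile is homogeneous of degree one away from the origin, so dilation does not change it
outside the ball of radius `t`. Differences of two dilates therefore have compact support. -/
lemma dilate_eq {t : ℝ} (ht : 0 < t) {x : E3} (hx : t ≤ ‖x‖) :
    dilate t x = (∫ x, bilapFun smoothNorm x)⁻¹ * ‖x‖ := by
  have h : ‖t⁻¹ • x‖ = t⁻¹ * ‖x‖ := by rw [norm_smul, Real.norm_of_nonneg (by positivity)]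
  have h1 : 1 / 2 ≤ ‖t⁻¹ • x‖ := by
    rw [h]; have : 1 ≤ t⁻¹ * ‖x‖ := by rw [inv_mul_eq_div, one_le_div ht]; exact hx
    linarith
  simp only [dilate, profile]
  rw [smoothNorm_eq h1, h]
  field_simp

/-- The parametrix of the bilaplacian truncated to the scales between `ε` and `R`. -/
def kern (ε R : ℝ) : TF :=
  if h : 0 < ε ∧ ε ≤ R then
    ⟨fun x => dilate ε x - dilate R x, (smooth_dilate ε).sub (smooth_dilate R),
      HasCompactSupport.intro (isCompact_closedBall (0 : E3) R) fun x hx => by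
        rw [Metric.mem_closedBall, dist_zero_right, not_le] at hx
        rw [dilate_eq h.1 (h.2.trans hx.le), dilate_eq (h.1.trans_le h.2) hx.le, sub_self], by simp⟩
  else 0

lemma coe_kern {ε R : ℝ} (hε : 0 < ε) (hR : ε ≤ R) :
    ⇑(kern ε R) = fun x => dilate ε x - dilate R x := by
  rw [kern, dif_pos ⟨hε, hR⟩]; rfl

lemma bilapFun_profile : bilapFun profile = radial (fun s =>
    (∫ x, bilapFun smoothNorm x)⁻¹ * lapProfile (lapProfile sqrtProfile) s) := by
  have h : bilapFun profile = fun x => (∫ x, bilapFun smoothNorm x)⁻¹ * bilapFun smoothNorm x := by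
    ext x
    have hs := smooth_smoothNorm
    have h4 : ∀ a b, pd a (pd a (pd b (pd b profile))) = fun x =>
        (∫ x, bilapFun smoothNorm x)⁻¹ * pd a (pd a (pd b (pd b smoothNorm))) x := by
      intro a b
      unfold profile
      rw [pd_const_mul hs, pd_const_mul (contDiff_pd hs b),
        pd_const_mul (contDiff_pd (contDiff_pd hs b) b),
        pd_const_mul (contDiff_pd (contDiff_pd (contDiff_pd hs b) b) a)]
    simp only [bilapFun, h4, Finset.mul_sum]
  rw [h, bilapFun_smoothNorm]; rfl

lemma smooth_bilapFun {f : E3 → ℝ} (hf : Smooth f) : Smooth (bilapFun f) :=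
  ContDiff.sum fun a _ => ContDiff.sum fun b _ =>
    contDiff_pd (contDiff_pd (contDiff_pd (contDiff_pd hf b) b) a) a

lemma bilapFun_profile_eq_zero {x : E3} (hx : 1 ≤ ‖x‖) : bilapFun profile x = 0 := by
  rw [bilapFun_profile, radial, lapProfile_lapProfile_sqrtProfile (by nlinarith), mul_zero]

lemma integral_bilapFun_profile : ∫ x, bilapFun profile x = 1 := by
  have := integral_bilapFun_smoothNorm
  rw [bilapFun_profile]
  change ∫ x, (∫ x, bilapFun smoothNorm x)⁻¹ * radial (lapProfile (lapProfile sqrtProfile)) x = 1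
  rw [integral_const_mul, ← bilapFun_smoothNorm, inv_mul_cancel₀ this]

lemma norm_inv_smul {t : ℝ} (ht : 0 < t) (x : E3) : ‖t⁻¹ • x‖ = ‖x‖ / t := by
  rw [norm_smul, Real.norm_of_nonneg (by positivity), inv_mul_eq_div]

lemma bilapFun_profile_scaled_eq_zero {t : ℝ} (ht : 0 < t) {x : E3} (hx : t ≤ ‖x‖) :
    t⁻¹ ^ 3 * bilapFun profile (t⁻¹ • x) = 0 := by
  rw [bilapFun_profile_eq_zero, mul_zero]
  rwa [norm_inv_smul ht, one_le_div ht]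

/-- The normalized mollifier at scale `t`. -/
def chi (t : ℝ) : TF :=
  if h : 0 < t then
    ⟨fun x => t⁻¹ ^ 3 * bilapFun profile (t⁻¹ • x),
      contDiff_const.mul ((smooth_bilapFun smooth_profile).comp (contDiff_const_smul _)),
      HasCompactSupport.intro (isCompact_closedBall (0 : E3) t) fun x hx => by
        rw [Metric.mem_closedBall, dist_zero_right, not_le] at hx
        exact bilapFun_profile_scaled_eq_zero h hx.le, by simp⟩
  else 0

lemma coe_chi {t : ℝ} (ht : 0 < t) :
    ⇑(chi t) = fun x => t⁻¹ ^ 3 * bilapFun profile (t⁻¹ • x) := by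
  rw [chi, dif_pos ht]; rfl

lemma chi_eq_zero {t : ℝ} (ht : 0 < t) {x : E3} (hx : t ≤ ‖x‖) : chi t x = 0 := by
  rw [coe_chi ht]; exact bilapFun_profile_scaled_eq_zero ht hx

lemma chi_neg (t : ℝ) (x : E3) : chi t (-x) = chi t x := by
  by_cases ht : 0 < t
  · rw [coe_chi ht, bilapFun_profile]; simp [radial]
  · rw [chi, dif_neg ht]; rfl

lemma integral_chi {t : ℝ} (ht : 0 < t) : ∫ x, chi t x = 1 := by
  rw [coe_chi ht, integral_const_mul, Measure.integral_comp_inv_smul_of_nonneg volume _ ht.le,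
    integral_bilapFun_profile]
  simp [ht.ne']

lemma tsupport_subset_closedBall {f : E3 → ℝ} {R : ℝ} (h : ∀ x : E3, R < ‖x‖ → f x = 0) :
    tsupport f ⊆ Metric.closedBall 0 R := by
  refine closure_minimal (fun x hx => ?_) Metric.isClosed_closedBall
  rw [Metric.mem_closedBall, dist_zero_right]
  by_contra hR
  exact hx (h x (not_le.1 hR))

lemma tsupport_D_subset (i : Fin 3) (φ : TF) : tsupport (D i φ) ⊆ tsupport φ := by
  rw [coe_D]
  refine closure_minimal (fun x hx => ?_) (isClosed_tsupport _)
  refine tsupport_fderiv_subset ℝ (subset_tsupport _ fun h => hx ?_)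
  simp [pd, h]

lemma D_eq_zero_of_norm {φ : TF} {R : ℝ} (h : ∀ x : E3, R < ‖x‖ → φ x = 0) (i : Fin 3) :
    ∀ x : E3, R < ‖x‖ → D i φ x = 0 := by
  intro x hx
  by_contra h0
  have := tsupport_subset_closedBall h (tsupport_D_subset i φ (subset_tsupport _ h0))
  rw [Metric.mem_closedBall, dist_zero_right] at this
  linarith

lemma exists_bound_chi : ∃ C : ℝ, 0 < C ∧ ∀ t : ℝ, 0 < t → ∀ x, |chi t x| ≤ C * t⁻¹ ^ 3 := by
  obtain ⟨C, hC⟩ := (isCompact_closedBall (0 : E3) 1).exists_bound_of_continuousOn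
    (smooth_bilapFun smooth_profile).continuous.continuousOn
  have hC0 : 0 ≤ C := (norm_nonneg _).trans (hC 0 (by simp))
  refine ⟨C + 1, by positivity, fun t ht x => ?_⟩
  rw [coe_chi ht, abs_mul, abs_of_nonneg (by positivity), mul_comm]
  gcongr
  rcases le_total ‖t⁻¹ • x‖ 1 with h | h
  · exact (hC _ (by simpa using h)).trans (by linarith)
  · rw [bilapFun_profile_eq_zero h]; simp; positivity

lemma exists_bound_D_chi :
    ∃ C : ℝ, 0 < C ∧ ∀ t : ℝ, 0 < t → ∀ i x, |D i (chi t) x| ≤ C * t⁻¹ ^ 4 := by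
  have h : ∀ i, ∃ C, ∀ x, |pd i (bilapFun profile) x| ≤ C := by
    intro i
    obtain ⟨C, hC⟩ := (D i (chi 1)).continuous.bounded_above_of_compact_support
      (D i (chi 1)).hasCompactSupport
    refine ⟨C, fun x => ?_⟩
    have := hC x
    rw [coe_D, coe_chi one_pos] at this
    simpa using this
  choose C hC using h
  refine ⟨1 + ∑ i, |C i|, by positivity, fun t ht i x => ?_⟩
  rw [coe_D, coe_chi ht, pd_const_mul_comp_smul (smooth_bilapFun smooth_profile), abs_mul,
    abs_of_nonneg (by positivity), ← pow_succ, mul_comm]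
  gcongr
  have h1 : |C i| ≤ ∑ i, |C i| :=
    Finset.single_le_sum (f := fun i => |C i|) (fun _ _ => abs_nonneg _) (Finset.mem_univ i)
  linarith [hC i (t⁻¹ • x), le_abs_self (C i)]

lemma volume_ball_eq (x : E3) {r : ℝ} (hr : 0 ≤ r) :
    volume (Metric.ball x r) = ENNReal.ofReal (r ^ 3) * volume (Metric.ball (0 : E3) 1) := by
  rw [Measure.addHaar_ball _ _ hr]; simp

lemma exists_integral_abs_chi_le : ∃ C : ℝ, 0 < C ∧ ∀ t : ℝ, 0 < t → ∫ x, |chi t x| ≤ C := by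
  refine ⟨1 + ∫ x, |bilapFun profile x|, by positivity, fun t ht => ?_⟩
  rw [coe_chi ht]
  simp only [abs_mul]
  rw [integral_const_mul,
    Measure.integral_comp_inv_smul_of_nonneg volume (fun x => |bilapFun profile x|) ht.le]
  rw [finrank_euclideanSpace, Fintype.card_fin, smul_eq_mul, ← mul_assoc,
    abs_of_nonneg (by positivity), ← mul_pow, inv_mul_cancel₀ ht.ne']
  simp

lemma pd_dilate_three (t : ℝ) (i j k : Fin 3) :
    pd i (pd j (pd k (dilate t))) =
      fun x => t * t⁻¹ ^ 3 * pd i (pd j (pd k profile)) (t⁻¹ • x) := by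
  have hs := smooth_profile
  unfold dilate
  rw [pd_const_mul_comp_smul hs, pd_const_mul_comp_smul (contDiff_pd hs k),
    pd_const_mul_comp_smul (contDiff_pd (contDiff_pd hs k) j)]
  ext x; ring

lemma pd_dilate_four (t : ℝ) (i j k l : Fin 3) :
    pd i (pd j (pd k (pd l (dilate t)))) =
      fun x => t * t⁻¹ ^ 4 * pd i (pd j (pd k (pd l profile))) (t⁻¹ • x) := by
  rw [pd_dilate_three, pd_const_mul_comp_smul
    (contDiff_pd (contDiff_pd (contDiff_pd smooth_profile l) k) j)]
  ext x; ring

lemma coe_D_three_kern {ε R : ℝ} (hε : 0 < ε) (hR : ε ≤ R) (i j k : Fin 3) :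
    ⇑(D i (D j (D k (kern ε R)))) = fun x => pd i (pd j (pd k (dilate ε))) x
      - pd i (pd j (pd k (dilate R))) x := by
  have h1 := smooth_dilate ε
  have h2 := smooth_dilate R
  rw [coe_D, coe_D, coe_D, coe_kern hε hR, pd_sub h1 h2, pd_sub (contDiff_pd h1 k)
    (contDiff_pd h2 k), pd_sub (contDiff_pd (contDiff_pd h1 k) j) (contDiff_pd (contDiff_pd h2 k) j)]

lemma coe_D_four_kern {ε R : ℝ} (hε : 0 < ε) (hR : ε ≤ R) (i j k l : Fin 3) :
    ⇑(D i (D j (D k (D l (kern ε R))))) = fun x => pd i (pd j (pd k (pd l (dilate ε)))) x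
      - pd i (pd j (pd k (pd l (dilate R)))) x := by
  rw [coe_D, coe_D_three_kern hε hR, pd_sub
    (contDiff_pd (contDiff_pd (contDiff_pd (smooth_dilate ε) l) k) j)
    (contDiff_pd (contDiff_pd (contDiff_pd (smooth_dilate R) l) k) j)]

/-- Four derivatives of `t * profile (x / t)` produce `t * t⁻⁴ = t⁻³`, the normalization of a
mollifier. Bilaplacians of the parametrix are thus differences of mollifiers at two scales, which is
how the equation is compared with the identity throughout. -/
lemma bilap_kern {ε R : ℝ} (hε : 0 < ε) (hR : ε ≤ R) : bilap (kern ε R) = chi ε - chi R := by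
  ext x
  have h : ∀ t : ℝ, 0 < t → ∑ a, ∑ b, pd a (pd a (pd b (pd b (dilate t)))) x = chi t x := by
    intro t ht
    simp only [pd_dilate_four, ← Finset.mul_sum, coe_chi ht]
    simp only [bilapFun]
    field_simp
  change _ = chi ε x - chi R x
  rw [← h ε hε, ← h R (hε.trans_le hR)]
  simp only [bilap, TF.sum_apply, coe_D_four_kern hε hR, Finset.sum_sub_distrib]

lemma kern_eq_zero {ε R : ℝ} {x : E3} (hx : R < ‖x‖) : kern ε R x = 0 := by
  by_cases h : 0 < ε ∧ ε ≤ R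
  · rw [coe_kern h.1 h.2]
    simp only
    rw [dilate_eq h.1 (h.2.trans hx.le), dilate_eq (h.1.trans_le h.2) hx.le, sub_self]
  · rw [kern, dif_neg h]; rfl

/-- A bound `‖x‖ⁿ |f| ≤ C` is invariant under the scaling obeyed by derivatives of order `n + 1` of
the dilates. This makes the kernel bounds uniform in both truncation scales. -/
lemma scaled_bound {n : ℕ} {f : E3 → ℝ} {C : ℝ} (hf : ∀ x, ‖x‖ ^ n * |f x| ≤ C) {t : ℝ}
    (ht : 0 < t) (x : E3) : ‖x‖ ^ n * |t * t⁻¹ ^ (n + 1) * f (t⁻¹ • x)| ≤ C := by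
  have h := hf (t⁻¹ • x)
  rw [norm_inv_smul ht] at h
  rw [abs_mul, abs_of_nonneg (by positivity)]
  refine le_trans (le_of_eq ?_) h
  rw [pow_succ, div_pow, inv_pow]
  field_simp

/-- The third derivatives of the truncated parametrix are bounded by `C / ‖x‖²`. -/
lemma exists_bound_D_three_kern : ∃ C : ℝ, 0 < C ∧ ∀ ε R : ℝ, 0 < ε → ε ≤ R → ∀ i j k x,
    ‖x‖ ^ 2 * |D i (D j (D k (kern ε R))) x| ≤ C := by
  have hs := smooth_profile
  have h : ∀ s : Fin 3 × Fin 3 × Fin 3, ∃ C, 0 ≤ C ∧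
      ∀ x, ‖x‖ ^ 2 * |pd s.1 (pd s.2.1 (pd s.2.2 profile)) x| ≤ C := by
    rintro ⟨i, j, k⟩
    have s2 := contDiff_pd (contDiff_pd hs k) j
    refine HomogeneousOutside.bound (contDiff_pd s2 i).continuous ?_
    exact HomogeneousOutside.pd s2 (HomogeneousOutside.pd (contDiff_pd hs k)
      (HomogeneousOutside.pd hs homogeneousOutside_profile k) j) i
  choose C hC0 hC using h
  -- The factor `2` counts the two dilates in `kern`; the `1` makes the constant positive.
  refine ⟨2 * ∑ s, C s + 1, ?_, fun ε R hε hR i j k x => ?_⟩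
  · have : 0 ≤ ∑ s, C s := Finset.sum_nonneg fun s _ => hC0 s
    linarith
  have hle : C (i, j, k) ≤ ∑ s, C s :=
    Finset.single_le_sum (f := C) (fun s _ => hC0 s) (Finset.mem_univ _)
  have h1 := scaled_bound (hC (i, j, k)) hε x
  have h2 := scaled_bound (hC (i, j, k)) (hε.trans_le hR) x
  rw [coe_D_three_kern hε hR, pd_dilate_three, pd_dilate_three]
  refine (mul_le_mul_of_nonneg_left (abs_sub _ _) (by positivity)).trans ?_
  rw [mul_add]
  linarith

/-- The fourth derivatives of the truncated parametrix are bounded by `C / ‖x‖³`. -/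
lemma exists_bound_D_four_kern : ∃ C : ℝ, 0 < C ∧ ∀ ε R : ℝ, 0 < ε → ε ≤ R → ∀ i j k l x,
    ‖x‖ ^ 3 * |D i (D j (D k (D l (kern ε R)))) x| ≤ C := by
  have hs := smooth_profile
  have h : ∀ s : Fin 3 × Fin 3 × Fin 3 × Fin 3, ∃ C, 0 ≤ C ∧
      ∀ x, ‖x‖ ^ 3 * |pd s.1 (pd s.2.1 (pd s.2.2.1 (pd s.2.2.2 profile))) x| ≤ C := by
    rintro ⟨i, j, k, l⟩
    have s2 := contDiff_pd (contDiff_pd hs l) k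
    refine HomogeneousOutside.bound (contDiff_pd (contDiff_pd s2 j) i).continuous ?_
    exact HomogeneousOutside.pd (contDiff_pd s2 j) (HomogeneousOutside.pd s2
      (HomogeneousOutside.pd (contDiff_pd hs l)
      (HomogeneousOutside.pd hs homogeneousOutside_profile l) k) j) i
  choose C hC0 hC using h
  refine ⟨2 * ∑ s, C s + 1, ?_, fun ε R hε hR i j k l x => ?_⟩
  · have : 0 ≤ ∑ s, C s := Finset.sum_nonneg fun s _ => hC0 s
    linarith
  have hle : C (i, j, k, l) ≤ ∑ s, C s :=
    Finset.single_le_sum (f := C) (fun s _ => hC0 s) (Finset.mem_univ _)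
  have h1 := scaled_bound (hC (i, j, k, l)) hε x
  have h2 := scaled_bound (hC (i, j, k, l)) (hε.trans_le hR) x
  rw [coe_D_four_kern hε hR, pd_dilate_four, pd_dilate_four]
  refine (mul_le_mul_of_nonneg_left (abs_sub _ _) (by positivity)).trans ?_
  rw [mul_add]
  linarith

/-! ### Finite order of distributions and convergence of mollifications. -/

/-- A distribution has finite order on each compact set. -/
lemma exists_order_bound (T : Distr) (K : TopologicalSpace.Compacts E3) :
    ∃ (N : ℕ) (C : ℝ), 0 ≤ C ∧ ∀ ψ : TF, tsupport ψ ⊆ K → ∀ B : ℝ, 0 ≤ B →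
      (∀ i ≤ N, ∀ x, ‖iteratedFDeriv ℝ i ψ x‖ ≤ B) → |T ψ| ≤ C * B := by
  have hK : (K : Set E3) ⊆ (⊤ : TopologicalSpace.Opens E3) := fun _ _ => trivial
  -- Restricted to functions supported in `K`, the absolute value of `T` is a continuous seminorm,
  -- so finitely many of the derivative seminorms dominate it.
  let A : 𝓓^{(⊤ : ℕ∞)}_{K}(E3, ℝ) →L[ℝ] ℝ :=
    (T : TF →L[ℝ] ℝ).comp (TestFunction.ofSupportedInCLM ℝ hK)
  let q : Seminorm ℝ 𝓓^{(⊤ : ℕ∞)}_{K}(E3, ℝ) := (normSeminorm ℝ ℝ).comp A.toLinearMap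
  have hq : Continuous q := continuous_norm.comp A.continuous
  obtain ⟨s, C, -, hC⟩ := Seminorm.bound_of_continuous
    (ContDiffMapSupportedIn.withSeminorms ℝ E3 ℝ ⊤ K) q hq
  refine ⟨s.sup id, C, C.2, fun ψ hψ B hB h => ?_⟩
  let f : 𝓓^{(⊤ : ℕ∞)}_{K}(E3, ℝ) :=
    ContDiffMapSupportedIn.of_support_subset ψ.contDiff ((subset_tsupport _).trans hψ)
  have h1 : q f = |T ψ| := rfl
  rw [← h1]
  refine (hC f).trans ?_
  change (C : ℝ) * (s.sup (ContDiffMapSupportedIn.seminorm ℝ E3 ℝ ⊤ K)) f ≤ C * B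
  gcongr
  refine Seminorm.finset_sup_apply_le hB fun i hi => ?_
  rw [ContDiffMapSupportedIn.seminorm_top_le_iff ℝ hB]
  exact fun x _ => h i (Finset.le_sup (f := id) hi) x

open scoped Convolution

lemma fderiv_smul_convolution {F : Type} [NormedAddCommGroup F] [NormedSpace ℝ F]
    {f : E3 → ℝ} (hf : LocallyIntegrable f) {g : E3 → F}
    (hg : ContDiff ℝ ((⊤ : ℕ∞) : WithTop ℕ∞) g) (hc : HasCompactSupport g) (x : E3) :
    HasFDerivAt (f ⋆[ContinuousLinearMap.lsmul ℝ ℝ, volume] g)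
      ((f ⋆[ContinuousLinearMap.lsmul ℝ ℝ, volume] (fderiv ℝ g)) x) x := by
  have := hc.hasFDerivAt_convolution_right (ContinuousLinearMap.lsmul ℝ ℝ) hf
    (hg.of_le (by simp)) x
  exact this

/-- All derivatives fall on `g`. The target space is quantified after `i` because the induction
passes from `g` to `fderiv ℝ g`, which takes values in another space. -/
lemma exists_bound_iteratedFDeriv_convolution (i : ℕ) :
    ∀ {F : Type} [NormedAddCommGroup F] [NormedSpace ℝ F] [CompleteSpace F] {g : E3 → F},
      ContDiff ℝ ((⊤ : ℕ∞) : WithTop ℕ∞) g → HasCompactSupport g →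
      ∃ C : ℝ, 0 ≤ C ∧ ∀ f : TF, ∀ x,
        ‖iteratedFDeriv ℝ i ((f : E3 → ℝ) ⋆[ContinuousLinearMap.lsmul ℝ ℝ, volume] g) x‖
          ≤ C * ∫ y, |f y| := by
  induction i with
  | zero =>
    intro F _ _ _ g hg hc
    obtain ⟨C, hC⟩ := hg.continuous.bounded_above_of_compact_support hc
    have hC0 : 0 ≤ C := (norm_nonneg _).trans (hC 0)
    refine ⟨C, hC0, fun f x => ?_⟩
    rw [norm_iteratedFDeriv_zero, convolution_def, ← integral_const_mul]
    refine norm_integral_le_of_norm_le ((TF.integrable f).abs.const_mul C)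
      (Filter.Eventually.of_forall fun y => ?_)
    simp only [ContinuousLinearMap.lsmul_apply, norm_smul, Real.norm_eq_abs]
    rw [mul_comm]
    exact mul_le_mul_of_nonneg_right (hC _) (abs_nonneg _)
  | succ i ih =>
    intro F _ _ _ g hg hc
    obtain ⟨C, hC0, hC⟩ := ih (hg.fderiv_right (m := (⊤ : ℕ∞)) (by simp)) (hc.fderiv ℝ)
    refine ⟨C, hC0, fun f x => ?_⟩
    rw [← norm_iteratedFDeriv_fderiv]
    have : fderiv ℝ ((f : E3 → ℝ) ⋆[ContinuousLinearMap.lsmul ℝ ℝ, volume] g)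
        = (f : E3 → ℝ) ⋆[ContinuousLinearMap.lsmul ℝ ℝ, volume] (fderiv ℝ g) :=
      funext fun x => (fderiv_smul_convolution (TF.locallyIntegrable f) hg hc x).fderiv
    rw [this]
    exact hC f x

/-- At order zero, `chi ε` has integral one, uniformly bounded `L¹` norm and support in the ball of
radius `ε`, while `g` is Lipschitz. Higher orders follow by applying this to the derivatives of `g`.
-/
lemma exists_bound_iteratedFDeriv_chi_convolution_sub (i : ℕ) :
    ∀ {F : Type} [NormedAddCommGroup F] [NormedSpace ℝ F] [CompleteSpace F] {g : E3 → F},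
      ContDiff ℝ ((⊤ : ℕ∞) : WithTop ℕ∞) g → HasCompactSupport g →
      ∃ C : ℝ, 0 ≤ C ∧ ∀ ε : ℝ, 0 < ε → ∀ x,
        ‖iteratedFDeriv ℝ i (fun x =>
          ((chi ε : E3 → ℝ) ⋆[ContinuousLinearMap.lsmul ℝ ℝ, volume] g) x - g x) x‖ ≤ C * ε := by
  induction i with
  | zero =>
    intro F _ _ _ g hg hc
    obtain ⟨L, hL⟩ := ContDiff.lipschitzWith_of_hasCompactSupport hc hg (by simp)
    obtain ⟨C, hC0, hC⟩ := exists_integral_abs_chi_le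
    refine ⟨L * C, by positivity, fun ε hε x => ?_⟩
    have h1 : Integrable fun y => chi ε y • g (x - y) :=
      (hc.convolutionExists_right (ContinuousLinearMap.lsmul ℝ ℝ) (TF.locallyIntegrable (chi ε))
        hg.continuous x).integrable
    have h2 : g x = ∫ y, chi ε y • g x := by
      rw [integral_smul_const, integral_chi hε, one_smul]
    rw [norm_iteratedFDeriv_zero, convolution_def]
    simp only [ContinuousLinearMap.lsmul_apply]
    rw [show ∀ v : F, v - g x = v - ∫ y, chi ε y • g x from fun v => by rw [← h2]]
    rw [← integral_sub h1 ((TF.integrable (chi ε)).smul_const _)]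
    refine (norm_integral_le_of_norm_le ((TF.integrable (chi ε)).abs.const_mul (L * ε))
      (Filter.Eventually.of_forall fun y => ?_)).trans ?_
    · rw [← smul_sub, norm_smul, Real.norm_eq_abs, mul_comm]
      rcases le_or_gt ε ‖y‖ with h | h
      · rw [chi_eq_zero hε h]; simp
      · gcongr
        refine (hL.norm_sub_le _ _).trans ?_
        rw [sub_sub_cancel_left, norm_neg]
        gcongr
    · rw [integral_const_mul]
      have := hC ε hε
      have hL0 : (0 : ℝ) ≤ L * ε := by positivity
      nlinarith
  | succ i ih =>
    intro F _ _ _ g hg hc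
    obtain ⟨C, hC0, hC⟩ := ih (hg.fderiv_right (m := (⊤ : ℕ∞)) (by simp)) (hc.fderiv ℝ)
    refine ⟨C, hC0, fun ε hε x => ?_⟩
    rw [← norm_iteratedFDeriv_fderiv]
    have : fderiv ℝ (fun x =>
        ((chi ε : E3 → ℝ) ⋆[ContinuousLinearMap.lsmul ℝ ℝ, volume] g) x - g x)
        = fun x => ((chi ε : E3 → ℝ) ⋆[ContinuousLinearMap.lsmul ℝ ℝ, volume] (fderiv ℝ g)) x
          - fderiv ℝ g x := funext fun x =>
      ((fderiv_smul_convolution (TF.locallyIntegrable (chi ε)) hg hc x).sub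
        (hg.differentiable (by simp) x).hasFDerivAt).fderiv
    rw [this]
    exact hC ε hε x

lemma conv_eq_zero {β φ : TF} {x₀ : E3} {R r : ℝ} (hβ : ∀ x : E3, R < ‖x‖ → β x = 0)
    (hφ : ∀ x : E3, r < ‖x - x₀‖ → φ x = 0) {x : E3} (hx : R + r < ‖x - x₀‖) : conv β φ x = 0 := by
  rw [TF.conv_apply]
  refine integral_eq_zero_of_ae (Filter.Eventually.of_forall fun y => ?_)
  rcases lt_or_ge R ‖y‖ with h | h
  · simp [hβ y h]
  · have : r < ‖x - y - x₀‖ := by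
      have := norm_sub_norm_le (x - x₀) y
      rw [sub_right_comm]
      linarith
    simp [hφ _ this]

lemma TF.exists_radius (φ : TF) : ∃ r : ℝ, 0 < r ∧ ∀ x : E3, r < ‖x‖ → φ x = 0 := by
  obtain ⟨r, hr⟩ := φ.hasCompactSupport.isCompact.isBounded.subset_closedBall (0 : E3)
  refine ⟨max r 1, by positivity, fun x hx => ?_⟩
  by_contra h
  have := hr (subset_tsupport _ h)
  rw [Metric.mem_closedBall, dist_zero_right] at this
  linarith [le_max_left r 1]

/-- Mollification of test functions converges against every distribution. -/
lemma tendsto_apply_conv_chi (T : Distr) (φ : TF) :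
    Filter.Tendsto (fun ε => T (conv (chi ε) φ)) (nhdsWithin 0 (Ioi 0)) (nhds (T φ)) := by
  obtain ⟨r, hr0, hr⟩ := φ.exists_radius
  obtain ⟨N, C, hC0, hC⟩ := exists_order_bound T ⟨Metric.closedBall 0 (1 + r),
    isCompact_closedBall _ _⟩
  choose A hA0 hA using fun i => exists_bound_iteratedFDeriv_chi_convolution_sub i φ.smooth
    φ.hasCompactSupport
  -- Taking `ε < 1` keeps every support in the ball of radius `1 + r`, where a single order bound
  -- applies.
  have hmain : ∀ ε ∈ Ioo (0 : ℝ) 1, |T (conv (chi ε) φ) - T φ|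
      ≤ C * ((∑ i ∈ Finset.range (N + 1), A i) * ε) := by
    intro ε hε
    rw [← map_sub]
    have hs : (0 : ℝ) ≤ ∑ i ∈ Finset.range (N + 1), A i := Finset.sum_nonneg fun i _ => hA0 i
    refine hC _ (tsupport_subset_closedBall fun x hx => ?_) _ (mul_nonneg hs hε.1.le) ?_
    · change conv (chi ε) φ x - φ x = 0
      rw [hr x (by linarith), conv_eq_zero (x₀ := 0) (R := 1) (r := r) (fun y hy => chi_eq_zero hε.1
        (by linarith [hε.2])) (fun y hy => hr y (by simpa using hy)) (by simpa using hx), sub_zero]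
    · intro i hi x
      refine (hA i ε hε.1 x).trans ?_
      gcongr
      · exact hε.1.le
      · exact Finset.single_le_sum (f := A) (fun i _ => hA0 i) (Finset.mem_range.2 (by omega))
  rw [tendsto_iff_dist_tendsto_zero]
  refine squeeze_zero' (Filter.Eventually.of_forall fun _ => dist_nonneg)
    (g := fun ε => C * ((∑ i ∈ Finset.range (N + 1), A i) * ε)) ?_ ?_
  · filter_upwards [Ioo_mem_nhdsGT (zero_lt_one' ℝ)] with ε hε
    exact hmain ε hε
  · have : Continuous fun ε : ℝ => C * ((∑ i ∈ Finset.range (N + 1), A i) * ε) := by fun_prop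
    have h := this.tendsto 0
    simp only [mul_zero] at h
    exact h.mono_left nhdsWithin_le_nhds

/-- Testing a distribution with `β * φ` is bounded by the `L¹` norm of `φ`. -/
lemma exists_bound_apply_conv (T : Distr) (β : TF) (r : ℝ) :
    ∃ C : ℝ, 0 ≤ C ∧ ∀ φ : TF, (∀ x : E3, r < ‖x‖ → φ x = 0) →
      |T (conv β φ)| ≤ C * ∫ x, |φ x| := by
  obtain ⟨R, hR0, hR⟩ := β.exists_radius
  obtain ⟨N, C, hC0, hC⟩ := exists_order_bound T ⟨Metric.closedBall 0 (R + r),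
    isCompact_closedBall _ _⟩
  choose A hA0 hA using fun i => exists_bound_iteratedFDeriv_convolution i β.smooth
    β.hasCompactSupport
  have hs : (0 : ℝ) ≤ ∑ i ∈ Finset.range (N + 1), A i := Finset.sum_nonneg fun i _ => hA0 i
  refine ⟨C * ∑ i ∈ Finset.range (N + 1), A i, by positivity, fun φ hφ => ?_⟩
  rw [mul_assoc]
  refine hC _ (tsupport_subset_closedBall fun x hx => ?_) _ (by positivity) fun i hi x => ?_
  · exact conv_eq_zero (x₀ := 0) hR (fun y hy => hφ y (by simpa using hy)) (by simpa using hx)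
  · rw [TF.conv_comm]
    refine (hA i φ x).trans ?_
    gcongr
    exact Finset.single_le_sum (f := A) (fun i _ => hA0 i) (Finset.mem_range.2 (by omega))

/-! ### Riesz potentials of functions with controlled growth on balls. -/

/-- Cauchy–Schwarz for nonnegative functions. -/
lemma lintegral_mul_sq_le {μ : Measure E3} {f g : E3 → ℝ≥0∞} (hf : AEMeasurable f μ)
    (hg : AEMeasurable g μ) :
    (∫⁻ x, f x * g x ∂μ) ^ 2 ≤ (∫⁻ x, f x ^ 2 ∂μ) * ∫⁻ x, g x ^ 2 ∂μ := by
  have h := ENNReal.lintegral_mul_le_Lp_mul_Lq μ Real.HolderConjugate.two_two hf hg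
  calc (∫⁻ x, f x * g x ∂μ) ^ 2
      ≤ ((∫⁻ x, f x ^ (2 : ℝ) ∂μ) ^ (1 / 2 : ℝ) * (∫⁻ x, g x ^ (2 : ℝ) ∂μ) ^ (1 / 2 : ℝ)) ^ 2 := by
        gcongr; exact h
    _ = _ := by
        rw [mul_pow, ← ENNReal.rpow_natCast, ← ENNReal.rpow_natCast, ← ENNReal.rpow_mul,
          ← ENNReal.rpow_mul]
        norm_num

/-- `∫_B f ≤ M t ^ s` for the closed balls `B` of center `x` and radius `t`. -/
def GrowthAt (s M : ℝ) (f : E3 → ℝ≥0∞) (x : E3) (t : ℝ) : Prop :=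
  ∫⁻ y in Metric.closedBall x t, f y ≤ ENNReal.ofReal (M * t ^ s)

lemma tsum_ofReal_geometric_le {c q : ℝ} (hc : 0 ≤ c) (hq0 : 0 ≤ q) (hq1 : q < 1) :
    ∑' n : ℕ, ENNReal.ofReal (c * q ^ n) ≤ ENNReal.ofReal (c * (1 - q)⁻¹) := by
  rw [← ENNReal.ofReal_tsum_of_nonneg (fun n => by positivity)
    ((summable_geometric_of_lt_one hq0 hq1).mul_left c), tsum_mul_left,
    tsum_geometric_of_lt_one hq0 hq1]

/-- The constant in the estimates of Riesz potentials. -/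
def potentialConst (s a : ℝ) : ℝ := 2 ^ (max s a) * (1 - 2 ^ (-|s - a|))⁻¹

lemma potentialConst_pos {s a : ℝ} (h : s ≠ a) : 0 < potentialConst s a := by
  have h1 : 0 < |s - a| := abs_pos.2 (sub_ne_zero.2 h)
  have h2 : (2 : ℝ) ^ (-|s - a|) < 1 :=
    Real.rpow_lt_one_of_one_lt_of_neg (by norm_num) (by linarith)
  unfold potentialConst
  have : 0 < 1 - (2 : ℝ) ^ (-|s - a|) := by linarith
  positivity

lemma lintegral_potential_near {s a M R : ℝ} (has : a < s) (ha : 0 < a) (hM : 0 ≤ M) (hR : 0 < R)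
    {f : E3 → ℝ≥0∞} {x : E3} (hf : ∀ t, 0 < t → t ≤ R → GrowthAt s M f x t) :
    ∫⁻ y in Metric.closedBall x R, f y * ENNReal.ofReal (‖y - x‖ ^ (-a))
      ≤ ENNReal.ofReal (potentialConst s a * M * R ^ (s - a)) := by
  -- Dyadic shells shrinking to the null set `{x}`: their contributions form a geometric series of
  -- ratio `2^(a - s) < 1`.
  let A : ℕ → Set E3 := fun n => {y | R / 2 ^ (n + 1) < ‖y - x‖ ∧ ‖y - x‖ ≤ R / 2 ^ n}
  have hcov : Metric.closedBall x R ⊆ {x} ∪ ⋃ n, A n := by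
    intro y hy
    rcases eq_or_ne y x with h | h
    · exact Or.inl h
    right
    have hd : 0 < ‖y - x‖ := norm_pos_iff.2 (sub_ne_zero.2 h)
    rw [Metric.mem_closedBall, dist_eq_norm] at hy
    obtain ⟨n, h1, h2⟩ := exists_nat_pow_near (x := R / ‖y - x‖) (y := 2)
      ((one_le_div hd).2 hy) (by norm_num)
    refine mem_iUnion.2 ⟨n, ?_, ?_⟩
    · rw [div_lt_iff₀ (by positivity)]; rwa [div_lt_iff₀ hd, mul_comm] at h2
    · rw [le_div_iff₀ (by positivity)]; rwa [le_div_iff₀ hd, mul_comm] at h1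
  have hm : Measurable fun y : E3 => ‖y - x‖ := by fun_prop
  have hA : ∀ n, ∫⁻ y in A n, f y * ENNReal.ofReal (‖y - x‖ ^ (-a))
      ≤ ENNReal.ofReal (2 ^ a * M * R ^ (s - a) * (2 ^ (a - s)) ^ n) := by
    intro n
    have hp : (0 : ℝ) < R / 2 ^ n := by positivity
    calc ∫⁻ y in A n, f y * ENNReal.ofReal (‖y - x‖ ^ (-a))
        ≤ ∫⁻ y in A n, f y * ENNReal.ofReal ((R / 2 ^ (n + 1)) ^ (-a)) := by
          refine setLIntegral_mono' ?_ fun y hy => ?_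
          · exact (measurableSet_lt measurable_const hm).inter
              (measurableSet_le hm measurable_const)
          · gcongr f y * ENNReal.ofReal ?_
            exact Real.rpow_le_rpow_of_nonpos (by positivity) hy.1.le (by linarith)
      _ = (∫⁻ y in A n, f y) * ENNReal.ofReal ((R / 2 ^ (n + 1)) ^ (-a)) :=
          lintegral_mul_const' _ _ ENNReal.ofReal_ne_top
      _ ≤ ENNReal.ofReal (M * (R / 2 ^ n) ^ s) * ENNReal.ofReal ((R / 2 ^ (n + 1)) ^ (-a)) := by
          gcongr
          refine (lintegral_mono_set fun y hy => ?_).trans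
            (hf (R / 2 ^ n) hp (div_le_self hR.le (one_le_pow₀ (by norm_num))))
          rw [Metric.mem_closedBall, dist_eq_norm]; exact hy.2
      _ = _ := by
          rw [← ENNReal.ofReal_mul (by positivity)]
          congr 1
          rw [pow_succ, ← div_div, Real.div_rpow hp.le (by norm_num), Real.rpow_neg hp.le,
            Real.rpow_neg (by norm_num), Real.div_rpow hR.le (by positivity),
            Real.div_rpow hR.le (by positivity), Real.rpow_sub hR, Real.rpow_sub (by norm_num),
            div_pow, ← Real.rpow_natCast, ← Real.rpow_mul (by norm_num), ← Real.rpow_mul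
            (by norm_num), ← Real.rpow_natCast, ← Real.rpow_mul (by norm_num),
            ← Real.rpow_natCast, ← Real.rpow_mul (by norm_num), mul_comm (n : ℝ), mul_comm (n : ℝ)]
          field_simp
  have hz : ∫⁻ y in {x}, f y * ENNReal.ofReal (‖y - x‖ ^ (-a)) = 0 :=
    setLIntegral_measure_zero _ _ (measure_singleton x)
  have hq : (2 : ℝ) ^ (a - s) < 1 := Real.rpow_lt_one_of_one_lt_of_neg (by norm_num) (by linarith)
  calc _ ≤ ∫⁻ y in {x} ∪ ⋃ n, A n, f y * ENNReal.ofReal (‖y - x‖ ^ (-a)) := lintegral_mono_set hcov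
    _ ≤ _ := lintegral_union_le _ _ _
    _ ≤ 0 + ∑' n, ENNReal.ofReal (2 ^ a * M * R ^ (s - a) * (2 ^ (a - s)) ^ n) := by
        rw [hz]
        gcongr
        exact (lintegral_iUnion_le _ _).trans (ENNReal.tsum_le_tsum hA)
    _ ≤ ENNReal.ofReal (2 ^ a * M * R ^ (s - a) * (1 - 2 ^ (a - s))⁻¹) := by
        rw [zero_add]
        exact tsum_ofReal_geometric_le (by positivity) (by positivity) hq
    _ ≤ _ := by
        apply ENNReal.ofReal_le_ofReal
        rw [potentialConst, abs_of_pos (by linarith), neg_sub]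
        have : 0 < (1 - (2 : ℝ) ^ (a - s))⁻¹ := by rw [inv_pos]; linarith
        have h2 : (2 : ℝ) ^ a ≤ 2 ^ (max s a) :=
          Real.rpow_le_rpow_of_exponent_le (by norm_num) (le_max_right _ _)
        calc _ = (2 : ℝ) ^ a * ((1 - (2 : ℝ) ^ (a - s))⁻¹ * M * R ^ (s - a)) := by ring
          _ ≤ 2 ^ (max s a) * ((1 - (2 : ℝ) ^ (a - s))⁻¹ * M * R ^ (s - a)) := by gcongr
          _ = _ := by ring

lemma lintegral_potential_far {s a M r : ℝ} (has : s < a) (ha : 0 < a) (hM : 0 ≤ M) (hr : 0 < r)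
    {f : E3 → ℝ≥0∞} {x : E3} (hf : ∀ t, r ≤ t → GrowthAt s M f x t) :
    ∫⁻ y in {y | r ≤ ‖y - x‖}, f y * ENNReal.ofReal (‖y - x‖ ^ (-a))
      ≤ ENNReal.ofReal (potentialConst s a * M * r ^ (s - a)) := by
  -- Dyadic shells going to infinity: here `s < a`, and the ratio is `2^(s - a) < 1`.
  let A : ℕ → Set E3 := fun n => {y | 2 ^ n * r ≤ ‖y - x‖ ∧ ‖y - x‖ ≤ 2 ^ (n + 1) * r}
  have hcov : {y | r ≤ ‖y - x‖} ⊆ ⋃ n, A n := by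
    intro y hy
    obtain ⟨n, h1, h2⟩ := exists_nat_pow_near (x := ‖y - x‖ / r) (y := 2)
      ((one_le_div hr).2 hy) (by norm_num)
    refine mem_iUnion.2 ⟨n, ?_, ?_⟩
    · rwa [le_div_iff₀ hr] at h1
    · rw [div_lt_iff₀ hr] at h2; exact h2.le
  have hm : Measurable fun y : E3 => ‖y - x‖ := by fun_prop
  have hA : ∀ n, ∫⁻ y in A n, f y * ENNReal.ofReal (‖y - x‖ ^ (-a))
      ≤ ENNReal.ofReal (2 ^ s * M * r ^ (s - a) * (2 ^ (s - a)) ^ n) := by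
    intro n
    have hp : (0 : ℝ) < 2 ^ n * r := by positivity
    calc ∫⁻ y in A n, f y * ENNReal.ofReal (‖y - x‖ ^ (-a))
        ≤ ∫⁻ y in A n, f y * ENNReal.ofReal ((2 ^ n * r) ^ (-a)) := by
          refine setLIntegral_mono' ?_ fun y hy => ?_
          · exact (measurableSet_le measurable_const hm).inter
              (measurableSet_le hm measurable_const)
          · gcongr f y * ENNReal.ofReal ?_
            exact Real.rpow_le_rpow_of_nonpos hp hy.1 (by linarith)
      _ = (∫⁻ y in A n, f y) * ENNReal.ofReal ((2 ^ n * r) ^ (-a)) :=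
          lintegral_mul_const' _ _ ENNReal.ofReal_ne_top
      _ ≤ ENNReal.ofReal (M * (2 ^ (n + 1) * r) ^ s) * ENNReal.ofReal ((2 ^ n * r) ^ (-a)) := by
          gcongr
          refine (lintegral_mono_set fun y hy => ?_).trans
            (hf (2 ^ (n + 1) * r) (le_mul_of_one_le_left hr.le (one_le_pow₀ (by norm_num))))
          rw [Metric.mem_closedBall, dist_eq_norm]; exact hy.2
      _ = _ := by
          rw [← ENNReal.ofReal_mul (by positivity)]
          congr 1
          rw [pow_succ, mul_comm _ (2 : ℝ), mul_assoc (2 : ℝ), Real.mul_rpow (by norm_num) hp.le,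
            Real.rpow_neg hp.le, Real.mul_rpow (by positivity) hr.le,
            Real.mul_rpow (by positivity) hr.le, Real.rpow_sub hr, Real.rpow_sub (by norm_num),
            div_pow, ← Real.rpow_natCast, ← Real.rpow_mul (by norm_num), ← Real.rpow_mul
            (by norm_num), ← Real.rpow_natCast, ← Real.rpow_mul (by norm_num),
            ← Real.rpow_natCast, ← Real.rpow_mul (by norm_num), mul_comm (n : ℝ), mul_comm (n : ℝ)]
          field_simp
  have hq : (2 : ℝ) ^ (s - a) < 1 := Real.rpow_lt_one_of_one_lt_of_neg (by norm_num) (by linarith)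
  calc _ ≤ ∫⁻ y in ⋃ n, A n, f y * ENNReal.ofReal (‖y - x‖ ^ (-a)) := lintegral_mono_set hcov
    _ ≤ ∑' n, ENNReal.ofReal (2 ^ s * M * r ^ (s - a) * (2 ^ (s - a)) ^ n) :=
        (lintegral_iUnion_le _ _).trans (ENNReal.tsum_le_tsum hA)
    _ ≤ ENNReal.ofReal (2 ^ s * M * r ^ (s - a) * (1 - 2 ^ (s - a))⁻¹) :=
        tsum_ofReal_geometric_le (by positivity) (by positivity) hq
    _ ≤ _ := by
        apply ENNReal.ofReal_le_ofReal
        rw [potentialConst, abs_of_neg (by linarith), neg_neg]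
        have : 0 < (1 - (2 : ℝ) ^ (s - a))⁻¹ := by rw [inv_pos]; linarith
        have h2 : (2 : ℝ) ^ s ≤ 2 ^ (max s a) :=
          Real.rpow_le_rpow_of_exponent_le (by norm_num) (le_max_left _ _)
        calc _ = (2 : ℝ) ^ s * ((1 - (2 : ℝ) ^ (s - a))⁻¹ * M * r ^ (s - a)) := by ring
          _ ≤ 2 ^ (max s a) * ((1 - (2 : ℝ) ^ (s - a))⁻¹ * M * r ^ (s - a)) := by gcongr
          _ = _ := by ring

/-! ### Morrey spaces in terms of growth on balls. -/

lemma volume_closedBall_eq (x : E3) {r : ℝ} (hr : 0 ≤ r) :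
    volume (Metric.closedBall x r) = ENNReal.ofReal (r ^ 3) * volume (Metric.ball (0 : E3) 1) := by
  rw [Measure.addHaar_closedBall _ _ hr]; simp

/-- The volume of the unit ball. -/
def unitVol : ℝ := (volume (Metric.ball (0 : E3) 1)).toReal

lemma unitVol_pos : 0 < unitVol :=
  ENNReal.toReal_pos (Metric.measure_ball_pos volume _ one_pos).ne' measure_ball_lt_top.ne

lemma volume_closedBall_eq_ofReal (x : E3) {r : ℝ} (hr : 0 ≤ r) :
    volume (Metric.closedBall x r) = ENNReal.ofReal (unitVol * r ^ 3) := by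
  rw [volume_closedBall_eq x hr, mul_comm, ENNReal.ofReal_mul unitVol_pos.le, unitVol,
    ENNReal.ofReal_toReal measure_ball_lt_top.ne]

lemma volume_ball_eq_ofReal (x : E3) {r : ℝ} (hr : 0 ≤ r) :
    volume (Metric.ball x r) = ENNReal.ofReal (unitVol * r ^ 3) := by
  rw [volume_ball_eq x hr, mul_comm, ENNReal.ofReal_mul unitVol_pos.le, unitVol,
    ENNReal.ofReal_toReal measure_ball_lt_top.ne]

/-- With `γ = 3/p`, squaring turns the weight `R^γ` and the volume `unitVol * R³` into the
normalization `R^(3 - 2γ)`. This is the growth exponent used for squares of Morrey functions. -/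
lemma sq_morrey_term {γ R : ℝ} (hR : 0 < R) (x : E3) (I : ℝ≥0∞) :
    (ENNReal.ofReal (R ^ γ) * ((volume (Metric.ball x R))⁻¹ * I) ^ (1 / 2 : ℝ)) ^ 2
      = ENNReal.ofReal (unitVol * R ^ (3 - 2 * γ))⁻¹ * I := by
  have hV := unitVol_pos
  rw [mul_pow, ← ENNReal.rpow_natCast (_ ^ (1 / 2 : ℝ)), ← ENNReal.rpow_mul,
    show (1 / 2 : ℝ) * ((2 : ℕ) : ℝ) = 1 by norm_num, ENNReal.rpow_one, volume_ball_eq_ofReal x hR.le, ← ENNReal.ofReal_inv_of_pos (by positivity),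
    ← ENNReal.ofReal_pow (by positivity), ← mul_assoc, ← ENNReal.ofReal_mul (by positivity)]
  congr 2
  rw [Real.rpow_sub hR, mul_comm 2 γ, Real.rpow_mul hR.le]
  norm_cast
  field_simp

/-- A description of the Morrey space in terms of the integrals over closed balls. -/
lemma memMorrey_iff {p : ℝ} {f : E3 → ℝ} : MemMorrey p f ↔ AEStronglyMeasurable f volume ∧
    ∃ M : ℝ, 0 ≤ M ∧ ∀ x R, 0 < R → GrowthAt (3 - 2 * (3 / p)) M (fun y => ‖f y‖ₑ ^ 2) x R := by
  set γ := 3 / p with hγ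
  have hV := unitVol_pos
  refine and_congr_right fun _ => ⟨fun h => ?_, fun ⟨M, hM, h⟩ => ?_⟩
  · set N := (morreyNorm p f).toReal
    have hN : ENNReal.ofReal N = morreyNorm p f := ENNReal.ofReal_toReal h.ne
    -- The power of `2` pays for enclosing a closed ball of radius `R` in the open ball of radius
    -- `2R`.
    refine ⟨N ^ 2 * unitVol * 2 ^ (3 - 2 * γ), by positivity, fun x R hR => ?_⟩
    have h2R : 0 < 2 * R := by positivity
    have h1 : ENNReal.ofReal ((2 * R) ^ γ) * ((volume (Metric.ball x (2 * R)))⁻¹ *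
        ∫⁻ x in Metric.ball x (2 * R), ‖f x‖ₑ ^ 2) ^ (1 / 2 : ℝ) ≤ ENNReal.ofReal N := by
      rw [hN, morreyNorm]
      exact le_iSup_of_le x (le_iSup_of_le (2 * R) (le_iSup_of_le h2R le_rfl))
    have h2 := pow_le_pow_left' h1 2
    rw [sq_morrey_term h2R, ← ENNReal.ofReal_pow (by positivity), mul_comm,
      ENNReal.ofReal_inv_of_pos (by positivity), ← div_eq_mul_inv,
      ENNReal.div_le_iff (by simpa using by positivity) ENNReal.ofReal_ne_top,
      ← ENNReal.ofReal_mul (by positivity)] at h2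
    refine (lintegral_mono_set (Metric.closedBall_subset_ball (by linarith))).trans (h2.trans ?_)
    rw [Real.mul_rpow (by norm_num) hR.le]
    exact ENNReal.ofReal_le_ofReal (le_of_eq (by ring))
  · set B := ENNReal.ofReal (unitVol⁻¹ * M) ^ (1 / 2 : ℝ)
    refine lt_of_le_of_lt (b := B) ?_ (ENNReal.rpow_lt_top_of_nonneg (by norm_num)
      ENNReal.ofReal_ne_top)
    refine iSup_le fun x => iSup_le fun R => iSup_le fun hR => ?_
    rw [← ENNReal.pow_le_pow_left_iff (n := 2) (by norm_num), sq_morrey_term hR]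
    have hB : B ^ 2 = ENNReal.ofReal (unitVol⁻¹ * M) := by
      rw [← ENNReal.rpow_natCast, ← ENNReal.rpow_mul]; norm_num
    rw [hB]
    calc _ ≤ ENNReal.ofReal (unitVol * R ^ (3 - 2 * γ))⁻¹ *
          ENNReal.ofReal (M * R ^ (3 - 2 * γ)) := by
          gcongr
          exact (lintegral_mono_set Metric.ball_subset_closedBall).trans (h x R hR)
      _ = _ := by
          rw [← ENNReal.ofReal_mul (by positivity)]
          congr 1
          field_simp

/-- Passing from the square integral to the integral on balls. -/
lemma GrowthAt.of_sq {γ M : ℝ} (hM : 0 ≤ M) {f : E3 → ℝ} (hf : AEStronglyMeasurable f volume)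
    {x : E3} {R : ℝ} (hR : 0 < R) (h : GrowthAt (3 - 2 * γ) M (fun y => ‖f y‖ₑ ^ 2) x R) :
    GrowthAt (3 - γ) (Real.sqrt (unitVol * M)) (fun y => ‖f y‖ₑ) x R := by
  have hV := unitVol_pos
  have h1 := lintegral_mul_sq_le (μ := volume.restrict (Metric.closedBall x R))
    (f := fun y => ‖f y‖ₑ) (g := fun _ => 1) hf.restrict.enorm aemeasurable_const
  simp only [mul_one, one_pow, lintegral_const, Measure.restrict_apply_univ, one_mul] at h1
  rw [volume_closedBall_eq_ofReal x hR.le] at h1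
  unfold GrowthAt
  rw [← ENNReal.pow_le_pow_left_iff (n := 2) (by norm_num)]
  refine h1.trans ((mul_le_mul_left h _).trans (le_of_eq ?_))
  rw [← ENNReal.ofReal_mul (by positivity), ← ENNReal.ofReal_pow (by positivity)]
  congr 1
  have h2 : R ^ (3 - 2 * γ) * R ^ 3 = (R ^ (3 - γ)) ^ 2 := by
    rw [← Real.rpow_natCast (R ^ _) 2, ← Real.rpow_mul hR.le, ← Real.rpow_natCast R 3,
      ← Real.rpow_add hR]
    congr 1; push_cast; ring
  rw [mul_pow, Real.sq_sqrt (by positivity), ← h2]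
  ring

section MemMorrey

variable {p : ℝ} {f g : E3 → ℝ}

/-- A measurable function dominated by Morrey functions is a Morrey function. -/
lemma MemMorrey.of_sq_le (hf : MemMorrey p f) {C : ℝ≥0} (hg : AEStronglyMeasurable g volume)
    (h : ∀ᵐ x, ‖g x‖ₑ ^ 2 ≤ C * ‖f x‖ₑ ^ 2) : MemMorrey p g := by
  rw [memMorrey_iff] at hf ⊢
  obtain ⟨hm, M, hM, hf⟩ := hf
  refine ⟨hg, C * M, by positivity, fun x R hR => ?_⟩
  refine (lintegral_mono_ae (ae_restrict_of_ae h)).trans ?_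
  rw [lintegral_const_mul' _ _ ENNReal.coe_ne_top]
  refine (mul_le_mul_right (hf x R hR) _).trans (le_of_eq ?_)
  rw [mul_assoc (C : ℝ), ENNReal.ofReal_mul C.coe_nonneg]
  simp

lemma MemMorrey.add (hf : MemMorrey p f) (hg : MemMorrey p g) :
    MemMorrey p (fun x => f x + g x) := by
  rw [memMorrey_iff] at hf hg ⊢
  obtain ⟨hfm, M, hM, hf⟩ := hf
  obtain ⟨hgm, N, hN, hg⟩ := hg
  refine ⟨hfm.add hgm, 2 * (M + N), by positivity, fun x R hR => ?_⟩
  have h1 : ∀ y, ‖f y + g y‖ₑ ^ 2 ≤ 2 * (‖f y‖ₑ ^ 2 + ‖g y‖ₑ ^ 2) := by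
    intro y
    have h2 : ‖f y + g y‖ ^ 2 ≤ 2 * (‖f y‖ ^ 2 + ‖g y‖ ^ 2) := by
      have := norm_add_le (f y) (g y)
      nlinarith [sq_nonneg (‖f y‖ - ‖g y‖), norm_nonneg (f y + g y)]
    have := ENNReal.ofReal_le_ofReal h2
    rwa [ENNReal.ofReal_mul (by norm_num), ENNReal.ofReal_add (by positivity) (by positivity),
      ENNReal.ofReal_pow (norm_nonneg _), ENNReal.ofReal_pow (norm_nonneg _),
      ENNReal.ofReal_pow (norm_nonneg _), ofReal_norm, ofReal_norm, ofReal_norm,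
      ENNReal.ofReal_ofNat] at this
  refine (lintegral_mono fun y => h1 y).trans ?_
  rw [lintegral_const_mul' _ _ (by norm_num), lintegral_add_left' (hfm.restrict.enorm.pow_const 2)]
  refine (mul_le_mul_right (add_le_add (hf x R hR) (hg x R hR)) _).trans (le_of_eq ?_)
  rw [← ENNReal.ofReal_add (by positivity) (by positivity), ← ENNReal.ofReal_ofNat,
    ← ENNReal.ofReal_mul (by norm_num)]
  congr 1; ring

lemma MemMorrey.bdd_mul (hf : MemMorrey p f) (hg : AEStronglyMeasurable g volume) {C : ℝ}
    (h : ∀ᵐ x, |g x| ≤ C) : MemMorrey p (fun x => f x * g x) := by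
  refine hf.of_sq_le (C := (C ^ 2).toNNReal) (hf.1.mul hg) (h.mono fun x hx => ?_)
  rw [enorm_mul, mul_pow, mul_comm]
  gcongr
  rw [← ofReal_norm, ← ENNReal.ofReal_pow (norm_nonneg _)]
  apply ENNReal.ofReal_le_ofReal
  rw [Real.norm_eq_abs]
  exact pow_le_pow_left₀ (abs_nonneg _) hx 2

lemma MemMorrey.const_mul (hf : MemMorrey p f) (c : ℝ) : MemMorrey p (fun x => c * f x) := by
  have := hf.bdd_mul (g := fun _ => c) aestronglyMeasurable_const
    (Filter.Eventually.of_forall fun _ => le_refl |c|)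
  simpa [mul_comm] using this

lemma MemMorrey.zero : MemMorrey p (fun _ => 0) := by
  rw [memMorrey_iff]
  exact ⟨aestronglyMeasurable_const, 0, le_rfl, fun x R _ => by simp [GrowthAt]⟩

lemma MemMorrey.sum {ι : Type*} (s : Finset ι) {f : ι → E3 → ℝ}
    (hf : ∀ i ∈ s, MemMorrey p (f i)) : MemMorrey p (fun x => ∑ i ∈ s, f i x) := by
  classical
  induction s using Finset.induction_on with
  | empty => simpa using MemMorrey.zero
  | insert a s ha ih =>
    simp only [Finset.sum_insert ha]
    exact (hf a (by simp)).add (ih fun i hi => hf i (by simp [hi]))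

lemma MemMorrey.abs (hf : MemMorrey p f) : MemMorrey p (fun x => |f x|) :=
  hf.of_sq_le (C := 1) hf.1.norm (Filter.Eventually.of_forall fun x => by simp)

/-- The integral of a Morrey function over closed balls. -/
lemma MemMorrey.exists_growth (hf : MemMorrey p f) :
    ∃ M : ℝ, 0 ≤ M ∧ ∀ x R, 0 < R → GrowthAt (3 - 3 / p) M (fun y => ‖f y‖ₑ) x R := by
  have hm := hf.1
  obtain ⟨-, M, hM, hf⟩ := memMorrey_iff.1 hf
  exact ⟨_, Real.sqrt_nonneg _, fun x R hR => GrowthAt.of_sq hM hm hR (hf x R hR)⟩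

lemma locallyIntegrable_of_lintegral_closedBall {f : E3 → ℝ} (hf : AEStronglyMeasurable f volume)
    (h : ∀ R : ℝ, 0 < R → ∫⁻ y in Metric.closedBall 0 R, ‖f y‖ₑ < ∞) : LocallyIntegrable f := by
  intro x
  refine ⟨Metric.closedBall 0 (‖x‖ + 1), Filter.mem_of_superset (Metric.ball_mem_nhds x one_pos)
    fun y hy => ?_, hf.restrict, h _ (by positivity)⟩
  rw [Metric.mem_ball, dist_eq_norm] at hy
  rw [Metric.mem_closedBall, dist_zero_right]
  linarith [norm_le_norm_add_norm_sub' y x]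

lemma MemMorrey.locallyIntegrable (hf : MemMorrey p f) : LocallyIntegrable f := by
  obtain ⟨M, -, h⟩ := hf.exists_growth
  exact locallyIntegrable_of_lintegral_closedBall hf.1 fun R hR =>
    (h 0 R hR).trans_lt ENNReal.ofReal_lt_top

end MemMorrey

/-! ### Square-integral estimates for test functions. -/

lemma TF.memLp_two (φ : TF) : MemLp (φ : E3 → ℝ) 2 volume :=
  φ.continuous.memLp_of_hasCompactSupport φ.hasCompactSupport

lemma TF.integrable_mul_TF (φ ψ : TF) : Integrable fun x => φ x * ψ x :=
  TF.integrable_mul (TF.locallyIntegrable ψ) φ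

/-- The `L²` norm of a test function. -/
def normTwo (φ : TF) : ℝ := Real.sqrt (∫ x, φ x * φ x)

lemma normTwo_nonneg (φ : TF) : 0 ≤ normTwo φ := Real.sqrt_nonneg _

lemma sq_normTwo (φ : TF) : normTwo φ ^ 2 = ∫ x, φ x * φ x :=
  Real.sq_sqrt (integral_nonneg fun _ => mul_self_nonneg _)

lemma lintegral_enorm_sq_TF (φ : TF) : ∫⁻ x, ‖φ x‖ₑ ^ 2 = ENNReal.ofReal (normTwo φ ^ 2) := by
  rw [sq_normTwo, ofReal_integral_eq_lintegral_ofReal (TF.integrable_mul_TF φ φ)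
    (Filter.Eventually.of_forall fun x => mul_self_nonneg _)]
  congr 1; ext x
  rw [← ofReal_norm, ← ENNReal.ofReal_pow (norm_nonneg _), ← sq, Real.norm_eq_abs, sq_abs]

lemma TF.integral_D_mul (i : Fin 3) (φ ψ : TF) :
    ∫ x, D i φ x * ψ x = - ∫ x, φ x * D i ψ x := by
  have h := integral_mul_fderiv_eq_neg_fderiv_mul_of_integrable (μ := (volume : Measure E3))
    (𝕜 := ℝ) (f := ⇑φ) (g := ⇑ψ) (v := e i)
    (by simpa [coe_D, pd] using TF.integrable_mul_TF (D i φ) ψ)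
    (by simpa [coe_D, pd] using TF.integrable_mul_TF φ (D i ψ))
    (TF.integrable_mul_TF φ ψ) (fun x _ => φ.smooth.differentiable (by simp) x)
    (fun x _ => ψ.smooth.differentiable (by simp) x)
  simp only [coe_D, pd]
  linarith

/-- The Laplacian of a test function. -/
def lapl (φ : TF) : TF := ∑ a, D a (D a φ)

lemma lapl_lapl (φ : TF) : lapl (lapl φ) = bilap φ := by
  simp only [lapl, bilap, map_sum]

lemma lapl_D (i : Fin 3) (φ : TF) : lapl (D i φ) = D i (lapl φ) := by
  simp only [lapl, map_sum]
  refine Finset.sum_congr rfl fun a _ => ?_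
  rw [TF.D_comm a i φ, TF.D_comm a i]

lemma TF.integral_sum_mul_sum (f g : Fin 3 → TF) :
    ∫ x, (∑ a, f a) x * (∑ b, g b) x = ∑ a, ∑ b, ∫ x, f a x * g b x := by
  simp only [TF.sum_apply, Finset.sum_mul_sum]
  rw [integral_finsetSum _ fun a _ => integrable_finsetSum _ fun b _ =>
    TF.integrable_mul_TF (f a) (g b)]
  refine Finset.sum_congr rfl fun a _ => ?_
  rw [integral_finsetSum _ fun b _ => TF.integrable_mul_TF (f a) (g b)]

/-- The second derivatives of a test function are controlled by its Laplacian in `L²`. -/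
lemma normTwo_D_D_le (i j : Fin 3) (ψ : TF) : normTwo (D i (D j ψ)) ≤ normTwo (lapl ψ) := by
  apply Real.sqrt_le_sqrt
  -- Two integrations by parts; summing over `a` and `b` shows that the squared norms of all second
  -- derivatives add up to that of the Laplacian.
  have h : ∀ a b, ∫ x, D a (D b ψ) x * D a (D b ψ) x
      = ∫ x, D b (D b ψ) x * D a (D a ψ) x := by
    intro a b
    rw [TF.integral_D_mul, TF.D_comm a b ψ, TF.D_comm a b (D a ψ), ← TF.integral_D_mul]
  have h2 : ∫ x, lapl ψ x * lapl ψ x = ∑ b, ∑ a, ∫ x, D a (D b ψ) x * D a (D b ψ) x := by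
    simp only [h]
    exact TF.integral_sum_mul_sum _ _
  rw [h2]
  have h0 : ∀ a b, 0 ≤ ∫ x, D a (D b ψ) x * D a (D b ψ) x := fun a b =>
    integral_nonneg fun x => mul_self_nonneg _
  exact (Finset.single_le_sum (f := fun a => ∫ x, D a (D j ψ) x * D a (D j ψ) x)
    (fun a _ => h0 a j) (Finset.mem_univ i)).trans
    (Finset.single_le_sum (f := fun b => ∑ a, ∫ x, D a (D b ψ) x * D a (D b ψ) x)
      (fun b _ => Finset.sum_nonneg fun a _ => h0 a b) (Finset.mem_univ j))

lemma normTwo_D_four_le (i j k l : Fin 3) (ψ : TF) :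
    normTwo (D i (D j (D k (D l ψ)))) ≤ normTwo (bilap ψ) := by
  refine (normTwo_D_D_le i j _).trans ?_
  rw [lapl_D, lapl_D, ← lapl_lapl]
  exact normTwo_D_D_le k l _

/-- Young's inequality. -/
lemma lintegral_conv_sq_le (β φ : TF) :
    ∫⁻ x, ‖conv β φ x‖ₑ ^ 2 ≤ (∫⁻ y, ‖β y‖ₑ) ^ 2 * ∫⁻ x, ‖φ x‖ₑ ^ 2 := by
  have hβ : Measurable fun y => ‖β y‖ₑ := β.continuous.measurable.enorm
  have hφ : Measurable fun y => ‖φ y‖ₑ := φ.continuous.measurable.enorm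
  have h1 : ∀ x, ‖conv β φ x‖ₑ ^ 2 ≤ (∫⁻ y, ‖β y‖ₑ) * ∫⁻ y, ‖β y‖ₑ * ‖φ (x - y)‖ₑ ^ 2 := by
    intro x
    have hm : Measurable fun y => ‖φ (x - y)‖ₑ := hφ.comp (measurable_const.sub measurable_id)
    -- Cauchy–Schwarz after splitting `|β|` as `|β|^(1/2) * |β|^(1/2)`, so that only the integral of
    -- `|β|` appears.
    have h2 := lintegral_mul_sq_le (μ := volume) (f := fun y => ‖β y‖ₑ ^ (1 / 2 : ℝ))
      (g := fun y => ‖β y‖ₑ ^ (1 / 2 : ℝ) * ‖φ (x - y)‖ₑ) (hβ.pow_const _).aemeasurable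
      ((hβ.pow_const _).mul hm).aemeasurable
    have h3 : ∀ a : ℝ≥0∞, a ^ (1 / 2 : ℝ) * a ^ (1 / 2 : ℝ) = a := fun a => by
      rw [← ENNReal.rpow_add_of_nonneg _ _ (by norm_num) (by norm_num)]; norm_num
    have h4 : ∀ a : ℝ≥0∞, (a ^ (1 / 2 : ℝ)) ^ 2 = a := fun a => by rw [sq, h3]
    simp only [← mul_assoc, h3, mul_pow, h4] at h2
    refine le_trans ?_ h2
    gcongr
    rw [TF.conv_apply]
    refine (enorm_integral_le_lintegral_enorm _).trans (le_of_eq ?_)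
    simp only [enorm_mul]
  calc _ ≤ ∫⁻ x, (∫⁻ y, ‖β y‖ₑ) * ∫⁻ y, ‖β y‖ₑ * ‖φ (x - y)‖ₑ ^ 2 := lintegral_mono h1
    _ = (∫⁻ y, ‖β y‖ₑ) * ∫⁻ x, ∫⁻ y, ‖β y‖ₑ * ‖φ (x - y)‖ₑ ^ 2 := by
      refine lintegral_const_mul _ ?_
      refine Measurable.lintegral_prod_right' (f := fun z : E3 × E3 => ‖β z.2‖ₑ * ‖φ (z.1 - z.2)‖ₑ ^ 2) ?_
      exact (hβ.comp measurable_snd).mul ((hφ.comp (measurable_fst.sub measurable_snd)).pow_const 2)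
    _ = (∫⁻ y, ‖β y‖ₑ) * ∫⁻ y, ∫⁻ x, ‖β y‖ₑ * ‖φ (x - y)‖ₑ ^ 2 := by
      rw [lintegral_lintegral_swap]
      exact ((hβ.comp measurable_snd).mul
        ((hφ.comp (measurable_fst.sub measurable_snd)).pow_const 2)).aemeasurable
    _ = (∫⁻ y, ‖β y‖ₑ) * ∫⁻ y, ‖β y‖ₑ * ∫⁻ x, ‖φ x‖ₑ ^ 2 := by
      congr 1
      refine lintegral_congr fun y => ?_
      have hm : Measurable fun x => ‖φ (x - y)‖ₑ ^ 2 :=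
        (hφ.comp (measurable_id.sub measurable_const)).pow_const 2
      rw [lintegral_const_mul _ hm, lintegral_sub_right_eq_self (fun x => ‖φ x‖ₑ ^ 2)]
    _ = _ := by
      rw [lintegral_mul_const _ hβ]; ring

/-! ### Distributions locally bounded in the square-integral norm are functions. -/

/-- The local Riesz representation of a distribution bounded in `L²`. -/
lemma exists_representative_on_ball (T : Distr) (x₀ : E3) (r : ℝ) {C : ℝ} (hC : 0 ≤ C)
    (hT : ∀ φ : TF, (∀ x : E3, r < ‖x - x₀‖ → φ x = 0) → |T φ| ≤ C * normTwo φ) :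
    ∃ G : E3 → ℝ, MemLp G 2 volume ∧ ∫⁻ x, ‖G x‖ₑ ^ 2 ≤ ENNReal.ofReal (C ^ 2) ∧
      ∀ φ : TF, (∀ x : E3, r < ‖x - x₀‖ → φ x = 0) → T φ = ∫ x, φ x * G x := by
  let V : Submodule ℝ TF :=
    { carrier := {φ | ∀ x : E3, r < ‖x - x₀‖ → φ x = 0}
      add_mem' := fun {a b} ha hb x hx => by
        change a x + b x = 0
        rw [ha x hx, hb x hx, add_zero]
      zero_mem' := fun x _ => rfl
      smul_mem' := fun c a ha x hx => by
        change c * a x = 0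
        rw [ha x hx, mul_zero] }
  let ι : V →ₗ[ℝ] Lp ℝ 2 (volume : Measure E3) :=
    { toFun := fun φ => (TF.memLp_two φ.1).toLp _
      map_add' := fun φ ψ => MemLp.toLp_add (TF.memLp_two φ.1) (TF.memLp_two ψ.1)
      map_smul' := fun c φ => MemLp.toLp_const_smul c (TF.memLp_two φ.1) }
  have hιinner : ∀ (g : Lp ℝ 2 (volume : Measure E3)) (φ : V), inner ℝ g (ι φ) = ∫ x, φ.1 x * g x := by
    intro g φ
    rw [L2.inner_def]
    refine integral_congr_ae ?_
    filter_upwards [(TF.memLp_two φ.1).coeFn_toLp] with x hx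
    change inner ℝ (g x) (((TF.memLp_two φ.1).toLp _ : Lp ℝ 2 (volume : Measure E3)) x) = _
    rw [hx]; rfl
  have hιnorm : ∀ φ : V, ‖ι φ‖ = normTwo φ.1 := by
    intro φ
    rw [← Real.sqrt_sq (norm_nonneg _), ← real_inner_self_eq_norm_sq, hιinner, normTwo]
    congr 1
    refine integral_congr_ae ?_
    filter_upwards [(TF.memLp_two φ.1).coeFn_toLp] with x hx
    change _ * ((TF.memLp_two φ.1).toLp _ : Lp ℝ 2 (volume : Measure E3)) x = _
    rw [hx]
  let ℓ : V →ₗ[ℝ] ℝ := (T : TF →L[ℝ] ℝ).toLinearMap.comp V.subtype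
  have hℓ : ∀ φ : V, |ℓ φ| ≤ C * ‖ι φ‖ := fun φ => by rw [hιnorm]; exact hT φ.1 φ.2
  have : Module.Free ℝ (LinearMap.range ι) := Module.Free.of_divisionRing ℝ _
  have : Module.Projective ℝ (LinearMap.range ι) := Module.Projective.of_free
  -- A linear section of `ι` transports `ℓ` to the range of `ι`. The bound on `ℓ` makes the result
  -- continuous and independent of the section; Hahn–Banach and the Riesz representation then apply.
  obtain ⟨s, hs⟩ := ι.rangeRestrict.exists_rightInverse_of_surjective
    (LinearMap.range_eq_top.2 ι.surjective_rangeRestrict)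
  have hs' : ∀ y : LinearMap.range ι, ι (s y) = y := fun y => by
    have := congrArg (fun f => ((f y : LinearMap.range ι) : Lp ℝ 2 (volume : Measure E3))) hs
    exact this
  let L : StrongDual ℝ (LinearMap.range ι) := (ℓ.comp s).mkContinuous C fun y => by
    have := hℓ (s y)
    rw [hs'] at this
    exact this
  obtain ⟨g, hg, hgn⟩ := _root_.exists_extension_norm_eq (LinearMap.range ι) L
  have hLC : ‖L‖ ≤ C := LinearMap.mkContinuous_norm_le _ hC _
  let G := (InnerProductSpace.toDual ℝ (Lp ℝ 2 (volume : Measure E3))).symm g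
  have hGn : ‖G‖ ≤ C := by
    rw [LinearIsometryEquiv.norm_map, hgn]; exact hLC
  refine ⟨G, Lp.memLp G, ?_, fun φ hφ => ?_⟩
  · have h1 : ‖G‖ₑ ≤ ENNReal.ofReal C := by
      rw [← ofReal_norm]; exact ENNReal.ofReal_le_ofReal hGn
    rw [Lp.enorm_def, eLpNorm_eq_lintegral_rpow_enorm_toReal (by norm_num) (by norm_num)] at h1
    have h2 := pow_le_pow_left' h1 2
    rw [← ENNReal.rpow_natCast, ← ENNReal.rpow_mul, ← ENNReal.ofReal_pow hC] at h2
    simpa using h2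
  · rw [← hιinner G ⟨φ, hφ⟩, InnerProductSpace.toDual_symm_apply]
    have h1 := hg ⟨ι ⟨φ, hφ⟩, LinearMap.mem_range_self _ _⟩
    rw [show g (ι ⟨φ, hφ⟩) = L ⟨ι ⟨φ, hφ⟩, LinearMap.mem_range_self _ _⟩ from h1]
    change T φ = ℓ (s ⟨ι ⟨φ, hφ⟩, LinearMap.mem_range_self _ _⟩)
    -- `φ` and its image under `s ∘ ι` differ by an element of the kernel of `ι`, on which `ℓ`
    -- vanishes.
    have h2 := hℓ (⟨φ, hφ⟩ - s ⟨ι ⟨φ, hφ⟩, LinearMap.mem_range_self _ _⟩)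
    rw [map_sub, map_sub, hs', sub_self, norm_zero, mul_zero] at h2
    have h3 := abs_nonpos_iff.1 h2
    exact sub_eq_zero.1 h3

lemma ae_eq_on_open {U : Set E3} (hU : IsOpen U) {f g : E3 → ℝ} (hf : LocallyIntegrable f)
    (hg : LocallyIntegrable g)
    (h : ∀ φ : TF, tsupport φ ⊆ U → ∫ x, φ x * f x = ∫ x, φ x * g x) :
    ∀ᵐ x, x ∈ U → f x = g x := by
  have := hU.ae_eq_zero_of_integral_contDiff_smul_eq_zero (μ := volume) (f := fun x => f x - g x)
    ((hf.sub hg).locallyIntegrableOn U) fun φ hφ hc hs => by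
      let ψ : TF := ⟨φ, hφ, hc, by simp⟩
      have h1 := h ψ hs
      have h2 := integral_sub (TF.integrable_mul hf ψ) (TF.integrable_mul hg ψ)
      rw [h1, sub_self] at h2
      rw [← h2]
      refine integral_congr_ae (Filter.Eventually.of_forall fun x => ?_)
      exact mul_sub (φ x) (f x) (g x)
  filter_upwards [this] with x hx hxU using sub_eq_zero.1 (hx hxU)

lemma eq_zero_of_tsupport_subset_ball {φ : TF} {x₀ : E3} {r : ℝ}
    (h : tsupport φ ⊆ Metric.ball x₀ r) {x : E3} (hx : r < ‖x - x₀‖) : φ x = 0 := by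
  by_contra h0
  have := h (subset_tsupport _ h0)
  rw [Metric.mem_ball, dist_eq_norm] at this
  linarith

/-- A distribution that is locally bounded in `L²` is a function. -/
lemma exists_representative (T : Distr)
    (hT : ∀ n : ℕ, ∃ C : ℝ, 0 ≤ C ∧ ∀ φ : TF, (∀ x : E3, (n : ℝ) < ‖x‖ → φ x = 0) →
      |T φ| ≤ C * normTwo φ) :
    ∃ g : E3 → ℝ, LocallyIntegrable g ∧ T = toDistr g ∧ ∀ (x₀ : E3) (r C : ℝ), 0 ≤ C →
      (∀ φ : TF, (∀ x : E3, r < ‖x - x₀‖ → φ x = 0) → |T φ| ≤ C * normTwo φ) →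
      ∫⁻ x in Metric.ball x₀ r, ‖g x‖ₑ ^ 2 ≤ ENNReal.ofReal (C ^ 2) := by
  choose C hC0 hC using hT
  choose G hG2 hGC hGT using fun n : ℕ => exists_representative_on_ball T 0 (n : ℝ) (hC0 n)
    (fun φ hφ => hC n φ (by simpa using hφ))
  have hGl : ∀ n, LocallyIntegrable (G n) := fun n => (hG2 n).locallyIntegrable (by norm_num)
  have hcons : ∀ᵐ x, ∀ m n : ℕ, m ≤ n → x ∈ Metric.ball (0 : E3) m → G m x = G n x := by
    rw [ae_all_iff]; intro m
    rw [ae_all_iff]; intro n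
    by_cases hmn : m ≤ n
    · filter_upwards [ae_eq_on_open (Metric.isOpen_ball (x := (0 : E3)) (ε := m)) (hGl m) (hGl n)
        fun φ hφ => by
          rw [← hGT m φ fun x hx => eq_zero_of_tsupport_subset_ball hφ hx,
            ← hGT n φ fun x hx => eq_zero_of_tsupport_subset_ball hφ
              (lt_of_le_of_lt (by exact_mod_cast hmn) hx)]] with x hx _ h using hx h
    · exact Filter.Eventually.of_forall fun x h => absurd h hmn
  -- The local representatives are glued together; the `+ 1` puts `x` strictly inside the open ball
  -- on which the chosen one is valid.
  let g : E3 → ℝ := fun x => G (⌈‖x‖⌉₊ + 1) x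
  have hg : ∀ᵐ x, ∀ n : ℕ, x ∈ Metric.ball (0 : E3) n → g x = G n x := by
    filter_upwards [hcons] with x hx n hn
    have hk : x ∈ Metric.ball (0 : E3) ((⌈‖x‖⌉₊ + 1 : ℕ) : ℝ) := by
      rw [Metric.mem_ball, dist_zero_right]; push_cast
      linarith [Nat.le_ceil ‖x‖]
    rcases le_total n (⌈‖x‖⌉₊ + 1) with h | h
    · exact (hx _ _ h hn).symm
    · exact hx _ _ h hk
  have hgl : LocallyIntegrable g := by
    intro x
    obtain ⟨n, hn⟩ := exists_nat_gt ‖x‖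
    refine ⟨Metric.ball 0 n, Metric.isOpen_ball.mem_nhds (by simpa using hn), ?_⟩
    have h1 : IntegrableOn (G n) (Metric.ball (0 : E3) n) :=
      ((hGl n).integrableOn_isCompact (isCompact_closedBall 0 n)).mono_set
        Metric.ball_subset_closedBall
    refine h1.congr ?_
    rw [Filter.EventuallyEq, ae_restrict_iff' measurableSet_ball]
    exact hg.mono fun x hx h => (hx n h).symm
  have hTg : T = toDistr g := by
    ext φ
    rw [toDistr_apply hgl]
    obtain ⟨r, -, hr⟩ := TF.exists_radius φ
    obtain ⟨n, hn⟩ := exists_nat_gt r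
    rw [hGT n φ fun x hx => hr x (by simpa using hn.trans hx)]
    refine integral_congr_ae (hg.mono fun x hx => ?_)
    by_cases h : r < ‖x‖
    · simp [hr x h]
    · simp only
      rw [hx n (by simpa using (not_lt.1 h).trans_lt hn)]
  refine ⟨g, hgl, hTg, fun x₀ r C hC hb => ?_⟩
  obtain ⟨H, hH2, hHC, hHT⟩ := exists_representative_on_ball T x₀ r hC hb
  have hae := ae_eq_on_open (Metric.isOpen_ball (x := x₀) (ε := r)) hgl
    (hH2.locallyIntegrable (by norm_num)) fun φ hφ => by
      rw [← hHT φ fun x hx => eq_zero_of_tsupport_subset_ball hφ hx, hTg, toDistr_apply hgl]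
  calc ∫⁻ x in Metric.ball x₀ r, ‖g x‖ₑ ^ 2 = ∫⁻ x in Metric.ball x₀ r, ‖H x‖ₑ ^ 2 := by
        refine setLIntegral_congr_fun_ae measurableSet_ball (hae.mono fun x hx h => ?_)
        rw [hx h]
    _ ≤ _ := (setLIntegral_le_lintegral _ _).trans hHC

/-- A distribution satisfying Morrey bounds is a Morrey function. -/
lemma exists_memMorrey_representative {p : ℝ} (T : Distr) {M : ℝ} (hM : 0 ≤ M)
    (hT : ∀ (x₀ : E3) (r : ℝ), 0 < r → ∀ φ : TF, (∀ x : E3, r < ‖x - x₀‖ → φ x = 0) →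
      |T φ| ≤ M * r ^ (3 / 2 - 3 / p) * normTwo φ) :
    ∃ g : E3 → ℝ, MemMorrey p g ∧ T = toDistr g := by
  obtain ⟨g, hg, hTg, hb⟩ := exists_representative T fun n =>
    ⟨M * (n + 1 : ℝ) ^ (3 / 2 - 3 / p), by positivity, fun φ hφ => hT 0 (n + 1) (by positivity) φ
      fun x hx => hφ x (by rw [sub_zero] at hx; linarith)⟩
  refine ⟨g, memMorrey_iff.2 ⟨hg.aestronglyMeasurable, M ^ 2 * 2 ^ (3 - 2 * (3 / p)), by positivity,
    fun x R hR => ?_⟩, hTg⟩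
  -- The representative is controlled on open balls only, hence the doubled radius.
  have h := hb x (2 * R) (M * (2 * R) ^ (3 / 2 - 3 / p)) (by positivity)
    (hT x (2 * R) (by positivity))
  refine (lintegral_mono_set (Metric.closedBall_subset_ball (by linarith))).trans (h.trans
    (ENNReal.ofReal_le_ofReal (le_of_eq ?_)))
  rw [mul_pow, ← Real.rpow_natCast (_ ^ (_ : ℝ)), ← Real.rpow_mul (by positivity), mul_assoc,
    ← Real.mul_rpow (by norm_num) hR.le]
  congr 2; push_cast; ring

/-! ### Calderón–Zygmund estimates in Morrey spaces. -/

lemma conv_zero_left (φ : TF) : conv 0 φ = 0 := by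
  ext x
  rw [TF.conv_apply]
  change ∫ y, (0 : ℝ) * φ (x - y) = 0
  simp

lemma conv_sum_left {ι : Type*} (s : Finset ι) (f : ι → TF) (φ : TF) :
    conv (∑ a ∈ s, f a) φ = ∑ a ∈ s, conv (f a) φ := by
  classical
  induction s using Finset.induction_on with
  | empty => simp [conv_zero_left]
  | insert a s ha ih =>
    rw [Finset.sum_insert ha, Finset.sum_insert ha, ← ih]
    have := TF.conv_sub_left (f a + ∑ x ∈ s, f x) (∑ x ∈ s, f x) φ
    rw [add_sub_cancel_right] at this
    rw [this]; abel

lemma bilap_conv (β φ : TF) : bilap (conv β φ) = conv (bilap β) φ := by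
  simp only [bilap, TF.D_conv_left, conv_sum_left]

lemma lintegral_enorm_le_normTwo {φ : TF} {x₀ : E3} {r : ℝ} (hr : 0 < r)
    (hφ : ∀ x : E3, r < ‖x - x₀‖ → φ x = 0) :
    ∫⁻ x, ‖φ x‖ₑ ≤ ENNReal.ofReal (Real.sqrt unitVol * r ^ (3 / 2 : ℝ) * normTwo φ) := by
  have hV := unitVol_pos
  have hN := normTwo_nonneg φ
  have hφm : Measurable fun y => ‖φ y‖ₑ := φ.continuous.measurable.enorm
  have hs : ∫⁻ x, ‖φ x‖ₑ = ∫⁻ x in Metric.closedBall x₀ r, ‖φ x‖ₑ * 1 := by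
    simp only [mul_one]
    refine (setLIntegral_eq_of_support_subset ?_).symm
    intro x hx
    rw [Metric.mem_closedBall, dist_eq_norm]
    by_contra hc
    exact hx (by simp [hφ x (not_le.1 hc)])
  rw [hs, ← ENNReal.pow_le_pow_left_iff (n := 2) (by norm_num)]
  refine (lintegral_mul_sq_le hφm.aemeasurable aemeasurable_const).trans ?_
  simp only [one_pow, lintegral_const, Measure.restrict_apply_univ, one_mul]
  rw [volume_closedBall_eq_ofReal x₀ hr.le]
  calc _ ≤ ENNReal.ofReal (normTwo φ ^ 2) * ENNReal.ofReal (unitVol * r ^ 3) := by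
        gcongr
        exact (setLIntegral_le_lintegral _ _).trans (lintegral_enorm_sq_TF φ).le
    _ = _ := by
        rw [← ENNReal.ofReal_mul (by positivity), ← ENNReal.ofReal_pow (by positivity)]
        congr 1
        have h3 : (r ^ (3 / 2 : ℝ)) ^ 2 = r ^ 3 := by
          rw [← Real.rpow_natCast, ← Real.rpow_mul hr.le, ← Real.rpow_natCast]
          congr 1; push_cast; ring
        rw [mul_pow, mul_pow, h3, Real.sq_sqrt hV.le]
        ring

/-- The pairing of a Morrey function with fourth derivatives of the truncated parametrix. -/
lemma exists_bound_pairing {p : ℝ} (hp : 0 < p) {h : E3 → ℝ} (hh : MemMorrey p h) :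
    ∃ K : ℝ, 0 ≤ K ∧ ∀ ε R : ℝ, 0 < ε → ε ≤ R → ∀ (i j k l : Fin 3) (x₀ : E3) (r : ℝ), 0 < r →
      ∀ φ : TF, (∀ x : E3, r < ‖x - x₀‖ → φ x = 0) →
      |∫ y, D i (D j (D k (D l (conv (kern ε R) φ)))) y * h y|
        ≤ K * r ^ (3 / 2 - 3 / p) * normTwo φ := by
  set γ := 3 / p with hγ
  have hγ0 : 0 < γ := by positivity
  have hV := unitVol_pos
  obtain ⟨M₁, hM₁, hg₁⟩ := hh.exists_growth
  obtain ⟨hm, M₂, hM₂, hg₂⟩ := memMorrey_iff.1 hh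
  obtain ⟨Cχ, hCχ0, hCχ⟩ := exists_integral_abs_chi_le
  obtain ⟨Ck, hCk0, hCk⟩ := exists_bound_D_four_kern
  have hpc := potentialConst_pos (s := 3 - γ) (a := 3) (by linarith)
  set K₁ := Real.sqrt (M₂ * 2 ^ (3 - 2 * γ)) * (2 * Cχ) with hK₁
  set K₂ := Ck * (potentialConst (3 - γ) 3 * M₁) * Real.sqrt unitVol with hK₂
  have hK₁0 : 0 ≤ K₁ := by positivity
  have hK₂0 : 0 ≤ K₂ := by positivity
  refine ⟨K₁ + K₂, by positivity, fun ε R hε hR i j k l x₀ r hr φ hφ => ?_⟩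
  set w := D i (D j (D k (D l (conv (kern ε R) φ)))) with hw
  have hN := normTwo_nonneg φ
  have hwm : Measurable fun y => ‖w y‖ₑ := w.continuous.measurable.enorm
  have hφm : Measurable fun y => ‖φ y‖ₑ := φ.continuous.measurable.enorm
  -- Near the support of `φ`: fourth derivatives are controlled in `L²` by the bilaplacian, here
  -- `(chi ε - chi R) * φ`, and Young's inequality bounds it by `2 * Cχ` times the norm of `φ`. The
  -- Morrey bound on `h` supplies the power of `r`.
  have near : ∫⁻ y in Metric.closedBall x₀ (2 * r), ‖w y‖ₑ * ‖h y‖ₑ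
      ≤ ENNReal.ofReal (K₁ * r ^ (3 / 2 - γ) * normTwo φ) := by
    rw [← ENNReal.pow_le_pow_left_iff (n := 2) (by norm_num)]
    have h1 : ∫⁻ y, ‖w y‖ₑ ^ 2 ≤ ENNReal.ofReal ((2 * Cχ) ^ 2 * normTwo φ ^ 2) := by
      have hb : bilap (conv (kern ε R) φ) = conv (chi ε - chi R) φ := by
        rw [← bilap_kern hε hR, bilap_conv]
      have hχ : ∫⁻ y, ‖(chi ε - chi R) y‖ₑ ≤ ENNReal.ofReal (2 * Cχ) := by
        have h2 : ∀ t : ℝ, 0 < t → ∫⁻ y, ‖chi t y‖ₑ ≤ ENNReal.ofReal Cχ := by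
          intro t ht
          rw [← ofReal_integral_norm_eq_lintegral_enorm (TF.integrable (chi t))]
          exact ENNReal.ofReal_le_ofReal (hCχ t ht)
        calc ∫⁻ y, ‖(chi ε - chi R) y‖ₑ ≤ ∫⁻ y, (‖chi ε y‖ₑ + ‖chi R y‖ₑ) :=
              lintegral_mono fun y => enorm_sub_le
          _ = _ := lintegral_add_left (chi ε).continuous.measurable.enorm _
          _ ≤ ENNReal.ofReal Cχ + ENNReal.ofReal Cχ :=
              add_le_add (h2 ε hε) (h2 R (hε.trans_le hR))
          _ = _ := by rw [← ENNReal.ofReal_add hCχ0.le hCχ0.le, two_mul]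
      calc ∫⁻ y, ‖w y‖ₑ ^ 2 = ENNReal.ofReal (normTwo w ^ 2) := lintegral_enorm_sq_TF w
        _ ≤ ENNReal.ofReal (normTwo (bilap (conv (kern ε R) φ)) ^ 2) := by
            apply ENNReal.ofReal_le_ofReal
            exact pow_le_pow_left₀ (normTwo_nonneg _) (normTwo_D_four_le i j k l _) 2
        _ = ∫⁻ y, ‖conv (chi ε - chi R) φ y‖ₑ ^ 2 := by rw [hb, lintegral_enorm_sq_TF]
        _ ≤ (∫⁻ y, ‖(chi ε - chi R) y‖ₑ) ^ 2 * ∫⁻ x, ‖φ x‖ₑ ^ 2 := lintegral_conv_sq_le _ _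
        _ ≤ ENNReal.ofReal (2 * Cχ) ^ 2 * ENNReal.ofReal (normTwo φ ^ 2) := by
            rw [lintegral_enorm_sq_TF]; gcongr
        _ = _ := by rw [← ENNReal.ofReal_pow (by positivity), ← ENNReal.ofReal_mul (by positivity)]
    refine (lintegral_mul_sq_le hwm.aemeasurable hm.restrict.enorm).trans ?_
    calc _ ≤ ENNReal.ofReal ((2 * Cχ) ^ 2 * normTwo φ ^ 2) *
          ENNReal.ofReal (M₂ * (2 * r) ^ (3 - 2 * γ)) := by
          gcongr
          · exact (setLIntegral_le_lintegral _ _).trans h1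
          · exact hg₂ x₀ (2 * r) (by positivity)
      _ = _ := by
          rw [← ENNReal.ofReal_mul (by positivity), ← ENNReal.ofReal_pow (by positivity)]
          congr 1
          have h3 : (r ^ (3 / 2 - γ)) ^ 2 = r ^ (3 - 2 * γ) := by
            rw [← Real.rpow_natCast, ← Real.rpow_mul hr.le]; congr 1; push_cast; ring
          have h4 : K₁ ^ 2 = M₂ * 2 ^ (3 - 2 * γ) * (2 * Cχ) ^ 2 := by
            rw [hK₁, mul_pow, Real.sq_sqrt (by positivity)]
          rw [mul_pow (K₁ * _), mul_pow K₁, h3, h4, Real.mul_rpow (by norm_num) hr.le]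
          ring
  -- Away from the support the kernel is `O(‖y - x‖⁻³)` and `‖y - x‖ ≥ r`. Since `|h|` grows with
  -- exponent `3 - γ < 3`, the integral converges at infinity and gives `r^(-γ)`; the factor
  -- `r^(3/2)` comes from bounding the `L¹` norm of `φ` by its `L²` norm.
  have far : ∫⁻ y in (Metric.closedBall x₀ (2 * r))ᶜ, ‖w y‖ₑ * ‖h y‖ₑ
      ≤ ENNReal.ofReal (K₂ * r ^ (3 / 2 - γ) * normTwo φ) := by
    have hwb : ∀ y, ‖w y‖ₑ ≤ ∫⁻ x, ‖φ x‖ₑ * ‖D i (D j (D k (D l (kern ε R)))) (y - x)‖ₑ := by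
      intro y
      rw [hw]
      simp only [TF.D_conv_left]
      rw [TF.conv_apply']
      refine (enorm_integral_le_lintegral_enorm _).trans (le_of_eq ?_)
      simp only [enorm_mul]
    set β := D i (D j (D k (D l (kern ε R))))
    have hβm : Measurable fun y => ‖β y‖ₑ := β.continuous.measurable.enorm
    have hβ : ∀ z : E3, z ≠ 0 → ‖β z‖ₑ ≤ ENNReal.ofReal Ck * ENNReal.ofReal (‖z‖ ^ (-3 : ℝ)) := by
      intro z hz
      have hz' : 0 < ‖z‖ := norm_pos_iff.2 hz
      rw [← ENNReal.ofReal_mul hCk0.le, ← ofReal_norm]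
      apply ENNReal.ofReal_le_ofReal
      rw [Real.rpow_neg hz'.le, ← div_eq_mul_inv, le_div_iff₀ (by positivity), mul_comm]
      have := hCk ε R hε hR i j k l z
      rw [← Real.norm_eq_abs] at this
      exact_mod_cast this
    have hinner : ∀ x, ‖φ x‖ₑ * ∫⁻ y in (Metric.closedBall x₀ (2 * r))ᶜ, ‖β (y - x)‖ₑ * ‖h y‖ₑ
        ≤ ‖φ x‖ₑ * ENNReal.ofReal (Ck * (potentialConst (3 - γ) 3 * M₁) * r ^ (-γ)) := by
      intro x
      by_cases hx : r < ‖x - x₀‖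
      · simp [hφ x hx]
      gcongr
      have hsub : (Metric.closedBall x₀ (2 * r))ᶜ ⊆ {y | r ≤ ‖y - x‖} := by
        intro y hy
        rw [mem_compl_iff, Metric.mem_closedBall, dist_eq_norm, not_le] at hy
        have := norm_sub_le_norm_sub_add_norm_sub y x x₀
        rw [Set.mem_ofPred_eq]
        linarith [not_lt.1 hx]
      have hms : MeasurableSet {y : E3 | r ≤ ‖y - x‖} :=
        measurableSet_le measurable_const (by fun_prop)
      calc _ ≤ ∫⁻ y in {y | r ≤ ‖y - x‖}, ‖β (y - x)‖ₑ * ‖h y‖ₑ := lintegral_mono_set hsub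
        _ ≤ ∫⁻ y in {y | r ≤ ‖y - x‖},
            ENNReal.ofReal Ck * (‖h y‖ₑ * ENNReal.ofReal (‖y - x‖ ^ (-3 : ℝ))) := by
          refine setLIntegral_mono' hms fun y hy => ?_
          have hne : y - x ≠ 0 := norm_pos_iff.1 (hr.trans_le hy)
          calc _ ≤ _ := mul_le_mul_left (hβ _ hne) _
            _ = _ := by ring
        _ = ENNReal.ofReal Ck * ∫⁻ y in {y | r ≤ ‖y - x‖},
            ‖h y‖ₑ * ENNReal.ofReal (‖y - x‖ ^ (-3 : ℝ)) :=
          lintegral_const_mul' _ _ ENNReal.ofReal_ne_top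
        _ ≤ ENNReal.ofReal Ck *
            ENNReal.ofReal (potentialConst (3 - γ) 3 * M₁ * r ^ (3 - γ - 3)) := by
          gcongr
          exact lintegral_potential_far (by linarith) (by norm_num) hM₁ hr
            fun t ht => hg₁ x t (hr.trans_le ht)
        _ = _ := by
          rw [← ENNReal.ofReal_mul hCk0.le, show 3 - γ - 3 = -γ by ring]
          congr 1; ring
    have hφ1 := lintegral_enorm_le_normTwo hr hφ
    set S := (Metric.closedBall x₀ (2 * r))ᶜ
    have hmeas : AEMeasurable (Function.uncurry fun (y x : E3) =>
        ‖φ x‖ₑ * (‖β (y - x)‖ₑ * ‖h y‖ₑ)) ((volume.restrict S).prod volume) := by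
      refine ((hφm.comp measurable_snd).aemeasurable).mul
        (((hβm.comp (measurable_fst.sub measurable_snd)).aemeasurable).mul ?_)
      exact (hm.restrict.enorm).comp_fst
    calc ∫⁻ y in S, ‖w y‖ₑ * ‖h y‖ₑ
        ≤ ∫⁻ y in S, ∫⁻ x, ‖φ x‖ₑ * (‖β (y - x)‖ₑ * ‖h y‖ₑ) := by
          refine lintegral_mono fun y => ?_
          refine (mul_le_mul_left (hwb y) _).trans (le_of_eq ?_)
          rw [← lintegral_mul_const' _ _ enorm_ne_top]
          simp only [mul_assoc]
      _ = ∫⁻ x, ∫⁻ y in S, ‖φ x‖ₑ * (‖β (y - x)‖ₑ * ‖h y‖ₑ) := lintegral_lintegral_swap hmeas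
      _ = ∫⁻ x, ‖φ x‖ₑ * ∫⁻ y in S, ‖β (y - x)‖ₑ * ‖h y‖ₑ := by
          refine lintegral_congr fun x => lintegral_const_mul' _ _ enorm_ne_top
      _ ≤ ∫⁻ x, ‖φ x‖ₑ * ENNReal.ofReal (Ck * (potentialConst (3 - γ) 3 * M₁) * r ^ (-γ)) :=
          lintegral_mono hinner
      _ = (∫⁻ x, ‖φ x‖ₑ) * ENNReal.ofReal (Ck * (potentialConst (3 - γ) 3 * M₁) * r ^ (-γ)) :=
          lintegral_mul_const' _ _ ENNReal.ofReal_ne_top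
      _ ≤ ENNReal.ofReal (Real.sqrt unitVol * r ^ (3 / 2 : ℝ) * normTwo φ) *
          ENNReal.ofReal (Ck * (potentialConst (3 - γ) 3 * M₁) * r ^ (-γ)) := by gcongr
      _ = _ := by
          rw [← ENNReal.ofReal_mul (by positivity)]
          congr 1
          rw [hK₂, sub_eq_add_neg (3 / 2 : ℝ), Real.rpow_add hr]
          ring
  have hfin : ‖∫ y, w y * h y‖ₑ ≤ ENNReal.ofReal ((K₁ + K₂) * r ^ (3 / 2 - γ) * normTwo φ) := by
    refine (enorm_integral_le_lintegral_enorm _).trans ?_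
    simp only [enorm_mul]
    rw [← lintegral_add_compl _ (Metric.isClosed_closedBall (x := x₀) (ε := 2 * r)).measurableSet]
    refine (add_le_add near far).trans (le_of_eq ?_)
    rw [← ENNReal.ofReal_add (by positivity) (by positivity)]
    congr 1; ring
  rw [← ofReal_norm, ENNReal.ofReal_le_ofReal_iff (by positivity), Real.norm_eq_abs] at hfin
  exact hfin

/-- The bilaplacian of a distribution. -/
def Distr.bilap (T : Distr) : Distr := ∑ a, ∑ b, ∂_{e b} (∂_{e b} (∂_{e a} (∂_{e a} T)))

lemma Distr.sum_apply {ι : Type*} (s : Finset ι) (T : ι → Distr) (φ : TF) :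
    (∑ j ∈ s, T j) φ = ∑ j ∈ s, T j φ := by
  classical
  induction s using Finset.induction_on with
  | empty => simp
  | insert a s ha ih =>
    rw [Finset.sum_insert ha, Finset.sum_insert ha, ← ih]; rfl

lemma Distr.bilap_apply (T : Distr) (φ : TF) :
    Distr.bilap T φ = T (MorreyRegularity.bilap φ) := by
  simp only [Distr.bilap, Distr.sum_apply, Distr.deriv_apply, neg_neg, MorreyRegularity.bilap,
    map_sum]

/-- The contraction `∑ ∂_a ∂_b ∂_c h_{abc}`. -/
def div3 (h : Fin 3 → Fin 3 → Fin 3 → Distr) : Distr :=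
  ∑ a, ∑ b, ∑ c, ∂_{e a} (∂_{e b} (∂_{e c} (h a b c)))

lemma abs_apply_sub_apply_conv_chi_le {p : ℝ} (hp : 0 < p) {ι : Type*} [Fintype ι] {T : Distr}
    {d : ι → Fin 4 → Fin 3} {h : ι → E3 → ℝ} (hh : ∀ n, MemMorrey p (h n))
    (hT : ∀ ψ : TF, T (bilap ψ) =
      ∑ n, ∫ y, D (d n 0) (D (d n 1) (D (d n 2) (D (d n 3) ψ))) y * h n y) :
    ∃ M : ℝ, 0 ≤ M ∧ ∀ R : ℝ, 0 < R → ∀ (x₀ : E3) (r : ℝ), 0 < r →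
      ∀ φ : TF, (∀ x : E3, r < ‖x - x₀‖ → φ x = 0) →
      |T φ - T (conv (chi R) φ)| ≤ M * r ^ (3 / 2 - 3 / p) * normTwo φ := by
  choose K hK0 hK using fun n => exists_bound_pairing hp (hh n)
  refine ⟨∑ n, K n, Finset.sum_nonneg fun n _ => hK0 n, fun R hR x₀ r hr φ hφ => ?_⟩
  -- `T φ` is the limit of `T (chi ε * φ)` as `ε → 0`, and `chi ε - chi R` is the bilaplacian of
  -- `kern ε R`. The hypothesis on `T` turns the difference into pairings bounded uniformly in `ε`
  -- and `R`.
  have hlim := ((tendsto_apply_conv_chi T φ).sub_const (T (conv (chi R) φ))).abs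
  refine le_of_tendsto hlim ?_
  filter_upwards [self_mem_nhdsWithin, mem_nhdsWithin_of_mem_nhds (Iio_mem_nhds hR)] with ε hε hεR
  have hε : 0 < ε := hε
  rw [← map_sub, ← TF.conv_sub_left, ← bilap_kern hε (le_of_lt hεR), ← bilap_conv, hT,
    Finset.sum_mul, Finset.sum_mul]
  refine (Finset.abs_sum_le_sum_abs _ _).trans (Finset.sum_le_sum fun n _ => ?_)
  exact hK n ε R hε (le_of_lt hεR) _ _ _ _ x₀ r hr φ hφ

/-- Calderón–Zygmund estimate in Morrey spaces: a distribution vanishing at infinity whose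
bilaplacian is a combination of fourth derivatives of Morrey functions is a Morrey function. -/
lemma exists_memMorrey_of_bilap {p : ℝ} (hp : 0 < p) {ι : Type*} [Fintype ι] {T : Distr}
    {d : ι → Fin 4 → Fin 3} {h : ι → E3 → ℝ} (hh : ∀ n, MemMorrey p (h n))
    (hT : ∀ ψ : TF, T (bilap ψ) =
      ∑ n, ∫ y, D (d n 0) (D (d n 1) (D (d n 2) (D (d n 3) ψ))) y * h n y)
    {R : ℕ → ℝ} (hR : ∀ n, 0 < R n)
    (hdec : ∀ φ : TF, Filter.Tendsto (fun n => T (conv (chi (R n)) φ)) Filter.atTop (nhds 0)) :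
    ∃ g : E3 → ℝ, MemMorrey p g ∧ T = toDistr g := by
  obtain ⟨M, hM, hb⟩ := abs_apply_sub_apply_conv_chi_le hp hh hT
  refine exists_memMorrey_representative T hM fun x₀ r hr φ hφ => ?_
  -- The bound does not depend on the scale `R n`, so it survives the limit in which the mollified
  -- term disappears.
  have hlim := ((hdec φ).const_sub (T φ)).abs
  rw [sub_zero] at hlim
  exact le_of_tendsto hlim (Filter.Eventually.of_forall fun n => hb (R n) (hR n) x₀ r hr φ hφ)

lemma enorm_integral_mul_le_of_growth {s M B R : ℝ} (hB : 0 ≤ B) {u : E3 → ℝ}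
    {x : E3} (hu : GrowthAt s M (fun y => ‖u y‖ₑ) x R) {β : TF} (hβ : ∀ y, |β y| ≤ B)
    (hs : ∀ y : E3, R < ‖y‖ → β y = 0) :
    ‖∫ y, u y * β (y - x)‖ₑ ≤ ENNReal.ofReal (B * (M * R ^ s)) := by
  have h1 : ∀ y, ‖u y * β (y - x)‖ₑ ≤
      (Metric.closedBall x R).indicator (fun y => ENNReal.ofReal B * ‖u y‖ₑ) y := by
    intro y
    by_cases hy : y ∈ Metric.closedBall x R
    · rw [indicator_of_mem hy, enorm_mul, mul_comm]
      gcongr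
      rw [← ofReal_norm]
      exact ENNReal.ofReal_le_ofReal (hβ _)
    · rw [Metric.mem_closedBall, dist_eq_norm, not_le] at hy
      simp [hs _ hy]
  calc _ ≤ ∫⁻ y, ‖u y * β (y - x)‖ₑ := enorm_integral_le_lintegral_enorm _
    _ ≤ _ := lintegral_mono h1
    _ = ENNReal.ofReal B * ∫⁻ y in Metric.closedBall x R, ‖u y‖ₑ := by
        rw [lintegral_indicator Metric.isClosed_closedBall.measurableSet,
          lintegral_const_mul' _ _ ENNReal.ofReal_ne_top]
    _ ≤ ENNReal.ofReal B * ENNReal.ofReal (M * R ^ s) := by gcongr; exact hu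
    _ = _ := by rw [← ENNReal.ofReal_mul hB]

lemma D_chi_eq_zero {t : ℝ} (ht : 0 < t) (i : Fin 3) {x : E3} (hx : t < ‖x‖) :
    D i (chi t) x = 0 :=
  D_eq_zero_of_norm (fun _ h => chi_eq_zero ht h.le) i x hx

/-- The derivative of `chi R` is of size `R⁻⁴` on a ball of radius `R`, over which `|u|` has
integral `O(R^(3 - 3/p))`. The extra `R⁻¹` is what makes derivatives of `u` vanish at infinity. -/
lemma exists_bound_integral_mul_D_chi {p : ℝ} {u : E3 → ℝ} (hu : MemMorrey p u) :
    ∃ C : ℝ, 0 ≤ C ∧ ∀ R : ℝ, 0 < R → ∀ (i : Fin 3) (x : E3),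
      |∫ y, u y * D i (chi R) (y - x)| ≤ C * R ^ (-1 - 3 / p) := by
  obtain ⟨M, hM, hg⟩ := hu.exists_growth
  obtain ⟨C, hC, hb⟩ := exists_bound_D_chi
  refine ⟨C * M, by positivity, fun R hR i x => ?_⟩
  have := enorm_integral_mul_le_of_growth (by positivity) (hg x R hR) (hb R hR i)
    fun y hy => D_chi_eq_zero hR i hy
  rw [← ofReal_norm, ENNReal.ofReal_le_ofReal_iff (by positivity), Real.norm_eq_abs] at this
  refine this.trans (le_of_eq ?_)
  have h4 : R⁻¹ ^ 4 = R ^ (-4 : ℝ) := by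
    rw [Real.rpow_neg hR.le, inv_pow]; norm_cast
  rw [h4, show (-1 - 3 / p : ℝ) = -4 + (3 - 3 / p) by ring, Real.rpow_add hR]
  ring

/-- Derivatives of Morrey functions vanish at infinity. -/
lemma tendsto_deriv_toDistr_conv_chi {p : ℝ} (hp : 0 < p) {u : E3 → ℝ} (hu : MemMorrey p u)
    (i : Fin 3) (φ : TF) :
    Filter.Tendsto (fun R => (∂_{e i} (toDistr u)) (conv (chi R) φ)) Filter.atTop (nhds 0) := by
  obtain ⟨C, hC, hb⟩ := exists_bound_integral_mul_D_chi hu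
  have hγ : 0 < 3 / p := by positivity
  have hz : Filter.Tendsto (fun R : ℝ => (C * ∫ x, |φ x|) * R ^ (-(1 + 3 / p)))
      Filter.atTop (nhds 0) := by
    simpa using (tendsto_rpow_neg_atTop (y := 1 + 3 / p) (by positivity)).const_mul
      (C * ∫ x, |φ x|)
  refine squeeze_zero_norm' ?_ hz
  filter_upwards [Filter.eventually_gt_atTop 0] with R hR
  rw [Distr.deriv_apply, norm_neg, toDistr_apply hu.locallyIntegrable, TF.D_conv_left,
    TF.integral_conv_mul hu.locallyIntegrable]
  calc _ ≤ ∫ x, C * R ^ (-1 - 3 / p) * |φ x| := by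
        refine norm_integral_le_of_norm_le ((TF.integrable φ).abs.const_mul _)
          (Filter.Eventually.of_forall fun x => ?_)
        rw [norm_mul, mul_comm, Real.norm_eq_abs, Real.norm_eq_abs]
        exact mul_le_mul_of_nonneg_right (hb R hR i x) (abs_nonneg _)
    _ = _ := by rw [integral_const_mul, show (-1 - 3 / p) = -(1 + 3 / p) by ring]; ring

/-- Regularity for the linear equation `Δ² u = ∑ ∂_a ∂_b ∂_c h_{abc}` in Morrey spaces. -/
lemma exists_deriv_memMorrey {p : ℝ} (hp : 0 < p) {u : E3 → ℝ} (hu : MemMorrey p u)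
    {h : Fin 3 → Fin 3 → Fin 3 → E3 → ℝ} (hh : ∀ a b c, MemMorrey p (h a b c))
    (heq : Distr.bilap (toDistr u) = div3 fun a b c => toDistr (h a b c)) (i : Fin 3) :
    ∃ g : E3 → ℝ, MemMorrey p g ∧ ∂_{e i} (toDistr u) = toDistr g := by
  refine exists_memMorrey_of_bilap hp (ι := Fin 3 × Fin 3 × Fin 3)
    (d := fun n => ![n.2.2, n.2.1, n.1, i]) (h := fun n => h n.1 n.2.1 n.2.2)
    (fun n => hh _ _ _) (fun ψ => ?_) (R := fun n => (n : ℝ) + 1) (fun n => by positivity)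
    fun φ => (tendsto_deriv_toDistr_conv_chi hp hu i φ).comp
      (Filter.tendsto_atTop_add_const_right _ _ tendsto_natCast_atTop_atTop)
  -- Moving `∂_i` onto the test function adds one derivative to the three of `div3`, which gives the
  -- four required.
  have h1 : D i (bilap ψ) = bilap (D i ψ) := by
    simp only [bilap, map_sum, TF.D_comm i]
  rw [Distr.deriv_apply, h1, ← Distr.bilap_apply, heq]
  simp only [div3, Distr.sum_apply, Distr.deriv_apply, neg_neg, Fintype.sum_prod_type,
    Finset.sum_neg_distrib]
  simp [toDistr_apply (hh _ _ _).locallyIntegrable]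

/-! ### Regularization at a given scale and Hölder continuity. -/

/-- The regularization of a function at scale `R`. -/
def moll (f : E3 → ℝ) (R : ℝ) (x : E3) : ℝ := ∫ y, f y * chi R (y - x)

lemma moll_eq_apply {f : E3 → ℝ} (hf : LocallyIntegrable f) (R : ℝ) (x : E3) :
    moll f R x = toDistr f (reflect (chi R) x) := by
  rw [toDistr_apply hf, moll]
  congr 1; ext y
  rw [TF.reflect_apply, ← chi_neg, neg_sub, mul_comm]

lemma reflect_sub (β β' : TF) (x : E3) : reflect (β - β') x = reflect β x - reflect β' x := rfl

lemma reflect_sum {ι : Type*} (s : Finset ι) (β : ι → TF) (x : E3) :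
    reflect (∑ j ∈ s, β j) x = ∑ j ∈ s, reflect (β j) x := by
  ext y
  simp only [TF.reflect_apply, TF.sum_apply]

lemma bilap_reflect (β : TF) (x : E3) : bilap (reflect β x) = reflect (bilap β) x := by
  simp only [bilap, reflect_sum, TF.D_reflect, map_neg, neg_neg]

/-- Pairings with third derivatives of the truncated parametrix are bounded by potentials. -/
lemma exists_enorm_integral_D_three_le :
    ∃ C : ℝ, 0 < C ∧ ∀ ε R : ℝ, 0 < ε → ε ≤ R → ∀ (i j k : Fin 3) (x : E3) (g : E3 → ℝ),
      ‖∫ y, D i (D j (D k (reflect (kern ε R) x))) y * g y‖ₑ ≤ ENNReal.ofReal C *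
        ∫⁻ y in Metric.closedBall x R, ‖g y‖ₑ * ENNReal.ofReal (‖y - x‖ ^ (-2 : ℝ)) := by
  obtain ⟨Ck, hCk, hb⟩ := exists_bound_D_three_kern
  refine ⟨Ck, hCk, fun ε R hε hR i j k x g => ?_⟩
  have hpt : ∀ y, y ≠ x → ‖D i (D j (D k (reflect (kern ε R) x))) y * g y‖ₑ ≤
      (Metric.closedBall x R).indicator (fun y => ENNReal.ofReal Ck *
        (‖g y‖ₑ * ENNReal.ofReal (‖y - x‖ ^ (-2 : ℝ)))) y := by
    intro y hyx
    have hv : D i (D j (D k (reflect (kern ε R) x))) y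
        = - D i (D j (D k (kern ε R))) (x - y) := by
      simp only [TF.D_reflect, map_neg, neg_neg]
      rfl
    rw [hv, enorm_mul, enorm_neg]
    by_cases hy : y ∈ Metric.closedBall x R
    · rw [indicator_of_mem hy, ← mul_assoc, mul_right_comm]
      refine mul_le_mul_left ?_ _
      have hz' : 0 < ‖y - x‖ := norm_pos_iff.2 (sub_ne_zero.2 hyx)
      rw [← ENNReal.ofReal_mul hCk.le, ← ofReal_norm]
      apply ENNReal.ofReal_le_ofReal
      rw [Real.rpow_neg hz'.le, ← div_eq_mul_inv, le_div_iff₀ (by positivity), mul_comm]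
      have := hb ε R hε hR i j k (x - y)
      rw [← Real.norm_eq_abs, norm_sub_rev x y] at this
      exact_mod_cast this
    · rw [Metric.mem_closedBall, dist_eq_norm, not_le, norm_sub_rev] at hy
      have h0 : D i (D j (D k (kern ε R))) (x - y) = 0 := by
        refine D_eq_zero_of_norm ?_ i _ hy
        refine D_eq_zero_of_norm ?_ j
        exact D_eq_zero_of_norm (fun z hz => kern_eq_zero hz) k
      simp [h0]
  have hae : ∀ᵐ y : E3, y ≠ x := by
    simp [ae_iff, measure_singleton]
  calc _ ≤ _ := enorm_integral_le_lintegral_enorm _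
    _ ≤ _ := lintegral_mono_ae (hae.mono hpt)
    _ = _ := by
      rw [lintegral_indicator Metric.isClosed_closedBall.measurableSet,
        lintegral_const_mul' _ _ ENNReal.ofReal_ne_top]

lemma exists_bound_moll_sub_moll {p : ℝ} (hp : 3 < p) {f : E3 → ℝ} (hf : LocallyIntegrable f)
    {g : Fin 3 → E3 → ℝ} (hg : ∀ i, MemMorrey p (g i))
    (hfg : ∀ i, ∂_{e i} (toDistr f) = toDistr (g i)) :
    ∃ C : ℝ, 0 ≤ C ∧ ∀ ε R : ℝ, 0 < ε → ε ≤ R → ∀ x,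
      |moll f ε x - moll f R x| ≤ C * R ^ (1 - 3 / p) := by
  have hp0 : 0 < p := by linarith
  have hγ : 3 / p < 1 := (div_lt_one hp0).2 hp
  choose M hM hgr using fun i => (hg i).exists_growth
  obtain ⟨Ck, hCk, hb⟩ := exists_enorm_integral_D_three_le
  have hpc := potentialConst_pos (s := 3 - 3 / p) (a := 2) (by linarith)
  refine ⟨∑ a, ∑ _b : Fin 3, Ck * (potentialConst (3 - 3 / p) 2 * M a),
    Finset.sum_nonneg fun a _ => Finset.sum_nonneg fun _ _ => by have := hM a; positivity,
    fun ε R hε hR x => ?_⟩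
  have hR0 : 0 < R := hε.trans_le hR
  rw [moll_eq_apply hf, moll_eq_apply hf, ← map_sub, ← reflect_sub, ← bilap_kern hε hR,
    ← bilap_reflect]
  simp only [bilap, map_sum]
  rw [Finset.sum_mul]
  refine (Finset.abs_sum_le_sum_abs _ _).trans (Finset.sum_le_sum fun a _ => ?_)
  rw [Finset.sum_mul]
  refine (Finset.abs_sum_le_sum_abs _ _).trans (Finset.sum_le_sum fun b _ => ?_)
  -- One of the four derivatives of the parametrix is moved onto `f`. Three remain on the kernel,
  -- which is then `O(‖x‖⁻²)`.
  rw [← neg_neg (toDistr f _), ← Distr.deriv_apply, hfg, toDistr_apply (hg a).locallyIntegrable,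
    abs_neg]
  have : ‖∫ y, D a (D b (D b (reflect (kern ε R) x))) y * g a y‖ₑ ≤
      ENNReal.ofReal (Ck * (potentialConst (3 - 3 / p) 2 * M a) * R ^ (1 - 3 / p)) := by
    calc _ ≤ ENNReal.ofReal Ck * ∫⁻ y in Metric.closedBall x R,
          ‖g a y‖ₑ * ENNReal.ofReal (‖y - x‖ ^ (-2 : ℝ)) := hb ε R hε hR a b b x (g a)
      _ ≤ ENNReal.ofReal Ck *
          ENNReal.ofReal (potentialConst (3 - 3 / p) 2 * M a * R ^ (3 - 3 / p - 2)) := by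
        gcongr
        -- Convergence at the singularity requires `3 - 3/p > 2`, that is `p > 3`.
        exact lintegral_potential_near (by linarith) (by norm_num) (hM a) hR0
          fun t ht _ => hgr a x t ht
      _ = _ := by
        rw [← ENNReal.ofReal_mul hCk.le, show 3 - 3 / p - 2 = 1 - 3 / p by ring]
        congr 1; ring
  have hMa := hM a
  rwa [← ofReal_norm, ENNReal.ofReal_le_ofReal_iff (by positivity), Real.norm_eq_abs] at this

lemma norm_clm_le (L : E3 →L[ℝ] ℝ) {C : ℝ} (hC : 0 ≤ C) (h : ∀ i, |L (e i)| ≤ C) :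
    ‖L‖ ≤ 3 * C := by
  refine L.opNorm_le_bound (by positivity) fun v => ?_
  have hv : v = ∑ i, v i • e i := by
    ext j
    simp [e, Finset.sum_apply, Pi.single_apply]
  conv_lhs => rw [hv]
  rw [map_sum]
  refine (norm_sum_le _ _).trans ?_
  calc _ ≤ ∑ _i : Fin 3, C * ‖v‖ := Finset.sum_le_sum fun i _ => by
        rw [map_smul, norm_smul, mul_comm, Real.norm_eq_abs]
        exact mul_le_mul (h i) (PiLp.norm_apply_le v i) (norm_nonneg _) hC
    _ = _ := by simp; ring

lemma moll_eq_convolution (f : E3 → ℝ) (R : ℝ) : moll f R =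
    MeasureTheory.convolution f (chi R) (ContinuousLinearMap.lsmul ℝ ℝ) volume := by
  ext z
  rw [moll, MeasureTheory.convolution]
  congr 1; ext y
  rw [← chi_neg, neg_sub]; rfl

lemma smooth_moll {f : E3 → ℝ} (hf : LocallyIntegrable f) (R : ℝ) : Smooth (moll f R) := by
  rw [moll_eq_convolution]
  exact (chi R).hasCompactSupport.contDiff_convolution_right _ hf (chi R).contDiff

/-- Regularization commutes with weak derivatives. -/
lemma pd_moll {f g : E3 → ℝ} (hf : LocallyIntegrable f) (hg : LocallyIntegrable g) {i : Fin 3}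
    (hfg : ∂_{e i} (toDistr f) = toDistr g) (R : ℝ) : pd i (moll f R) = moll g R := by
  ext z
  have hder : HasFDerivAt (moll f R) ((MeasureTheory.convolution f (fderiv ℝ (chi R))
      (ContinuousLinearMap.lsmul ℝ ℝ) volume) z) z := by
    rw [moll_eq_convolution]
    exact fderiv_smul_convolution hf (chi R).smooth (chi R).hasCompactSupport z
  have hI : Integrable fun y => f y • fderiv ℝ (chi R) (z - y) := by
    have hc : Continuous fun y => fderiv ℝ (chi R) (z - y) :=
      ((chi R).smooth.continuous_fderiv (by simp)).comp (continuous_const.sub continuous_id)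
    exact hf.integrable_smul_right_of_hasCompactSupport hc
      (((chi R).hasCompactSupport.fderiv ℝ).comp_homeomorph (Homeomorph.subLeft z))
  rw [pd, hder.fderiv, MeasureTheory.convolution]
  change (∫ y, f y • fderiv ℝ (chi R) (z - y)) (e i) = _
  rw [ContinuousLinearMap.integral_apply hI]
  have h2 : toDistr f (reflect (D i (chi R)) z) = moll g R z := by
    rw [moll_eq_apply hg, ← hfg, Distr.deriv_apply, TF.D_reflect, map_neg, neg_neg]
  rw [toDistr_apply hf] at h2
  rw [← h2]
  congr 1; ext y
  rw [TF.reflect_apply, coe_D, mul_comm]; rfl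

/-- The gradient of `moll f R` is the regularization of the Morrey functions `g i`, which is
`O(R^(-3/p))`; the mean value inequality concludes. -/
lemma exists_bound_moll_sub {p : ℝ} {f : E3 → ℝ} (hf : LocallyIntegrable f)
    {g : Fin 3 → E3 → ℝ} (hg : ∀ i, MemMorrey p (g i))
    (hfg : ∀ i, ∂_{e i} (toDistr f) = toDistr (g i)) :
    ∃ C : ℝ, 0 ≤ C ∧ ∀ R : ℝ, 0 < R → ∀ x x',
      |moll f R x - moll f R x'| ≤ C * R ^ (-(3 / p)) * ‖x - x'‖ := by
  choose M hM hgr using fun i => (hg i).exists_growth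
  obtain ⟨C, hC, hb⟩ := exists_bound_chi
  set N := ∑ i, M i
  have hMN : ∀ i, M i ≤ N := fun i => Finset.single_le_sum (fun j _ => hM j) (Finset.mem_univ i)
  have hN : 0 ≤ N := Finset.sum_nonneg fun i _ => hM i
  refine ⟨3 * (C * N), by positivity, fun R hR x x' => ?_⟩
  have hval : ∀ z i, |fderiv ℝ (moll f R) z (e i)| ≤ C * N * R ^ (-(3 / p)) := by
    intro z i
    have h1 : fderiv ℝ (moll f R) z (e i) = moll (g i) R z :=
      congrFun (pd_moll hf (hg i).locallyIntegrable (hfg i) R) z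
    rw [h1, moll]
    have := enorm_integral_mul_le_of_growth (by positivity) (hgr i z R hR) (hb R hR)
      fun y hy => chi_eq_zero hR hy.le
    have hMi := hM i
    rw [← ofReal_norm, ENNReal.ofReal_le_ofReal_iff (by positivity), Real.norm_eq_abs] at this
    refine this.trans ?_
    have h3 : R⁻¹ ^ 3 = R ^ (-3 : ℝ) := by
      rw [Real.rpow_neg hR.le, inv_pow]; norm_cast
    rw [h3, show -(3 / p) = (-3 : ℝ) + (3 - 3 / p) by ring, Real.rpow_add hR]
    calc _ = C * M i * (R ^ (-3 : ℝ) * R ^ (3 - 3 / p)) := by ring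
      _ ≤ _ := by
        gcongr
        exact hMN i
  have := (convex_univ (𝕜 := ℝ) (E := E3)).norm_image_sub_le_of_norm_fderiv_le
    (f := moll f R) (C := 3 * (C * N * R ^ (-(3 / p))))
    (fun z _ => (smooth_moll hf R).differentiable (by simp) z)
    (fun z _ => norm_clm_le _ (by positivity) (hval z)) (mem_univ x') (mem_univ x)
  rw [Real.norm_eq_abs] at this
  refine this.trans (le_of_eq ?_)
  ring

lemma toDistr_apply_conv_chi {f : E3 → ℝ} (hf : LocallyIntegrable f) (R : ℝ) (φ : TF) :
    toDistr f (conv (chi R) φ) = ∫ x, φ x * moll f R x := by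
  rw [toDistr_apply hf, TF.integral_conv_mul hf]; rfl

/-- A function whose gradient is in a Morrey space with `p > 3` is Hölder continuous. -/
lemma exists_holder {p : ℝ} (hp : 3 < p) {f : E3 → ℝ} (hf : LocallyIntegrable f)
    {g : Fin 3 → E3 → ℝ} (hg : ∀ i, MemMorrey p (g i))
    (hfg : ∀ i, ∂_{e i} (toDistr f) = toDistr (g i)) :
    ∃ F : E3 → ℝ, f =ᵐ[volume] F ∧ (∃ C : ℝ≥0, HolderWith C (1 - 3 / p).toNNReal F) ∧
      ∃ C : ℝ, ∀ x, |moll f 1 x - F x| ≤ C := by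
  have hp0 : 0 < p := by linarith
  have hγ : 3 / p < 1 := (div_lt_one hp0).2 hp
  have hγ' : 0 < 1 - 3 / p := by linarith
  obtain ⟨A, hA, hA'⟩ := exists_bound_moll_sub_moll hp hf hg hfg
  obtain ⟨B, hB, hB'⟩ := exists_bound_moll_sub hf hg hfg
  let ε : ℕ → ℝ := fun n => ((n : ℝ) + 1)⁻¹
  have hε : ∀ n, 0 < ε n := fun n => by positivity
  have hεanti : Antitone ε := fun m n h => by
    have : (m : ℝ) ≤ n := by exact_mod_cast h
    exact inv_anti₀ (by positivity) (by linarith)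
  have hεlim : Filter.Tendsto ε Filter.atTop (nhds 0) :=
    (Filter.tendsto_atTop_add_const_right _ _ tendsto_natCast_atTop_atTop).inv_tendsto_atTop
  have hAlim : Filter.Tendsto (fun n => A * ε n ^ (1 - 3 / p)) Filter.atTop (nhds 0) := by
    have := (hεlim.rpow_const (p := 1 - 3 / p) (Or.inr hγ'.le)).const_mul A
    rwa [Real.zero_rpow hγ'.ne', mul_zero] at this
  have hcau : ∀ x, CauchySeq fun n => moll f (ε n) x := fun x =>
    cauchySeq_of_le_tendsto_0' (fun n => A * ε n ^ (1 - 3 / p)) (fun m n hmn => by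
      rw [dist_comm, Real.dist_eq]
      exact hA' _ _ (hε n) (hεanti hmn) x) hAlim
  choose F hF using fun x => cauchySeq_tendsto_of_complete (hcau x)
  have hFb : ∀ R, 0 < R → ∀ x, |moll f R x - F x| ≤ A * R ^ (1 - 3 / p) := by
    intro R hR x
    refine le_of_tendsto ((hF x).const_sub _).abs ?_
    filter_upwards [hεlim.eventually (Iio_mem_nhds hR)] with n hn
    rw [abs_sub_comm]
    exact hA' _ _ (hε n) (le_of_lt hn) x
  -- Regularizing at the scale `R = ‖x - x'‖` balances the two errors against the Lipschitz bound:
  -- `R^(-3/p) * R = R^(1 - 3/p)`.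
  have hFh : ∀ x x', |F x - F x'| ≤ (2 * A + B) * ‖x - x'‖ ^ (1 - 3 / p) := by
    intro x x'
    by_cases h : x = x'
    · subst h; simp; positivity
    have hR : 0 < ‖x - x'‖ := norm_pos_iff.2 (sub_ne_zero.2 h)
    set R := ‖x - x'‖ with hRdef
    have h1 := abs_le.1 (hFb R hR x)
    have h2 := abs_le.1 (hFb R hR x')
    have h3 := abs_le.1 (hB' R hR x x')
    rw [← hRdef] at h3
    have h4 : B * R ^ (-(3 / p)) * R = B * R ^ (1 - 3 / p) := by
      rw [mul_assoc, ← Real.rpow_add_one hR.ne']; congr 2; ring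
    rw [h4] at h3
    rw [abs_le]; constructor <;> linarith [h1.1, h1.2, h2.1, h2.2, h3.1, h3.2]
  have hhold : HolderWith (2 * A + B).toNNReal (1 - 3 / p).toNNReal F := by
    intro x x'
    rw [edist_dist, edist_dist, Real.dist_eq, dist_eq_norm, Real.coe_toNNReal _ hγ'.le,
      ENNReal.ofReal_rpow_of_nonneg (norm_nonneg _) hγ'.le]
    change _ ≤ ENNReal.ofReal _ * _
    rw [← ENNReal.ofReal_mul (by positivity)]
    exact ENNReal.ofReal_le_ofReal (hFh x x')
  have hFc : Continuous F := hhold.continuous (by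
    rw [Real.toNNReal_pos]; exact hγ')
  have hFl : LocallyIntegrable F := hFc.locallyIntegrable
  refine ⟨F, ae_eq_of_toDistr_eq hf hFl ?_, ⟨_, hhold⟩, A, fun x => ?_⟩
  · ext φ
    have hε' : Filter.Tendsto ε Filter.atTop (nhdsWithin 0 (Ioi 0)) :=
      tendsto_nhdsWithin_iff.2 ⟨hεlim, Filter.Eventually.of_forall hε⟩
    refine tendsto_nhds_unique ((tendsto_apply_conv_chi (toDistr f) φ).comp hε') ?_
    rw [toDistr_apply hFl, tendsto_iff_norm_sub_tendsto_zero]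
    have hz : Filter.Tendsto (fun n => (A * ε n ^ (1 - 3 / p)) * ∫ x, |φ x|) Filter.atTop
        (nhds 0) := by simpa using hAlim.mul_const (∫ x, |φ x|)
    refine squeeze_zero (fun n => norm_nonneg _) (fun n => ?_) hz
    have hmc : Continuous (moll f (ε n)) := by
      have hl : LipschitzWith (B * ε n ^ (-(3 / p))).toNNReal (moll f (ε n)) := by
        refine LipschitzWith.of_dist_le_mul fun x y => ?_
        rw [Real.dist_eq, dist_eq_norm, Real.coe_toNNReal _ (by have := hε n; positivity)]
        exact hB' _ (hε n) x y
      exact hl.continuous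
    simp only [Function.comp]
    rw [toDistr_apply_conv_chi hf, ← integral_sub (TF.integrable_mul hmc.locallyIntegrable φ)
      (TF.integrable_mul hFl φ)]
    refine (norm_integral_le_of_norm_le ((TF.integrable φ).abs.const_mul (A * ε n ^ (1 - 3 / p)))
      (Filter.Eventually.of_forall fun x => ?_)).trans (le_of_eq (integral_const_mul _ _))
    rw [← mul_sub, norm_mul, mul_comm, Real.norm_eq_abs, Real.norm_eq_abs]
    exact mul_le_mul_of_nonneg_right (hFb _ (hε n) x) (abs_nonneg _)
  · simpa using hFb 1 one_pos x

lemma exists_bound_moll {p : ℝ} {f : E3 → ℝ} (hf : MemMorrey p f) :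
    ∃ C : ℝ, 0 ≤ C ∧ ∀ x, |moll f 1 x| ≤ C := by
  obtain ⟨M, hM, hgr⟩ := hf.exists_growth
  obtain ⟨C, hC, hb⟩ := exists_bound_chi
  refine ⟨C * M, by positivity, fun x => ?_⟩
  have := enorm_integral_mul_le_of_growth (by positivity) (hgr x 1 one_pos) (hb 1 one_pos)
    fun y hy => chi_eq_zero one_pos hy.le
  rw [← ofReal_norm, ENNReal.ofReal_le_ofReal_iff (by positivity), Real.norm_eq_abs] at this
  rw [moll]
  simpa only [inv_one, one_pow, mul_one, Real.one_rpow] using this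

/-- A Morrey function with gradient in a Morrey space, `p > 3`, is bounded. -/
lemma exists_ae_bound {p : ℝ} (hp : 3 < p) {f : E3 → ℝ} (hf : MemMorrey p f)
    {g : Fin 3 → E3 → ℝ} (hg : ∀ i, MemMorrey p (g i))
    (hfg : ∀ i, ∂_{e i} (toDistr f) = toDistr (g i)) : ∃ C : ℝ, ∀ᵐ x, |f x| ≤ C := by
  obtain ⟨F, hfF, -, A, hA⟩ := exists_holder hp hf.locallyIntegrable hg hfg
  obtain ⟨C, hC, hb⟩ := exists_bound_moll hf
  refine ⟨C + A, hfF.mono fun x hx => ?_⟩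
  have h1 := abs_le.1 (hb x)
  have h2 := abs_le.1 (hA x)
  rw [hx, abs_le]
  constructor <;> linarith [h1.1, h1.2, h2.1, h2.2]

/-! ### Bootstrap for functions dominated by the square of their potential. -/

lemma measurable_ofReal_norm_sub_rpow (x : E3) (a : ℝ) :
    Measurable fun y : E3 => ENNReal.ofReal (‖y - x‖ ^ a) :=
  ((measurable_id.sub_const x).norm.pow_const a).ennreal_ofReal

lemma measurable_ofReal_norm_rpow_swap (a : ℝ) :
    Measurable fun q : E3 × E3 => ENNReal.ofReal (‖q.2 - q.1‖ ^ a) :=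
  (((measurable_snd.sub measurable_fst).norm).pow_const a).ennreal_ofReal

lemma growthAt_one (x : E3) {t : ℝ} (ht : 0 < t) :
    GrowthAt 3 unitVol (fun _ => 1) x t := by
  rw [GrowthAt, lintegral_one, Measure.restrict_apply_univ, volume_closedBall_eq_ofReal x ht.le]
  norm_cast

lemma lintegral_closedBall_norm_rpow_le {b : ℝ} (hb : 0 < b) (hb3 : b < 3) (x z : E3) {t : ℝ}
    (ht : 0 < t) (hz : z ∈ Metric.closedBall x (2 * t)) :
    ∫⁻ y in Metric.closedBall x t, ENNReal.ofReal (‖z - y‖ ^ (-b))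
      ≤ ENNReal.ofReal (potentialConst 3 b * unitVol * (3 * t) ^ (3 - b)) := by
  have hsub : Metric.closedBall x t ⊆ Metric.closedBall z (3 * t) := by
    apply Metric.closedBall_subset_closedBall'
    rw [Metric.mem_closedBall, dist_comm] at hz
    linarith
  refine (lintegral_mono_set hsub).trans ?_
  have := lintegral_potential_near (x := z) hb3 hb unitVol_pos.le (show 0 < 3 * t by positivity)
    (f := fun _ => 1) fun t ht _ => growthAt_one z ht
  simp only [one_mul] at this
  simpa only [norm_sub_rev] using this

lemma lintegral_closedBall_norm_rpow_le_far {b : ℝ} (hb : 0 < b) (x z : E3) {t : ℝ}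
    (ht : 0 < t) (hz : 2 * t ≤ ‖z - x‖) :
    ∫⁻ y in Metric.closedBall x t, ENNReal.ofReal (‖z - y‖ ^ (-b))
      ≤ ENNReal.ofReal (2 ^ b * unitVol * t ^ 3) * ENNReal.ofReal (‖z - x‖ ^ (-b)) := by
  have hV := unitVol_pos
  have hzx : 0 < ‖z - x‖ := by linarith
  calc _ ≤ ∫⁻ y in Metric.closedBall x t, ENNReal.ofReal (2 ^ b * ‖z - x‖ ^ (-b)) := by
        refine setLIntegral_mono' Metric.isClosed_closedBall.measurableSet fun y hy => ?_
        apply ENNReal.ofReal_le_ofReal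
        rw [Metric.mem_closedBall, dist_eq_norm] at hy
        have h1 : ‖z - x‖ / 2 ≤ ‖z - y‖ := by
          have := norm_sub_le_norm_sub_add_norm_sub z y x
          linarith
        calc _ ≤ (‖z - x‖ / 2) ^ (-b) :=
              Real.rpow_le_rpow_of_nonpos (by positivity) h1 (by linarith)
          _ = _ := by
              rw [Real.div_rpow hzx.le (by norm_num), Real.rpow_neg (by norm_num : (0:ℝ) ≤ 2),
                div_inv_eq_mul, mul_comm]
    _ = _ := by
        rw [lintegral_const, Measure.restrict_apply_univ, volume_closedBall_eq_ofReal x ht.le,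
          ← ENNReal.ofReal_mul (by positivity), ← ENNReal.ofReal_mul (by positivity)]
        congr 1; ring

/-- By Tonelli, the kernel is first averaged over the ball. The average is `O(t^(3 - b))` for `z`
within `2t` of `x` and `O(t³ ‖z - x‖^(-b))` beyond; integrating against `w`, both parts scale like
`t^(s + 3 - b)`. -/
lemma exists_lintegral_potential_le {s b M : ℝ} (hs : s < b) (hb : 0 < b) (hb3 : b < 3)
    (hM : 0 ≤ M) {w : E3 → ℝ≥0∞} (hw : AEMeasurable w)
    (hg : ∀ x t, 0 < t → GrowthAt s M w x t) :
    ∃ C : ℝ, 0 ≤ C ∧ ∀ x t, 0 < t → ∫⁻ y in Metric.closedBall x t, ∫⁻ z,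
      w z * ENNReal.ofReal (‖z - y‖ ^ (-b)) ≤ ENNReal.ofReal (C * t ^ (s + 3 - b)) := by
  have hV := unitVol_pos
  have hc1 := potentialConst_pos (s := 3) (a := b) hb3.ne'
  have hc2 := potentialConst_pos (s := s) (a := b) hs.ne
  refine ⟨potentialConst 3 b * unitVol * 3 ^ (3 - b) * (M * 2 ^ s)
    + 2 ^ b * unitVol * (potentialConst s b * M * 2 ^ (s - b)), by positivity, fun x t ht => ?_⟩
  have hmeas : AEMeasurable (Function.uncurry fun (y z : E3) =>
      w z * ENNReal.ofReal (‖z - y‖ ^ (-b)))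
      ((volume.restrict (Metric.closedBall x t)).prod volume) :=
    (hw.comp_snd).mul (measurable_ofReal_norm_rpow_swap (-b)).aemeasurable
  rw [lintegral_lintegral_swap hmeas]
  have hin : ∀ z, ∫⁻ y in Metric.closedBall x t, w z * ENNReal.ofReal (‖z - y‖ ^ (-b))
      = w z * ∫⁻ y in Metric.closedBall x t, ENNReal.ofReal (‖z - y‖ ^ (-b)) := by
    intro z
    refine lintegral_const_mul _ ?_
    simpa only [norm_sub_rev] using measurable_ofReal_norm_sub_rpow z (-b)
  simp only [hin]
  rw [← lintegral_add_compl _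
    (Metric.isClosed_closedBall (x := x) (ε := 2 * t)).measurableSet]
  have near : ∫⁻ z in Metric.closedBall x (2 * t),
      w z * ∫⁻ y in Metric.closedBall x t, ENNReal.ofReal (‖z - y‖ ^ (-b))
      ≤ ENNReal.ofReal (potentialConst 3 b * unitVol * 3 ^ (3 - b) * (M * 2 ^ s)
        * t ^ (s + 3 - b)) := by
    calc _ ≤ ∫⁻ z in Metric.closedBall x (2 * t),
          w z * ENNReal.ofReal (potentialConst 3 b * unitVol * (3 * t) ^ (3 - b)) :=
          setLIntegral_mono' Metric.isClosed_closedBall.measurableSet fun z hz =>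
            mul_le_mul_right (lintegral_closedBall_norm_rpow_le hb hb3 x z ht hz) _
      _ = (∫⁻ z in Metric.closedBall x (2 * t), w z) * _ :=
          lintegral_mul_const' _ _ ENNReal.ofReal_ne_top
      _ ≤ ENNReal.ofReal (M * (2 * t) ^ s) *
          ENNReal.ofReal (potentialConst 3 b * unitVol * (3 * t) ^ (3 - b)) := by
          gcongr
          exact hg x (2 * t) (by positivity)
      _ = _ := by
          rw [← ENNReal.ofReal_mul (by positivity), Real.mul_rpow (by norm_num) ht.le,
            Real.mul_rpow (by norm_num) ht.le, add_sub_assoc s, Real.rpow_add ht]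
          congr 1; ring
  have far : ∫⁻ z in (Metric.closedBall x (2 * t))ᶜ,
      w z * ∫⁻ y in Metric.closedBall x t, ENNReal.ofReal (‖z - y‖ ^ (-b))
      ≤ ENNReal.ofReal (2 ^ b * unitVol * (potentialConst s b * M * 2 ^ (s - b))
        * t ^ (s + 3 - b)) := by
    have hms : MeasurableSet {z : E3 | 2 * t ≤ ‖z - x‖} :=
      measurableSet_le measurable_const (by fun_prop)
    calc _ ≤ ∫⁻ z in {z | 2 * t ≤ ‖z - x‖},
          w z * ∫⁻ y in Metric.closedBall x t, ENNReal.ofReal (‖z - y‖ ^ (-b)) := by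
          refine lintegral_mono_set fun z hz => ?_
          rw [mem_compl_iff, Metric.mem_closedBall, dist_eq_norm, not_le] at hz
          exact hz.le
      _ ≤ ∫⁻ z in {z | 2 * t ≤ ‖z - x‖}, ENNReal.ofReal (2 ^ b * unitVol * t ^ 3) *
          (w z * ENNReal.ofReal (‖z - x‖ ^ (-b))) := by
          refine setLIntegral_mono' hms fun z hz => ?_
          refine (mul_le_mul_right
            (lintegral_closedBall_norm_rpow_le_far hb x z ht hz) _).trans (le_of_eq ?_)
          ring
      _ = ENNReal.ofReal (2 ^ b * unitVol * t ^ 3) * ∫⁻ z in {z | 2 * t ≤ ‖z - x‖},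
          w z * ENNReal.ofReal (‖z - x‖ ^ (-b)) :=
          lintegral_const_mul' _ _ ENNReal.ofReal_ne_top
      _ ≤ ENNReal.ofReal (2 ^ b * unitVol * t ^ 3) *
          ENNReal.ofReal (potentialConst s b * M * (2 * t) ^ (s - b)) := by
          gcongr
          exact lintegral_potential_far hs hb hM (by positivity)
            fun r hr => hg x r (lt_of_lt_of_le (by positivity) hr)
      _ = _ := by
          rw [← ENNReal.ofReal_mul (by positivity), Real.mul_rpow (by norm_num) ht.le,
            show s + 3 - b = (3 : ℕ) + (s - b) by push_cast; ring, Real.rpow_add ht,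
            Real.rpow_natCast]
          congr 1; ring
  refine (add_le_add near far).trans (le_of_eq ?_)
  rw [← ENNReal.ofReal_add (by positivity) (by positivity)]
  congr 1; ring

/-- The Riesz potential of order one, truncated at distance one. -/
def localPotential (w : E3 → ℝ≥0∞) (x : E3) : ℝ≥0∞ :=
  ∫⁻ y in Metric.closedBall x 1, w y * ENNReal.ofReal (‖y - x‖ ^ (-2 : ℝ))

/-- Cauchy–Schwarz for the measure `w dy`, splitting the exponent `2` as `a/2 + b/2`. With `a` small
enough for the first factor to be bounded, the square of the potential is dominated by an expression
linear in `w`. -/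
lemma sq_localPotential_le {w : E3 → ℝ≥0∞} (hw : AEMeasurable w) {a b : ℝ}
    (hab : a + b = 4) (x : E3) :
    localPotential w x ^ 2 ≤
      (∫⁻ y in Metric.closedBall x 1, w y * ENNReal.ofReal (‖y - x‖ ^ (-a))) *
        ∫⁻ y, w y * ENNReal.ofReal (‖y - x‖ ^ (-b)) := by
  have hm : ∀ c : ℝ, Measurable fun y : E3 => ENNReal.ofReal (‖y - x‖ ^ c) := fun c =>
    measurable_ofReal_norm_sub_rpow x c
  set μ := (volume.restrict (Metric.closedBall x 1)).withDensity w
  have hd : ∀ f : E3 → ℝ≥0∞, Measurable f →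
      ∫⁻ y, f y ∂μ = ∫⁻ y in Metric.closedBall x 1, w y * f y := fun f hf =>
    lintegral_withDensity_eq_lintegral_mul₀ hw.restrict hf.aemeasurable
  have hsq : ∀ c : ℝ, ∀ y : E3,
      ENNReal.ofReal (‖y - x‖ ^ (-(c / 2))) ^ 2 = ENNReal.ofReal (‖y - x‖ ^ (-c)) := by
    intro c y
    rw [← ENNReal.ofReal_pow (by positivity), ← Real.rpow_natCast, ← Real.rpow_mul (norm_nonneg _)]
    congr 2; push_cast; ring
  have h := lintegral_mul_sq_le (μ := μ) (hm (-(a / 2))).aemeasurable (hm (-(b / 2))).aemeasurable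
  simp only [hsq] at h
  rw [hd (fun y => _ * _) ((hm (-(a / 2))).mul (hm (-(b / 2)))), hd _ (hm _), hd _ (hm _)] at h
  refine le_trans (le_of_eq ?_) (h.trans (mul_le_mul_right (setLIntegral_le_lintegral _ _) _))
  rw [localPotential]
  congr 1
  have hae : ∀ᵐ y : E3, y ≠ x := by simp [ae_iff, measure_singleton]
  refine setLIntegral_congr_fun_ae Metric.isClosed_closedBall.measurableSet
    (hae.mono fun y hy _ => ?_)
  have hy0 : 0 < ‖y - x‖ := norm_pos_iff.2 (sub_ne_zero.2 hy)
  rw [← ENNReal.ofReal_mul (by positivity), ← Real.rpow_add hy0]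
  congr 3; linarith

/-- One step of the bootstrap: the growth exponent of `w` improves. -/
lemma exists_growth_improved {w : E3 → ℝ≥0∞} (hw : AEMeasurable w) {K : ℝ} (hK : 0 ≤ K)
    (hwK : ∀ᵐ x, w x ≤ ENNReal.ofReal K + ENNReal.ofReal K * localPotential w x ^ 2)
    {δ₀ M₀ : ℝ} (hM₀ : 0 ≤ M₀) (hg₀ : ∀ x t, 0 < t → GrowthAt (1 + δ₀) M₀ w x t)
    {δ M : ℝ} (hδ : 0 < δ) (hδ1 : δ ≤ 1) (hδ₀ : δ₀ ≤ δ) (hM : 0 ≤ M)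
    (hg : ∀ x t, 0 < t → GrowthAt (1 + δ) M w x t) :
    ∃ M' : ℝ, 0 ≤ M' ∧ ∀ x t, 0 < t → GrowthAt (1 + 3 / 2 * δ) M' w x t := by
  have hV := unitVol_pos
  obtain ⟨C, hC, hC'⟩ := exists_lintegral_potential_le (s := 1 + δ) (b := 3 - δ / 2)
    (by linarith) (by linarith) (by linarith) hM hw hg
  set A := potentialConst (1 + δ) (1 + δ / 2) * M with hA
  have hpc := potentialConst_pos (s := 1 + δ) (a := 1 + δ / 2) (by linarith)
  have hA0 : 0 ≤ A := by positivity
  have hM1 : 0 ≤ K * unitVol + K * (A * C) := by positivity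
  refine ⟨max M₀ (K * unitVol + K * (A * C)), hM₀.trans (le_max_left _ _), fun x t ht => ?_⟩
  rw [GrowthAt]
  rcases le_total 1 t with h1 | h1
  -- For large radii the initial exponent suffices, being smaller than the new one. Only small radii
  -- need an improvement.
  · refine (hg₀ x t ht).trans (ENNReal.ofReal_le_ofReal ?_)
    exact mul_le_mul (le_max_left _ _) (Real.rpow_le_rpow_of_exponent_le h1 (by linarith))
      (by positivity) (hM₀.trans (le_max_left _ _))
  · have hb : ∀ y, localPotential w y ^ 2 ≤
        ENNReal.ofReal A * ∫⁻ z, w z * ENNReal.ofReal (‖z - y‖ ^ (-(3 - δ / 2))) := by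
      intro y
      -- The exponent `1 + δ/2` is below the growth exponent `1 + δ`, so the first factor is
      -- bounded. The other exponent, `3 - δ/2`, exceeds `1 + δ` because `δ ≤ 1`, and averaging over
      -- a ball gives `1 + δ + 3 - (3 - δ/2) = 1 + 3δ/2`.
      refine (sq_localPotential_le hw (a := 1 + δ / 2) (b := 3 - δ / 2) (by ring) y).trans ?_
      gcongr
      have := lintegral_potential_near (s := 1 + δ) (a := 1 + δ / 2) (x := y) (R := 1)
        (by linarith) (by linarith) hM one_pos (f := w) fun t ht _ => hg y t ht
      rwa [Real.one_rpow, mul_one] at this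
    calc ∫⁻ y in Metric.closedBall x t, w y
        ≤ ∫⁻ y in Metric.closedBall x t, (ENNReal.ofReal K + ENNReal.ofReal K *
          (ENNReal.ofReal A * ∫⁻ z, w z * ENNReal.ofReal (‖z - y‖ ^ (-(3 - δ / 2))))) := by
          refine lintegral_mono_ae (ae_restrict_of_ae (hwK.mono fun y hy => hy.trans ?_))
          gcongr
          exact hb y
      _ = ENNReal.ofReal K * volume (Metric.closedBall x t) + ENNReal.ofReal K *
          (ENNReal.ofReal A * ∫⁻ y in Metric.closedBall x t,
            ∫⁻ z, w z * ENNReal.ofReal (‖z - y‖ ^ (-(3 - δ / 2)))) := by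
          rw [lintegral_add_left measurable_const, lintegral_const, Measure.restrict_apply_univ,
            lintegral_const_mul' _ _ ENNReal.ofReal_ne_top,
            lintegral_const_mul' _ _ ENNReal.ofReal_ne_top]
      _ ≤ ENNReal.ofReal K * ENNReal.ofReal (unitVol * t ^ 3) + ENNReal.ofReal K *
          (ENNReal.ofReal A * ENNReal.ofReal (C * t ^ (1 + δ + 3 - (3 - δ / 2)))) := by
          gcongr
          · exact (volume_closedBall_eq_ofReal x ht.le).le
          · exact hC' x t ht
      _ = ENNReal.ofReal (K * unitVol * t ^ (3 : ℝ) + K * (A * C) * t ^ (1 + 3 / 2 * δ)) := by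
          rw [← ENNReal.ofReal_mul hA0, ← ENNReal.ofReal_mul hK, ← ENNReal.ofReal_mul hK,
            ← ENNReal.ofReal_add (by positivity) (by positivity)]
          congr 1
          rw [show 1 + δ + 3 - (3 - δ / 2) = 1 + 3 / 2 * δ by ring,
            show (3 : ℝ) = (3 : ℕ) by norm_num, Real.rpow_natCast]
          ring
      _ ≤ _ := by
          apply ENNReal.ofReal_le_ofReal
          calc _ ≤ K * unitVol * t ^ (1 + 3 / 2 * δ) + K * (A * C) * t ^ (1 + 3 / 2 * δ) := by
                gcongr ?_ * ?_ + _
                exact Real.rpow_le_rpow_of_exponent_ge ht h1 (by linarith)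
            _ = (K * unitVol + K * (A * C)) * t ^ (1 + 3 / 2 * δ) := by ring
            _ ≤ _ := by
                gcongr
                exact le_max_right _ _

/-- Boundedness of functions controlled by the square of their own potential. -/
lemma exists_bound_of_localPotential {w : E3 → ℝ≥0∞} (hw : AEMeasurable w) {K : ℝ} (hK : 0 ≤ K)
    (hwK : ∀ᵐ x, w x ≤ ENNReal.ofReal K + ENNReal.ofReal K * localPotential w x ^ 2)
    {δ₀ M₀ : ℝ} (hδ₀ : 0 < δ₀) (hM₀ : 0 ≤ M₀)
    (hg₀ : ∀ x t, 0 < t → GrowthAt (1 + δ₀) M₀ w x t) :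
    ∃ C : ℝ, 0 ≤ C ∧ ∀ᵐ x, w x ≤ ENNReal.ofReal C := by
  -- The improvement step needs `δ ≤ 1`. The alternative `1 < δ` records that the iteration has
  -- reached its goal and may stop.
  have hit : ∀ n : ℕ, ∃ δ M : ℝ, δ₀ ≤ δ ∧ (1 < δ ∨ (3 / 2) ^ n * δ₀ ≤ δ) ∧ 0 ≤ M ∧
      ∀ x t, 0 < t → GrowthAt (1 + δ) M w x t := by
    intro n
    induction n with
    | zero => exact ⟨δ₀, M₀, le_rfl, Or.inr (by simp), hM₀, hg₀⟩
    | succ n ih =>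
      obtain ⟨δ, M, h1, h2, h3, h4⟩ := ih
      by_cases h : 1 < δ
      · exact ⟨δ, M, h1, Or.inl h, h3, h4⟩
      · obtain ⟨M', hM', hg'⟩ := exists_growth_improved hw hK hwK hM₀ hg₀
          (hδ₀.trans_le h1) (not_lt.1 h) h1 h3 h4
        refine ⟨3 / 2 * δ, M', by linarith, Or.inr ?_, hM', hg'⟩
        rw [pow_succ]
        linarith [h2.resolve_left h]
  obtain ⟨n, hn⟩ := pow_unbounded_of_one_lt (1 / δ₀) (show (1 : ℝ) < 3 / 2 by norm_num)
  rw [div_lt_iff₀ hδ₀] at hn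
  obtain ⟨δ, M, -, h2, hM, hg⟩ := hit n
  have hδ : 1 < δ := h2.elim id fun h => hn.trans_le h
  have hpc := potentialConst_pos (s := 1 + δ) (a := 2) (by linarith)
  refine ⟨K + K * (potentialConst (1 + δ) 2 * M) ^ 2, by positivity, hwK.mono fun x hx => ?_⟩
  -- Now the growth exponent `1 + δ` exceeds `2`, so the potential with kernel `‖y - x‖⁻²` is
  -- bounded.
  have := lintegral_potential_near (s := 1 + δ) (a := 2) (x := x) (R := 1)
    (by linarith) (by norm_num) hM one_pos (f := w) fun t ht _ => hg x t ht
  rw [Real.one_rpow, mul_one] at this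
  refine hx.trans ?_
  rw [ENNReal.ofReal_add (by positivity) (by positivity), ENNReal.ofReal_mul hK,
    ENNReal.ofReal_pow (by positivity)]
  gcongr
  exact this

/-! ### Potential bounds for the equation and boundedness of its solutions. -/

lemma ae_tendsto_moll {u : E3 → ℝ} (hu : LocallyIntegrable u) :
    ∀ᵐ x, Filter.Tendsto (fun n : ℕ => moll u ((n : ℝ) + 1)⁻¹ x) Filter.atTop (nhds (u x)) := by
  obtain ⟨C, hC, hb⟩ := exists_bound_chi
  have hV := unitVol_pos
  let ε : ℕ → ℝ := fun n => ((n : ℝ) + 1)⁻¹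
  have hε : ∀ n, 0 < ε n := fun n => by positivity
  have hεlim : Filter.Tendsto ε Filter.atTop (nhdsWithin 0 (Ioi 0)) :=
    tendsto_nhdsWithin_iff.2 ⟨(Filter.tendsto_atTop_add_const_right _ _
      tendsto_natCast_atTop_atTop).inv_tendsto_atTop, Filter.Eventually.of_forall hε⟩
  filter_upwards [IsUnifLocDoublingMeasure.ae_tendsto_average_norm_sub volume hu 1] with x hx
  have hlim := (hx (fun _ => x) ε hεlim (Filter.Eventually.of_forall fun n => by
    simpa using (hε n).le)).const_mul (C * unitVol)
  rw [mul_zero] at hlim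
  rw [tendsto_iff_norm_sub_tendsto_zero]
  refine squeeze_zero (fun n => norm_nonneg _) (fun n => ?_) hlim
  have hI : IntegrableOn (fun y => ‖u y - u x‖) (Metric.closedBall x (ε n)) :=
    ((hu.sub (locallyIntegrable_const (u x))).integrableOn_isCompact
      (isCompact_closedBall x (ε n))).norm
  -- As `chi` has integral one and size `ε⁻³` on the ball of radius `ε`, the error is at most a
  -- constant times the average of `|u - u x|`, which tends to zero at Lebesgue points.
  have h1 : moll u (ε n) x - u x = ∫ y, (u y - u x) * chi (ε n) (y - x) := by
    have h2 : ∫ y, chi (ε n) (y - x) = 1 := by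
      rw [integral_sub_right_eq_self (chi (ε n) : E3 → ℝ), integral_chi (hε n)]
    have hi1 : Integrable fun y => u y * chi (ε n) (y - x) := by
      refine (TF.integrable_mul hu (reflect (chi (ε n)) x)).congr
        (Filter.Eventually.of_forall fun y => ?_)
      simp only [TF.reflect_apply]
      rw [← chi_neg, neg_sub, mul_comm]
    have hi2 : Integrable fun y => u x * chi (ε n) (y - x) :=
      ((TF.integrable (chi (ε n))).comp_sub_right x).const_mul _
    simp only [sub_mul]
    rw [integral_sub hi1 hi2, integral_const_mul, h2, mul_one, moll]
  rw [h1]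
  calc _ ≤ ∫ y, (Metric.closedBall x (ε n)).indicator
        (fun y => C * (ε n)⁻¹ ^ 3 * ‖u y - u x‖) y := by
        refine norm_integral_le_of_norm_le ((integrable_indicator_iff
          Metric.isClosed_closedBall.measurableSet).2 (hI.const_mul _))
          (Filter.Eventually.of_forall fun y => ?_)
        by_cases hy : y ∈ Metric.closedBall x (ε n)
        · rw [indicator_of_mem hy, norm_mul, mul_comm]
          exact mul_le_mul_of_nonneg_right (hb _ (hε n) _) (norm_nonneg _)
        · rw [indicator_of_notMem hy]
          rw [Metric.mem_closedBall, dist_eq_norm, not_le] at hy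
          rw [chi_eq_zero (hε n) hy.le]; simp
    _ = C * (ε n)⁻¹ ^ 3 * ∫ y in Metric.closedBall x (ε n), ‖u y - u x‖ := by
        rw [integral_indicator Metric.isClosed_closedBall.measurableSet, integral_const_mul]
    _ = _ := by
        rw [setAverage_eq, Measure.real, volume_closedBall_eq_ofReal x (hε n).le,
          ENNReal.toReal_ofReal (by have := hε n; positivity), smul_eq_mul]
        have := (hε n).ne'
        field_simp

/-- Pointwise bound of solutions of `Δ² u = ∑ ∂_a ∂_b ∂_c h_{abc}` by potentials. -/
lemma exists_ae_le_potential : ∃ C : ℝ, 0 < C ∧ ∀ (u : E3 → ℝ)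
    (h : Fin 3 → Fin 3 → Fin 3 → E3 → ℝ) (H : E3 → ℝ≥0∞), LocallyIntegrable u →
    (∀ a b c, LocallyIntegrable (h a b c)) → (∀ a b c, ∀ᵐ y, ‖h a b c y‖ₑ ≤ H y) →
    Distr.bilap (toDistr u) = (div3 fun a b c => toDistr (h a b c)) →
    ∀ᵐ x, ‖u x‖ₑ ≤ ‖moll u 1 x‖ₑ + ENNReal.ofReal C * localPotential H x := by
  obtain ⟨C, hC, hb⟩ := exists_enorm_integral_D_three_le
  -- `27` counts the triples `(a, b, c)`.
  refine ⟨27 * C, by positivity, fun u h H hu hh hH heq => ?_⟩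
  have hstep : ∀ ε : ℝ, 0 < ε → ε ≤ 1 → ∀ x,
      ‖moll u ε x‖ₑ ≤ ‖moll u 1 x‖ₑ + ENNReal.ofReal (27 * C) * localPotential H x := by
    intro ε hε hε1 x
    -- The difference of regularizations at scales `ε` and `1` is `Δ² u` tested against the
    -- parametrix; the equation moves three derivatives onto the kernel.
    have h1 : moll u ε x = moll u 1 x + (-∑ a, ∑ b, ∑ c,
        ∫ y, D c (D b (D a (reflect (kern ε 1) x))) y * h a b c y) := by
      rw [← sub_eq_iff_eq_add', moll_eq_apply hu, moll_eq_apply hu, ← map_sub, ← reflect_sub,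
        ← bilap_kern hε hε1, ← bilap_reflect, ← Distr.bilap_apply, heq]
      simp only [div3, Distr.sum_apply, Distr.deriv_apply, neg_neg, Finset.sum_neg_distrib]
      simp only [toDistr_apply (hh _ _ _)]
    rw [h1]
    refine (enorm_add_le _ _).trans ?_
    gcongr
    rw [enorm_neg]
    have hterm : ∀ a b c, ‖∫ y, D c (D b (D a (reflect (kern ε 1) x))) y * h a b c y‖ₑ
        ≤ ENNReal.ofReal C * localPotential H x := by
      intro a b c
      refine (hb ε 1 hε hε1 c b a x (h a b c)).trans ?_
      gcongr
      refine lintegral_mono_ae (ae_restrict_of_ae ((hH a b c).mono fun y hy => ?_))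
      gcongr
    calc _ ≤ ∑ _a : Fin 3, ∑ _b : Fin 3, ∑ _c : Fin 3, ENNReal.ofReal C * localPotential H x := by
          refine (enorm_sum_le _ _).trans (Finset.sum_le_sum fun a _ => ?_)
          refine (enorm_sum_le _ _).trans (Finset.sum_le_sum fun b _ => ?_)
          exact (enorm_sum_le _ _).trans (Finset.sum_le_sum fun c _ => hterm a b c)
      _ = _ := by
          simp only [Finset.sum_const, Finset.card_univ, Fintype.card_fin, nsmul_eq_mul]
          rw [ENNReal.ofReal_mul (by norm_num), ← mul_assoc, ← mul_assoc, ← mul_assoc]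
          norm_num
  filter_upwards [ae_tendsto_moll hu] with x hx
  refine le_of_tendsto hx.enorm (Filter.Eventually.of_forall fun n => ?_)
  exact hstep _ (by positivity) (inv_le_one_of_one_le₀ (by linarith [n.cast_nonneg (α := ℝ)])) x

lemma localPotential_add {f g : E3 → ℝ≥0∞} (hf : AEMeasurable f) (x : E3) :
    localPotential (fun y => f y + g y) x = localPotential f x + localPotential g x := by
  simp only [localPotential, add_mul]
  exact lintegral_add_left' (hf.restrict.mul
    (measurable_ofReal_norm_sub_rpow x (-2)).aemeasurable) _

lemma localPotential_const_mul {c : ℝ≥0∞} (hc : c ≠ ∞) (f : E3 → ℝ≥0∞) (x : E3) :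
    localPotential (fun y => c * f y) x = c * localPotential f x := by
  simp only [localPotential, mul_assoc]
  exact lintegral_const_mul' _ _ hc

lemma ennreal_add_sq_le (a b : ℝ≥0∞) : (a + b) ^ 2 ≤ 2 * (a ^ 2 + b ^ 2) := by
  have h := ENNReal.rpow_add_le_mul_rpow_add_rpow a b (p := 2) one_le_two
  rw [show (2 : ℝ) - 1 = 1 by norm_num, ENNReal.rpow_one] at h
  exact_mod_cast h

/-- Boundedness of Morrey solutions of `Δ² U_n = ∑ ∂_a ∂_b ∂_c h_{n,abc}` with quadratic growth
of `h` in `U`. -/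
lemma exists_ae_bound_of_quadratic {p : ℝ} (hp : 3 < p) {ι : Type*} [Fintype ι]
    {U : ι → E3 → ℝ} (hU : ∀ n, MemMorrey p (U n)) {h : ι → Fin 3 → Fin 3 → Fin 3 → E3 → ℝ}
    (hh : ∀ n a b c, LocallyIntegrable (h n a b c)) {f : E3 → ℝ} (hf : MemMorrey p f) {C : ℝ}
    (hC : 0 ≤ C) (hbd : ∀ n a b c, ∀ᵐ x, |h n a b c x| ≤ |f x| + C * ∑ l, U l x ^ 2)
    (heq : ∀ n, Distr.bilap (toDistr (U n)) = div3 fun a b c => toDistr (h n a b c)) (n : ι) :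
    ∃ B : ℝ, ∀ᵐ x, |U n x| ≤ B := by
  have hp0 : 0 < p := by linarith
  have hγ : 3 / p < 1 := (div_lt_one hp0).2 hp
  set w : E3 → ℝ≥0∞ := fun x => ∑ l, ‖U l x‖ₑ ^ 2 with hwdef
  have hw : AEMeasurable w :=
    Finset.aemeasurable_fun_sum _ fun l _ => ((memMorrey_iff.1 (hU l)).1.enorm).pow_const 2
  have hfm : AEMeasurable fun x => ‖f x‖ₑ := (memMorrey_iff.1 hf).1.enorm
  -- growth of `w`
  choose M hM hgr using fun l => (memMorrey_iff.1 (hU l)).2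
  -- The Morrey exponent `3 - 2 * (3 / p)` written as `1 + δ₀`; the bootstrap starts because `p > 3`
  -- makes `δ₀` positive.
  have hg : ∀ x t, 0 < t → GrowthAt (1 + (2 - 2 * (3 / p))) (∑ l, M l) w x t := by
    intro x t ht
    rw [GrowthAt, lintegral_finsetSum' _ fun l _ =>
      ((memMorrey_iff.1 (hU l)).1.enorm.pow_const 2).restrict, Finset.sum_mul,
      ENNReal.ofReal_sum_of_nonneg fun l _ => by have := hM l; positivity]
    refine Finset.sum_le_sum fun l _ => ?_
    have := hgr l x t ht
    rw [GrowthAt] at this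
    rwa [show 1 + (2 - 2 * (3 / p)) = 3 - 2 * (3 / p) by ring]
  -- potential of `f`
  obtain ⟨Mf, hMf, hgf⟩ := hf.exists_growth
  set Pf := potentialConst (3 - 3 / p) 2 * Mf
  have hpc := potentialConst_pos (s := 3 - 3 / p) (a := 2) (by linarith)
  have hPf0 : 0 ≤ Pf := by positivity
  have hPf : ∀ x, localPotential (fun y => ‖f y‖ₑ) x ≤ ENNReal.ofReal Pf := by
    intro x
    have := lintegral_potential_near (s := 3 - 3 / p) (a := 2) (x := x) (R := 1)
      (by linarith) (by norm_num) hMf one_pos (f := fun y => ‖f y‖ₑ) fun t ht _ => hgf x t ht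
    rwa [Real.one_rpow, mul_one] at this
  obtain ⟨C₁, hC₁, hpot⟩ := exists_ae_le_potential
  choose A hA hmoll using fun l => exists_bound_moll (hU l)
  have hsq : ∀ x, ENNReal.ofReal (∑ l, U l x ^ 2) = w x := by
    intro x
    rw [ENNReal.ofReal_sum_of_nonneg fun l _ => sq_nonneg _]
    refine Finset.sum_congr rfl fun l _ => ?_
    rw [← ofReal_norm, ← ENNReal.ofReal_pow (norm_nonneg _), Real.norm_eq_abs, sq_abs]
  have hU1 : ∀ l, ∀ᵐ x, ‖U l x‖ₑ ≤
      ENNReal.ofReal (A l + C₁ * Pf) + ENNReal.ofReal (C₁ * C) * localPotential w x := by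
    intro l
    filter_upwards [hpot (U l) (h l) (fun y => ‖f y‖ₑ + ENNReal.ofReal C * w y)
      (hU l).locallyIntegrable (hh l) (fun a b c => (hbd l a b c).mono fun x hx => by
        rw [← hsq, ← ENNReal.ofReal_mul hC, ← ofReal_norm, ← ofReal_norm,
          ← ENNReal.ofReal_add (norm_nonneg _)
            (mul_nonneg hC (Finset.sum_nonneg fun l _ => sq_nonneg _))]
        exact ENNReal.ofReal_le_ofReal hx) (heq l)] with x hx
    refine hx.trans ?_
    rw [localPotential_add hfm, localPotential_const_mul ENNReal.ofReal_ne_top, mul_add,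
      ENNReal.ofReal_add (hA l) (by positivity), ENNReal.ofReal_mul hC₁.le,
      ENNReal.ofReal_mul hC₁.le, ← add_assoc, ← mul_assoc]
    gcongr
    · rw [← ofReal_norm]; exact ENNReal.ofReal_le_ofReal (hmoll l x)
    · exact hPf x
  -- Squaring the bound for each component and summing shows that `w` is dominated by the square of
  -- its own potential.
  set K := max (∑ l, 2 * (A l + C₁ * Pf) ^ 2) (∑ _l : ι, 2 * (C₁ * C) ^ 2) with hK
  have hK0 : 0 ≤ K := le_max_of_le_left (Finset.sum_nonneg fun l _ => by positivity)
  have hwK : ∀ᵐ x, w x ≤ ENNReal.ofReal K + ENNReal.ofReal K * localPotential w x ^ 2 := by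
    filter_upwards [ae_all_iff.2 hU1] with x hx
    calc w x ≤ ∑ l, (ENNReal.ofReal (2 * (A l + C₁ * Pf) ^ 2)
          + ENNReal.ofReal (2 * (C₁ * C) ^ 2) * localPotential w x ^ 2) := by
          refine Finset.sum_le_sum fun l _ => ?_
          have hAl := hA l
          refine (pow_le_pow_left' (hx l) 2).trans ?_
          refine (ennreal_add_sq_le _ _).trans (le_of_eq ?_)
          rw [mul_pow, ← ENNReal.ofReal_pow (by positivity), ← ENNReal.ofReal_pow (by positivity),
            ENNReal.ofReal_mul (by norm_num), ENNReal.ofReal_mul (by norm_num),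
            ENNReal.ofReal_ofNat]
          ring
      _ = ENNReal.ofReal (∑ l, 2 * (A l + C₁ * Pf) ^ 2)
          + ENNReal.ofReal (∑ _l : ι, 2 * (C₁ * C) ^ 2) * localPotential w x ^ 2 := by
          rw [Finset.sum_add_distrib, ← Finset.sum_mul,
            ENNReal.ofReal_sum_of_nonneg fun l _ => by positivity,
            ENNReal.ofReal_sum_of_nonneg fun l _ => by positivity]
      _ ≤ _ := by
          gcongr
          · exact le_max_left _ _
          · exact le_max_right _ _
  obtain ⟨B, hB, hwB⟩ := exists_bound_of_localPotential hw hK0 hwK (by linarith)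
    (Finset.sum_nonneg fun l _ => hM l) hg
  refine ⟨Real.sqrt B, hwB.mono fun x hx => Real.le_sqrt_of_sq_le ?_⟩
  rw [← hsq, ENNReal.ofReal_le_ofReal_iff hB] at hx
  rw [sq_abs]
  exact (Finset.single_le_sum (f := fun l => U l x ^ 2) (fun l _ => sq_nonneg _)
    (Finset.mem_univ n)).trans hx

/-! ### Bounded functions and the Leibniz rule. -/

/-- Essentially bounded functions. -/
def Bdd (f : E3 → ℝ) : Prop := AEStronglyMeasurable f volume ∧ ∃ C : ℝ, ∀ᵐ x, |f x| ≤ C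

lemma Bdd.exists_bound {f : E3 → ℝ} (hf : Bdd f) : ∃ C : ℝ, 0 ≤ C ∧ ∀ᵐ x, |f x| ≤ C := by
  obtain ⟨-, C, hC⟩ := hf
  exact ⟨max C 0, le_max_right _ _, hC.mono fun x hx => hx.trans (le_max_left _ _)⟩

lemma _root_.MeasureTheory.LocallyIntegrable.mul_bdd {f g : E3 → ℝ} (hf : LocallyIntegrable f)
    (hg : Bdd g) : LocallyIntegrable fun x => f x * g x := by
  obtain ⟨C, -, hC⟩ := hg.exists_bound
  intro x
  obtain ⟨s, hs, hfs⟩ := hf x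
  refine ⟨s, hs, ?_⟩
  exact (Integrable.bdd_mul (c := C) hfs hg.1.restrict (ae_restrict_of_ae hC)).congr
    (Filter.Eventually.of_forall fun y => mul_comm _ _)

lemma Bdd.locallyIntegrable {f : E3 → ℝ} (hf : Bdd f) : LocallyIntegrable f := by
  simpa using (locallyIntegrable_const (1 : ℝ)).mul_bdd hf

lemma Bdd.mul {f g : E3 → ℝ} (hf : Bdd f) (hg : Bdd g) : Bdd fun x => f x * g x := by
  obtain ⟨C, hC0, hC⟩ := hf.exists_bound
  obtain ⟨K, hK0, hK⟩ := hg.exists_bound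
  refine ⟨hf.1.mul hg.1, C * K, ?_⟩
  filter_upwards [hC, hK] with x h1 h2
  rw [abs_mul]
  exact mul_le_mul h1 h2 (abs_nonneg _) hC0

/-- Fubini for the regularization of a locally integrable function. -/
lemma integral_mul_moll {f ψ : E3 → ℝ} (hf : LocallyIntegrable f) (hψ : Integrable ψ)
    {r : ℝ} (hr : ∀ x : E3, r < ‖x‖ → ψ x = 0) {ε : ℝ} (hε : 0 < ε) :
    ∫ x, ψ x * moll f ε x = ∫ y, f y * moll ψ ε y := by
  set K := Metric.closedBall (0 : E3) (r + ε) with hKdef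
  have hK : IsCompact K := isCompact_closedBall _ _
  have hsupp : ∀ x y, ψ x * chi ε (y - x) ≠ 0 → y ∈ K := by
    intro x y h
    have h1 : ‖x‖ ≤ r := not_lt.1 fun hx => left_ne_zero_of_mul h (hr x hx)
    have h2 : ‖y - x‖ ≤ ε := (not_le.1 fun hx => right_ne_zero_of_mul h (chi_eq_zero hε hx)).le
    rw [hKdef, mem_closedBall_zero_iff]
    have := norm_add_le x (y - x)
    rw [add_sub_cancel] at this
    linarith
  have hfK : Integrable (K.indicator f) :=
    (integrable_indicator_iff hK.measurableSet).2 (hf.integrableOn_isCompact hK)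
  have hprod : Integrable (fun z : E3 × E3 => ψ z.1 * chi ε (z.2 - z.1) * K.indicator f z.2)
      (volume.prod volume) := by
    obtain ⟨C, hC⟩ := (chi ε).continuous.bounded_above_of_compact_support (chi ε).hasCompactSupport
    have h1 : Integrable (fun z : E3 × E3 => ψ z.1 * K.indicator f z.2)
      (volume.prod volume) := hψ.mul_prod hfK
    refine (h1.bdd_mul (f := fun z : E3 × E3 => chi ε (z.2 - z.1)) (c := C)
      (by fun_prop) (Filter.Eventually.of_forall fun z => hC _)).congr
      (Filter.Eventually.of_forall fun z => by simp only; ring)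
  have hL : ∀ y, f y * moll ψ ε y = ∫ x, ψ x * chi ε (y - x) * K.indicator f y := by
    intro y
    rw [moll, ← integral_const_mul]
    congr 1; ext x
    rw [← chi_neg, neg_sub]
    by_cases h : ψ x * chi ε (y - x) = 0
    · rw [h, mul_zero, zero_mul]
    · rw [indicator_of_mem (hsupp x y h)]; ring
  have hR : ∀ x, ψ x * moll f ε x = ∫ y, ψ x * chi ε (y - x) * K.indicator f y := by
    intro x
    rw [moll, ← integral_const_mul]
    congr 1; ext y
    by_cases h : ψ x * chi ε (y - x) = 0
    · rw [h, zero_mul]; linear_combination f y * h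
    · rw [indicator_of_mem (hsupp x y h)]; ring
  simp only [hL, hR]
  exact integral_integral_swap hprod

lemma exists_bound_moll_of_bdd : ∃ K : ℝ, 0 < K ∧ ∀ (f : E3 → ℝ) (C : ℝ), 0 ≤ C →
    (∀ᵐ x, |f x| ≤ C) → ∀ ε : ℝ, 0 < ε → ∀ x, |moll f ε x| ≤ C * K := by
  obtain ⟨K, hK, hb⟩ := exists_integral_abs_chi_le
  refine ⟨K, hK, fun f C hC hf ε hε x => ?_⟩
  calc |moll f ε x| ≤ ∫ y, C * |chi ε (y - x)| := by
        rw [moll, ← Real.norm_eq_abs]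
        refine norm_integral_le_of_norm_le
          (((TF.integrable (chi ε)).comp_sub_right x).abs.const_mul _)
          (hf.mono fun y hy => ?_)
        rw [norm_mul]
        exact mul_le_mul_of_nonneg_right hy (abs_nonneg _)
    _ ≤ _ := by
        rw [integral_const_mul, integral_sub_right_eq_self (fun y => |chi ε y|)]
        exact mul_le_mul_of_nonneg_left (hb ε hε) hC

lemma tendsto_integral_mul_moll {h g : E3 → ℝ} (hh : Integrable h) (hg : Bdd g) :
    Filter.Tendsto (fun n : ℕ => ∫ x, h x * moll g ((n : ℝ) + 1)⁻¹ x) Filter.atTop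
      (nhds (∫ x, h x * g x)) := by
  obtain ⟨K, hK, hb⟩ := exists_bound_moll_of_bdd
  obtain ⟨C, hC, hgC⟩ := hg.exists_bound
  refine tendsto_integral_of_dominated_convergence (fun x => |h x| * (C * K)) (fun n => ?_)
    (hh.abs.mul_const _) (fun n => Filter.Eventually.of_forall fun x => ?_) ?_
  · exact hh.aestronglyMeasurable.mul
      (smooth_moll hg.locallyIntegrable _).continuous.aestronglyMeasurable
  · rw [norm_mul]
    exact mul_le_mul_of_nonneg_left (hb g C hC hgC _ (by positivity) x) (abs_nonneg _)
  · exact (ae_tendsto_moll hg.locallyIntegrable).mono fun x hx => hx.const_mul _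

/-- Regularizations of `g`, only locally integrable, have no evident dominating function. Since
`chi` is even, the regularization can be moved onto the bounded, compactly supported `ψ`, and
dominated convergence then applies. -/
lemma tendsto_integral_mul_moll_of_bdd {ψ g : E3 → ℝ} (hψ : Bdd ψ) {r : ℝ}
    (hr : ∀ x : E3, r < ‖x‖ → ψ x = 0) (hg : LocallyIntegrable g) :
    Filter.Tendsto (fun n : ℕ => ∫ x, ψ x * moll g ((n : ℝ) + 1)⁻¹ x) Filter.atTop
      (nhds (∫ x, ψ x * g x)) := by
  obtain ⟨K, hK, hb⟩ := exists_bound_moll_of_bdd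
  obtain ⟨C, hC, hψC⟩ := hψ.exists_bound
  have hψi : Integrable ψ := by
    refine (integrableOn_iff_integrable_of_support_subset (s := Metric.closedBall 0 r)
      fun x hx => ?_).1 (hψ.locallyIntegrable.integrableOn_isCompact (isCompact_closedBall _ _))
    rw [mem_closedBall_zero_iff]
    exact not_lt.1 fun h => hx (hr x h)
  have hε : ∀ n : ℕ, (0 : ℝ) < ((n : ℝ) + 1)⁻¹ := fun n => by positivity
  have heq : ∀ n : ℕ, ∫ x, ψ x * moll g ((n : ℝ) + 1)⁻¹ x
      = ∫ y, g y * moll ψ ((n : ℝ) + 1)⁻¹ y := fun n => integral_mul_moll hg hψi hr (hε n)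
  simp only [heq]
  simp only [mul_comm (ψ _)]
  set S := Metric.closedBall (0 : E3) (r + 1)
  refine tendsto_integral_of_dominated_convergence (fun x => S.indicator (fun x => |g x| * (C * K)) x)
    (fun n => ?_) ?_ (fun n => Filter.Eventually.of_forall fun x => ?_) ?_
  · exact hg.aestronglyMeasurable.mul
      (smooth_moll hψ.locallyIntegrable _).continuous.aestronglyMeasurable
  · rw [integrable_indicator_iff Metric.isClosed_closedBall.measurableSet]
    exact Integrable.mul_const (Integrable.abs
      (hg.integrableOn_isCompact (isCompact_closedBall _ _))) _
  · by_cases hx : x ∈ S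
    · rw [indicator_of_mem hx, norm_mul]
      exact mul_le_mul_of_nonneg_left (hb ψ C hC hψC _ (hε n) x) (abs_nonneg _)
    · rw [indicator_of_notMem hx]
      have h0 : moll ψ ((n : ℝ) + 1)⁻¹ x = 0 := by
        rw [moll]
        refine integral_eq_zero_of_ae (Filter.Eventually.of_forall fun y => ?_)
        by_cases hy : r < ‖y‖
        · simp [hr y hy]
        · rw [mem_closedBall_zero_iff, not_le] at hx
          have h1 : ((n : ℝ) + 1)⁻¹ ≤ 1 :=
            inv_le_one_of_one_le₀ (by linarith [n.cast_nonneg (α := ℝ)])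
          have h2 := norm_sub_norm_le x y
          rw [norm_sub_rev] at h2
          simp only [Pi.zero_apply]
          rw [chi_eq_zero (hε n) (by linarith [not_lt.1 hy]), mul_zero]
      simp [h0]
  · exact (ae_tendsto_moll hψ.locallyIntegrable).mono fun x hx => hx.const_mul _

/-- The product of a test function with a smooth function. -/
def smoothMul (a : E3 → ℝ) (ha : Smooth a) (φ : TF) : TF :=
  ⟨fun x => a x * φ x, ha.mul φ.contDiff, φ.hasCompactSupport.mul_left, by simp⟩

lemma D_smoothMul {a : E3 → ℝ} (ha : Smooth a) (φ : TF) (i : Fin 3) (x : E3) :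
    D i (smoothMul a ha φ) x = pd i a x * φ x + a x * D i φ x := by
  rw [coe_D, coe_D]
  have h1 : HasFDerivAt a (fderiv ℝ a x) x := (ha.differentiable (by simp) x).hasFDerivAt
  have h2 : HasFDerivAt φ (fderiv ℝ φ x) x := (φ.smooth.differentiable (by simp) x).hasFDerivAt
  change fderiv ℝ (a * ⇑φ) x (e i) = _
  rw [(h1.mul h2).fderiv]
  simp [pd]
  ring

/-- The Leibniz rule for bounded functions. -/
lemma deriv_toDistr_mul {f g f' g' : E3 → ℝ} (hf : Bdd f) (hg : Bdd g)
    (hf' : LocallyIntegrable f') (hg' : LocallyIntegrable g') {i : Fin 3}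
    (hff' : ∂_{e i} (toDistr f) = toDistr f') (hgg' : ∂_{e i} (toDistr g) = toDistr g') :
    ∂_{e i} (toDistr fun x => f x * g x) = toDistr fun x => f' x * g x + f x * g' x := by
  ext φ
  have hfl := hf.locallyIntegrable
  have h1 : LocallyIntegrable fun x => f' x * g x := hf'.mul_bdd hg
  have h2 : LocallyIntegrable fun x => f x * g' x := by
    simpa only [mul_comm] using hg'.mul_bdd hf
  rw [Distr.deriv_apply, toDistr_apply (hfl.mul_bdd hg),
    toDistr_apply (f := fun x => f' x * g x + f x * g' x) (h1.add h2)]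
  obtain ⟨r, -, hr⟩ := TF.exists_radius φ
  obtain ⟨Cφ, hCφ⟩ := φ.continuous.bounded_above_of_compact_support φ.hasCompactSupport
  have hφb : Bdd (φ : E3 → ℝ) :=
    ⟨φ.continuous.aestronglyMeasurable, Cφ, Filter.Eventually.of_forall hCφ⟩
  have t1 := tendsto_integral_mul_moll (TF.integrable_mul hf' φ) hg
  have t2 := tendsto_integral_mul_moll (TF.integrable_mul hfl (D i φ)) hg
  have t3 := tendsto_integral_mul_moll_of_bdd (hφb.mul hf) (r := r)
    (fun x hx => by rw [hr x hx, zero_mul]) hg'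
  -- With `g` regularized, its product with `φ` is a legitimate test function for `∂_i f = f'`, and
  -- the classical product rule applies. The three limits `t1`, `t2`, `t3` then remove the
  -- regularization.
  have key : ∀ n : ℕ, ∫ x, φ x * f' x * moll g ((n : ℝ) + 1)⁻¹ x
      = -(∫ x, D i φ x * f x * moll g ((n : ℝ) + 1)⁻¹ x)
        - ∫ x, φ x * f x * moll g' ((n : ℝ) + 1)⁻¹ x := by
    intro n
    set ε := ((n : ℝ) + 1)⁻¹
    have hs := smooth_moll hg.locallyIntegrable ε
    have hs' := smooth_moll hg' ε
    have h := congrArg (fun T : Distr => T (smoothMul _ hs φ)) hff'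
    simp only [Distr.deriv_apply, toDistr_apply hfl, toDistr_apply hf', D_smoothMul,
      pd_moll hg.locallyIntegrable hg' hgg'] at h
    have e1 : ∀ x, smoothMul _ hs φ x * f' x = φ x * f' x * moll g ε x := fun x => by
      change moll g ε x * φ x * f' x = _; ring
    have e2 : ∀ x, (moll g' ε x * φ x + moll g ε x * D i φ x) * f x
        = φ x * f x * moll g' ε x + D i φ x * f x * moll g ε x := fun x => by ring
    simp only [e1, e2] at h
    have i1 : Integrable fun x => φ x * f x * moll g' ε x :=
      (TF.integrable_mul hfl (smoothMul _ hs' φ)).congr (Filter.Eventually.of_forall fun x => by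
        change moll g' ε x * φ x * f x = _; ring)
    have i2 : Integrable fun x => D i φ x * f x * moll g ε x :=
      (TF.integrable_mul hfl (smoothMul _ hs (D i φ))).congr
        (Filter.Eventually.of_forall fun x => by
          change moll g ε x * D i φ x * f x = _; ring)
    rw [integral_add i1 i2] at h
    linarith
  have hlim := tendsto_nhds_unique t1 ((t2.neg.sub t3).congr fun n => (key n).symm)
  have e3 : ∀ x, φ x * (f' x * g x + f x * g' x) = φ x * f' x * g x + φ x * f x * g' x :=
    fun x => by ring
  simp only [e3]
  have i3 : Integrable fun x => φ x * f' x * g x :=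
    (TF.integrable_mul h1 φ).congr (Filter.Eventually.of_forall fun x => by
      simp only; ring)
  have i4 : Integrable fun x => φ x * f x * g' x :=
    (TF.integrable_mul h2 φ).congr (Filter.Eventually.of_forall fun x => by
      simp only; ring)
  rw [integral_add i3 i4, hlim]
  simp only [mul_assoc]
  ring

/-! ### Scales of weak regularity, products and the linear equation. -/

/-- A predicate defining a vector space of locally integrable functions. -/
structure IsFunctionSpace (S : (E3 → ℝ) → Prop) : Prop where
  locallyIntegrable : ∀ {f}, S f → LocallyIntegrable f
  zero : S fun _ => 0
  add : ∀ {f g}, S f → S g → S fun x => f x + g x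
  const_mul : ∀ {f} (c : ℝ), S f → S fun x => c * f x

lemma isFunctionSpace_memMorrey (p : ℝ) : IsFunctionSpace (MemMorrey p) where
  locallyIntegrable := MemMorrey.locallyIntegrable
  zero := MemMorrey.zero
  add := MemMorrey.add
  const_mul c h := h.const_mul c

/-- Functions in `S` whose weak derivatives up to order `m` are in `S`. -/
def Reg (S : (E3 → ℝ) → Prop) : ℕ → (E3 → ℝ) → Prop
  | 0, f => S f
  | m + 1, f => S f ∧ ∀ i, ∃ g, ∂_{e i} (toDistr f) = toDistr g ∧ Reg S m g

variable {S : (E3 → ℝ) → Prop}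

lemma Reg.base {m : ℕ} {f : E3 → ℝ} (h : Reg S m f) : S f := by
  cases m with
  | zero => exact h
  | succ m => exact h.1

lemma Reg.of_succ {m : ℕ} : ∀ {f : E3 → ℝ}, Reg S (m + 1) f → Reg S m f := by
  induction m with
  | zero => exact fun h => h.1
  | succ m ih => exact fun h => ⟨h.1, fun i => let ⟨g, hg, hr⟩ := h.2 i; ⟨g, hg, ih hr⟩⟩

lemma Reg.mono {m n : ℕ} (hmn : m ≤ n) {f : E3 → ℝ} (h : Reg S n f) : Reg S m f := by
  induction n, hmn using Nat.le_induction with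
  | base => exact h
  | succ n _ ih => exact ih h.of_succ

lemma Reg.zero (hS : IsFunctionSpace S) (m : ℕ) : Reg S m fun _ => 0 := by
  induction m with
  | zero => exact hS.zero
  | succ m ih => exact ⟨hS.zero, fun i => ⟨fun _ => 0, by rw [toDistr_zero, Distr.deriv_zero], ih⟩⟩

lemma Reg.add (hS : IsFunctionSpace S) {m : ℕ} : ∀ {f g : E3 → ℝ}, Reg S m f → Reg S m g →
    Reg S m fun x => f x + g x := by
  induction m with
  | zero => exact hS.add
  | succ m ih =>
    refine fun {f g} hf hg => ⟨hS.add hf.1 hg.1, fun i => ?_⟩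
    obtain ⟨f', hf', hfr⟩ := hf.2 i
    obtain ⟨g', hg', hgr⟩ := hg.2 i
    refine ⟨_, ?_, ih hfr hgr⟩
    rw [toDistr_add (hS.locallyIntegrable hf.1) (hS.locallyIntegrable hg.1),
      toDistr_add (hS.locallyIntegrable hfr.base) (hS.locallyIntegrable hgr.base),
      Distr.deriv_add, hf', hg']

lemma Distr.deriv_smul (i : Fin 3) (c : ℝ) (T : Distr) : ∂_{e i} (c • T) = c • ∂_{e i} T := by
  ext φ
  rw [Distr.deriv_apply]
  change -(c * T _) = c * (∂_{e i} T) φ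
  rw [Distr.deriv_apply]; ring

lemma Reg.const_mul (hS : IsFunctionSpace S) {m : ℕ} (c : ℝ) : ∀ {f : E3 → ℝ}, Reg S m f →
    Reg S m fun x => c * f x := by
  induction m with
  | zero => exact hS.const_mul c
  | succ m ih =>
    refine fun {f} hf => ⟨hS.const_mul c hf.1, fun i => ?_⟩
    obtain ⟨f', hf', hfr⟩ := hf.2 i
    refine ⟨_, ?_, ih hfr⟩
    rw [toDistr_const_mul (hS.locallyIntegrable hf.1),
      toDistr_const_mul (hS.locallyIntegrable hfr.base), Distr.deriv_smul, hf']

lemma Reg.sub (hS : IsFunctionSpace S) {m : ℕ} {f g : E3 → ℝ} (hf : Reg S m f)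
    (hg : Reg S m g) : Reg S m fun x => f x - g x := by
  have := hf.add hS (hg.const_mul hS (-1))
  simpa only [neg_one_mul, ← sub_eq_add_neg] using this

lemma Reg.sum (hS : IsFunctionSpace S) {m : ℕ} {ι : Type*} (s : Finset ι) {f : ι → E3 → ℝ}
    (hf : ∀ i ∈ s, Reg S m (f i)) : Reg S m fun x => ∑ i ∈ s, f i x := by
  classical
  induction s using Finset.induction_on with
  | empty => simpa using Reg.zero hS m
  | insert a s ha ih =>
    simp only [Finset.sum_insert ha]
    exact (hf a (by simp)).add hS (ih fun i hi => hf i (by simp [hi]))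

/-- A function with weak gradient in `Reg S m`. -/
def HasRegGrad (S : (E3 → ℝ) → Prop) (m : ℕ) (f : E3 → ℝ) : Prop :=
  LocallyIntegrable f ∧ ∀ i, ∃ g, ∂_{e i} (toDistr f) = toDistr g ∧ Reg S m g

lemma Reg.hasRegGrad (hS : IsFunctionSpace S) {m : ℕ} {f : E3 → ℝ} (h : Reg S (m + 1) f) :
    HasRegGrad S m f := ⟨hS.locallyIntegrable h.1, h.2⟩

lemma Reg.exists_iterate {n k : ℕ} {f : E3 → ℝ} (i : Fin 3) (h : Reg S (n + k) f) :
    ∃ g, (fun T : Distr => ∂_{e i} T)^[k] (toDistr f) = toDistr g ∧ Reg S n g := by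
  induction k generalizing f with
  | zero => exact ⟨f, rfl, h⟩
  | succ k ih =>
    obtain ⟨f', hf', hr⟩ := h.2 i
    rw [Function.iterate_succ_apply, hf']
    exact ih hr

lemma Reg.exists_multiDeriv {n : ℕ} {f : E3 → ℝ} (α : Fin 3 → ℕ) (h : Reg S (n + order α) f) :
    ∃ g, multiDeriv α (toDistr f) = toDistr g ∧ Reg S n g := by
  rw [order, Fin.sum_univ_three, ← add_assoc, ← add_assoc] at h
  obtain ⟨f₂, h₂, hr₂⟩ := h.exists_iterate 2
  obtain ⟨f₁, h₁, hr₁⟩ := hr₂.exists_iterate 1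
  obtain ⟨f₀, h₀, hr₀⟩ := hr₁.exists_iterate 0
  exact ⟨f₀, by rw [multiDeriv, h₂, h₁, h₀], hr₀⟩

lemma iterate_deriv_comm (i j : Fin 3) (k : ℕ) (T : Distr) :
    (fun S : Distr => ∂_{e i} S)^[k] (∂_{e j} T) = ∂_{e j} ((fun S : Distr => ∂_{e i} S)^[k] T) := by
  have hc : Function.Commute (fun S : Distr => ∂_{e i} S) (fun S : Distr => ∂_{e j} S) :=
    fun S => Distr.deriv_comm i j S
  exact (hc.iterate_left k).eq T

lemma multiDeriv_deriv (α : Fin 3 → ℕ) (i : Fin 3) (T : Distr) :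
    multiDeriv α (∂_{e i} T) = multiDeriv (α + Pi.single i 1) T := by
  have hs : ∀ (j : Fin 3) (k : ℕ) (T : Distr), (fun S : Distr => ∂_{e j} S)^[k + 1] T
      = ∂_{e j} ((fun S : Distr => ∂_{e j} S)^[k] T) := fun j k T => by
    rw [Function.iterate_succ_apply']
  fin_cases i <;> simp [multiDeriv, iterate_deriv_comm, hs]

lemma order_add_single (α : Fin 3 → ℕ) (i : Fin 3) : order (α + Pi.single i 1) = order α + 1 := by
  simp [order, Finset.sum_add_distrib]

lemma exists_eq_add_single {α : Fin 3 → ℕ} (h : 1 ≤ order α) :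
    ∃ (β : Fin 3 → ℕ) (i : Fin 3), α = β + Pi.single i 1 := by
  obtain ⟨i, hi⟩ : ∃ i, α i ≠ 0 := by
    by_contra! hc
    simp [order, hc] at h
  refine ⟨α - Pi.single i 1, i, ?_⟩
  ext j
  by_cases hj : j = i
  · subst hj; simp; omega
  · simp [hj]

lemma eq_zero_of_order {α : Fin 3 → ℕ} (h : order α = 0) : α = 0 := by
  ext i
  have := (Finset.sum_eq_zero_iff.1 h) i (Finset.mem_univ i)
  simpa using this

lemma multiDeriv_zero (T : Distr) : multiDeriv 0 T = T := rfl

/-- Stated for the gradient alone, so that it applies to functions such as `V`, which has modulus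
one and is not itself in the Morrey space. -/
lemma HasRegGrad.exists_isWeakDeriv (hS : IsFunctionSpace S) {m n : ℕ} {f : E3 → ℝ}
    (h : HasRegGrad S m f) {α : Fin 3 → ℕ} (h1 : 1 ≤ order α) (hn : n + order α ≤ m + 1) :
    ∃ g, IsWeakDeriv α f g ∧ Reg S n g := by
  obtain ⟨β, i, rfl⟩ := exists_eq_add_single h1
  rw [order_add_single] at hn
  obtain ⟨f', hf', hr⟩ := h.2 i
  obtain ⟨g, hg, hrg⟩ := Reg.exists_multiDeriv β (hr.mono (show n + order β ≤ m by omega))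
  exact ⟨g, ⟨h.1, hS.locallyIntegrable hrg.base, by rw [← multiDeriv_deriv, hf', hg]⟩, hrg⟩

lemma Reg.of_isWeakDeriv (hS : IsFunctionSpace S) {m : ℕ} : ∀ {f : E3 → ℝ}, S f →
    (∀ α : Fin 3 → ℕ, order α ≤ m → ∃ g, IsWeakDeriv α f g ∧ S g) → Reg S m f := by
  induction m with
  | zero => exact fun hf _ => hf
  | succ m ih =>
    refine fun {f} hf h => ⟨hf, fun i => ?_⟩
    obtain ⟨g, hg, hgS⟩ := h (0 + Pi.single i 1) (by rw [order_add_single]; simp [order])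
    have hd := hg.deriv_eq
    rw [← multiDeriv_deriv, multiDeriv_zero] at hd
    refine ⟨g, hd, ih hgS fun α hα => ?_⟩
    obtain ⟨u, hu, huS⟩ := h (α + Pi.single i 1) (by rw [order_add_single]; omega)
    refine ⟨u, ⟨hS.locallyIntegrable hgS, hS.locallyIntegrable huS, ?_⟩, huS⟩
    rw [← hd, multiDeriv_deriv, hu.deriv_eq]

lemma MemSobolevMorrey.reg {p : ℝ} {m : ℕ} {f : E3 → ℝ} (h : MemSobolevMorrey m p f) :
    Reg (MemMorrey p) m f :=
  Reg.of_isWeakDeriv (isFunctionSpace_memMorrey p) h.1 h.2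

lemma IsWeakDeriv.self {f : E3 → ℝ} (hf : LocallyIntegrable f) : IsWeakDeriv 0 f f :=
  ⟨hf, hf, multiDeriv_zero _⟩

lemma Reg.memSobolevMorrey {p : ℝ} {m : ℕ} {f : E3 → ℝ} (h : Reg (MemMorrey p) m f) :
    MemSobolevMorrey m p f := by
  refine ⟨h.base, fun α hα => ?_⟩
  rcases Nat.eq_zero_or_pos (order α) with h0 | h0
  · rw [eq_zero_of_order h0]
    exact ⟨f, IsWeakDeriv.self h.base.locallyIntegrable, h.base⟩
  · obtain ⟨n, rfl⟩ : ∃ n, m = n + 1 := ⟨m - 1, by omega⟩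
    obtain ⟨g, hg, hr⟩ := (h.hasRegGrad (isFunctionSpace_memMorrey p)).exists_isWeakDeriv
      (isFunctionSpace_memMorrey p) (n := 0) h0 (by omega)
    exact ⟨g, hg, hr⟩

lemma HasRegGrad.exists_holder {p : ℝ} (hp : 3 < p) {m : ℕ} {f : E3 → ℝ}
    (h : HasRegGrad (MemMorrey p) m f) : ∃ F : E3 → ℝ, f =ᵐ[volume] F ∧
      ∃ C : ℝ≥0, HolderWith C (1 - 3 / p).toNNReal F := by
  choose g hg hgr using h.2
  obtain ⟨F, hF, hC, -⟩ := MorreyRegularity.exists_holder hp h.1 (fun i => (hgr i).base) hg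
  exact ⟨F, hF, hC⟩

lemma IsWeakDeriv.congr_right {α : Fin 3 → ℕ} {f g F : E3 → ℝ} (h : IsWeakDeriv α f g)
    (hF : g =ᵐ[volume] F) : IsWeakDeriv α f F :=
  ⟨h.1, (locallyIntegrable_congr hF).1 h.2, by
    rw [h.deriv_eq, toDistr_congr h.locallyIntegrable_right hF]⟩

/-- A derivative of order at most `m` still has one more derivative in the Morrey space, which is
what `exists_holder` consumes. -/
lemma HasRegGrad.holderDerivs {p : ℝ} (hp : 3 < p) {m : ℕ} {f : E3 → ℝ}
    (h : HasRegGrad (MemMorrey p) m f) : HolderDerivs m (1 - 3 / p).toNNReal f := by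
  intro α hα
  rcases Nat.eq_zero_or_pos (order α) with h0 | h0
  · rw [eq_zero_of_order h0]
    obtain ⟨F, hF, hC⟩ := h.exists_holder hp
    exact ⟨F, (IsWeakDeriv.self h.1).congr_right hF, hC⟩
  · obtain ⟨g, hg, hr⟩ := h.exists_isWeakDeriv (isFunctionSpace_memMorrey p) (n := 1) h0 (by omega)
    obtain ⟨F, hF, hC⟩ := (hr.hasRegGrad (isFunctionSpace_memMorrey p)).exists_holder hp
    exact ⟨F, hg.congr_right hF, hC⟩

lemma Reg.bdd {p : ℝ} (hp : 3 < p) {m : ℕ} {f : E3 → ℝ} (h : Reg (MemMorrey p) (m + 1) f) :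
    Bdd f := by
  choose g hg hgr using h.2
  exact ⟨h.1.1, exists_ae_bound hp h.1 (fun i => (hgr i).base) hg⟩

/-- One Morrey derivative is traded for boundedness of all the lower ones. -/
lemma Reg.reg_bdd {p : ℝ} (hp : 3 < p) {m : ℕ} : ∀ {f : E3 → ℝ}, Reg (MemMorrey p) (m + 1) f →
    Reg Bdd m f := by
  induction m with
  | zero => exact fun h => h.bdd hp
  | succ m ih =>
    exact fun h => ⟨h.bdd hp, fun i => let ⟨g, hg, hr⟩ := h.2 i; ⟨g, hg, ih hr⟩⟩

lemma MemMorrey.mul_bdd {p : ℝ} {f g : E3 → ℝ} (hf : MemMorrey p f) (hg : Bdd g) :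
    MemMorrey p fun x => f x * g x := by
  obtain ⟨hm, C, hC⟩ := hg
  exact hf.bdd_mul hm hC

lemma Reg.mul_bdd {p : ℝ} (hp : 3 < p) {m : ℕ} : ∀ {f g : E3 → ℝ}, Reg (MemMorrey p) m f →
    Reg Bdd m g → Reg (MemMorrey p) m fun x => f x * g x := by
  have hM := isFunctionSpace_memMorrey p
  induction m with
  | zero => exact fun hf hg => MemMorrey.mul_bdd hf hg
  | succ m ih =>
    refine fun {f g} hf hg => ⟨hf.1.mul_bdd hg.1, fun i => ?_⟩
    obtain ⟨f', hf', hfr⟩ := hf.2 i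
    obtain ⟨g', hg', hgr⟩ := hg.2 i
    exact ⟨_, deriv_toDistr_mul (hf.bdd hp) hg.1 hfr.base.locallyIntegrable
      hgr.base.locallyIntegrable hf' hg', (ih hfr hg.of_succ).add hM (ih hf.of_succ hgr)⟩

/-- The gradient is `f' g + f g'`: in each term one factor is a derivative in the Morrey scale of
order `m`, while the other has `m` bounded derivatives by `Reg.reg_bdd`. -/
lemma Reg.mul {p : ℝ} (hp : 3 < p) {m : ℕ} {f g : E3 → ℝ} (hf : Reg (MemMorrey p) (m + 1) f)
    (hg : Reg (MemMorrey p) (m + 1) g) : Reg (MemMorrey p) (m + 1) fun x => f x * g x := by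
  have hM := isFunctionSpace_memMorrey p
  refine ⟨hf.1.mul_bdd (hg.bdd hp), fun i => ?_⟩
  obtain ⟨f', hf', hfr⟩ := hf.2 i
  obtain ⟨g', hg', hgr⟩ := hg.2 i
  refine ⟨_, deriv_toDistr_mul (hf.bdd hp) (hg.bdd hp) hfr.base.locallyIntegrable
    hgr.base.locallyIntegrable hf' hg', (hfr.mul_bdd hp (hg.reg_bdd hp)).add hM ?_⟩
  simpa only [mul_comm] using hgr.mul_bdd hp (hf.reg_bdd hp)

lemma Distr.deriv_bilap (i : Fin 3) (T : Distr) :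
    ∂_{e i} (Distr.bilap T) = Distr.bilap (∂_{e i} T) := by
  simp only [Distr.bilap, Distr.deriv_sum, Distr.deriv_comm i]

lemma deriv_div3 (i : Fin 3) (h : Fin 3 → Fin 3 → Fin 3 → Distr) :
    ∂_{e i} (div3 h) = div3 fun a b c => ∂_{e i} (h a b c) := by
  simp only [div3, Distr.deriv_sum, Distr.deriv_comm i]

/-- Higher regularity for the linear equation `Δ² u = ∑ ∂_a ∂_b ∂_c h_{abc}`. -/
lemma Reg.of_bilap {p : ℝ} (hp : 0 < p) {m : ℕ} : ∀ {u : E3 → ℝ}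
    {h : Fin 3 → Fin 3 → Fin 3 → E3 → ℝ}, Reg (MemMorrey p) m u →
    (∀ a b c, Reg (MemMorrey p) m (h a b c)) →
    Distr.bilap (toDistr u) = (div3 fun a b c => toDistr (h a b c)) →
    Reg (MemMorrey p) (m + 1) u := by
  induction m with
  | zero =>
    refine fun {u h} hu hh heq => ⟨hu, fun i => ?_⟩
    obtain ⟨g, hg, hug⟩ := exists_deriv_memMorrey hp hu hh heq i
    exact ⟨g, hug, hg⟩
  | succ m ih =>
    refine fun {u h} hu hh heq => ⟨hu.1, fun i => ?_⟩
    obtain ⟨g, hg, hgr⟩ := hu.2 i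
    choose h' hh' hhr using fun a b c => (hh a b c).2 i
    refine ⟨g, hg, ih hgr (h := h') hhr ?_⟩
    -- The equation has constant coefficients, so each derivative of `u` solves it with the
    -- differentiated data.
    rw [← hg, ← Distr.deriv_bilap, heq, deriv_div3]
    simp only [hh']

/-! ### Distributions with Morrey gradient, up to a constant. -/

lemma TF.integral_D (i : Fin 3) (φ : TF) : ∫ x, D i φ x = 0 := by
  have h0 := TF.integrable (D i φ)
  rw [coe_D] at h0
  unfold pd at h0
  have h := integral_mul_fderiv_eq_neg_fderiv_mul_of_integrable (μ := (volume : Measure E3))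
    (𝕜 := ℝ) (f := ⇑φ) (g := fun _ => (1 : ℝ)) (v := e i)
    (by simpa using h0) (by simp)
    (by simpa using TF.integrable φ) (fun x _ => φ.smooth.differentiable (by simp) x)
    (fun x _ => differentiableAt_const _)
  simp only [coe_D, pd]
  simpa using h

lemma deriv_toDistr_const (i : Fin 3) (c : ℝ) : ∂_{e i} (toDistr fun _ => c) = 0 := by
  ext φ
  rw [Distr.deriv_apply, toDistr_apply (locallyIntegrable_const c), integral_mul_const,
    TF.integral_D]
  simp

lemma integral_abs_le_normTwo {φ : TF} {r : ℝ} (hr : 0 < r)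
    (hφ : ∀ x : E3, r < ‖x‖ → φ x = 0) :
    ∫ x, |φ x| ≤ Real.sqrt unitVol * r ^ (3 / 2 : ℝ) * normTwo φ := by
  have h := lintegral_enorm_le_normTwo (x₀ := 0) hr (by simpa using hφ)
  have hN := normTwo_nonneg φ
  rw [← ofReal_integral_norm_eq_lintegral_enorm (TF.integrable φ),
    ENNReal.ofReal_le_ofReal_iff (by positivity)] at h
  exact h

lemma moll_const {R : ℝ} (hR : 0 < R) (c : ℝ) (x : E3) : moll (fun _ => c) R x = c := by
  rw [moll, integral_const_mul, integral_sub_right_eq_self (chi R : E3 → ℝ), integral_chi hR,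
    mul_one]

lemma abs_integral_mul_le {φ ψ : E3 → ℝ} (hφ : Integrable φ) {C : ℝ}
    (h : ∀ x, φ x ≠ 0 → |ψ x| ≤ C) : |∫ x, φ x * ψ x| ≤ (∫ x, |φ x|) * C := by
  rw [← Real.norm_eq_abs, ← integral_mul_const]
  refine norm_integral_le_of_norm_le (hφ.abs.mul_const _) (Filter.Eventually.of_forall fun x => ?_)
  rw [norm_mul]
  by_cases hx : φ x = 0
  · simp [hx]
  · exact mul_le_mul_of_nonneg_left (h x hx) (abs_nonneg _)

/-- A distribution with gradient in a Morrey space whose bilaplacian is a combination of fourth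
derivatives of Morrey functions is, up to a constant, a Morrey function. -/
lemma exists_memMorrey_add_const {p : ℝ} (hp : 3 < p) {ι : Type*} [Fintype ι] {P : Distr}
    {d : ι → Fin 4 → Fin 3} {h : ι → E3 → ℝ} (hh : ∀ n, MemMorrey p (h n))
    (hP : ∀ ψ : TF, P (bilap ψ) =
      ∑ n, ∫ y, D (d n 0) (D (d n 1) (D (d n 2) (D (d n 3) ψ))) y * h n y)
    {g : Fin 3 → E3 → ℝ} (hg : ∀ i, MemMorrey p (g i)) (hPg : ∀ i, ∂_{e i} P = toDistr (g i)) :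
    ∃ (c : ℝ) (Q : E3 → ℝ), MemMorrey p Q ∧ P = toDistr Q + toDistr fun _ => c := by
  have hp0 : 0 < p := by linarith
  have hγ : 0 < 3 / p := by positivity
  obtain ⟨M, hM, hb⟩ := abs_apply_sub_apply_conv_chi_le hp0 hh hP
  obtain ⟨f, hf, rfl⟩ : ∃ f : E3 → ℝ, LocallyIntegrable f ∧ P = toDistr f := by
    -- Decay is not available yet, but local bounds are: `P φ - P (chi 1 * φ)` is controlled by the
    -- parametrix, and `P (chi 1 * φ)` by the finite order of `P`.
    obtain ⟨f, hf, hPf, -⟩ := exists_representative P fun n => by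
      obtain ⟨C, hC, hC'⟩ := exists_bound_apply_conv P (chi 1) (n + 1)
      refine ⟨M * (n + 1 : ℝ) ^ (3 / 2 - 3 / p) +
        C * (Real.sqrt unitVol * (n + 1 : ℝ) ^ (3 / 2 : ℝ)), by positivity, fun φ hφ => ?_⟩
      have hφ' : ∀ x : E3, (n : ℝ) + 1 < ‖x‖ → φ x = 0 := fun x hx => hφ x (by linarith)
      have h1 := hb 1 one_pos 0 (n + 1) (by positivity) φ (by simpa using hφ')
      have h2 := hC' φ hφ'
      have h3 := mul_le_mul_of_nonneg_left (integral_abs_le_normTwo (by positivity) hφ') hC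
      have h4 := abs_sub_abs_le_abs_sub (P φ) (P (conv (chi 1) φ))
      linarith
    exact ⟨f, hf, hPf⟩
  obtain ⟨K, hK, hKb⟩ := exists_bound_moll_sub hf hg hPg
  let R : ℕ → ℝ := fun n => (n : ℝ) + 1
  have hR : ∀ n, 0 < R n := fun n => by positivity
  have hRlim : Filter.Tendsto R Filter.atTop Filter.atTop :=
    Filter.tendsto_atTop_add_const_right _ _ tendsto_natCast_atTop_atTop
  -- the regularizations at the origin are bounded
  have hmoll : ∃ B : ℝ, ∀ n, moll f (R n) 0 ∈ Metric.closedBall (0 : ℝ) B := by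
    have hχ : ∀ x : E3, 1 < ‖x - 0‖ → chi 1 x = 0 := fun x hx =>
      chi_eq_zero one_pos (by rw [sub_zero] at hx; exact hx.le)
    refine ⟨|toDistr f (chi 1)| + M * 1 ^ (3 / 2 - 3 / p) * normTwo (chi 1)
      + (∫ x, |chi 1 x|) * K, fun n => ?_⟩
    rw [mem_closedBall_zero_iff, Real.norm_eq_abs]
    have h1 := hb (R n) (hR n) 0 1 one_pos (chi 1) hχ
    rw [toDistr_apply_conv_chi hf] at h1
    have h2 : |∫ x, chi 1 x * (moll f (R n) x - moll f (R n) 0)| ≤ (∫ x, |chi 1 x|) * K := by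
      refine abs_integral_mul_le (TF.integrable _) fun x hx => ?_
      have hx1 : ‖x‖ < 1 := not_le.1 fun h => hx (chi_eq_zero one_pos h)
      refine (hKb (R n) (hR n) x 0).trans ?_
      rw [sub_zero]
      have h3 : R n ^ (-(3 / p)) ≤ 1 :=
        Real.rpow_le_one_of_one_le_of_nonpos (by simp [R]) (by linarith)
      calc _ ≤ K * 1 * 1 := by gcongr
        _ = K := by ring
    -- Averaging against `chi 1` compares the value at the origin with `toDistr f (conv (chi (R n))
    -- (chi 1))`, which stays within a fixed distance of `toDistr f (chi 1)`.
    have h5 : ∫ x, chi 1 x * (moll f (R n) x - moll f (R n) 0)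
        = (∫ x, chi 1 x * moll f (R n) x) - moll f (R n) 0 := by
      simp only [mul_sub]
      rw [integral_sub (TF.integrable_mul (smooth_moll hf _).continuous.locallyIntegrable _)
        ((TF.integrable _).mul_const _), integral_mul_const, integral_chi one_pos, one_mul]
    rw [h5] at h2
    have t1 := abs_le.1 h1
    have t2 := abs_le.1 h2
    rw [abs_le]
    constructor <;> linarith [t1.1, t1.2, t2.1, t2.2, le_abs_self (toDistr f (chi 1)),
      neg_abs_le (toDistr f (chi 1))]
  obtain ⟨B, hB⟩ := hmoll
  -- The constant is a limit point of the regularizations at the origin. Since their gradients are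
  -- `O(R^(-3/p))`, they tend to `c` locally uniformly along the subsequence, so `f - c` vanishes at
  -- infinity.
  obtain ⟨c, -, ν, hν, hlim⟩ := tendsto_subseq_of_bounded Metric.isBounded_closedBall hB
  have hcl : LocallyIntegrable fun _ : E3 => c := locallyIntegrable_const c
  -- Subtracting a constant does not affect the bilaplacian.
  have hT : ∀ ψ : TF, (toDistr f - toDistr fun _ => c) (bilap ψ) =
      ∑ n, ∫ y, D (d n 0) (D (d n 1) (D (d n 2) (D (d n 3) ψ))) y * h n y := by
    intro ψ
    change toDistr f (bilap ψ) - toDistr (fun _ => c) (bilap ψ) = _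
    rw [hP, ← Distr.bilap_apply]
    simp [Distr.bilap, deriv_toDistr_const]
  obtain ⟨Q, hQ, hfQ⟩ := exists_memMorrey_of_bilap hp0 hh hT (R := fun n => R (ν n))
    (fun n => hR _) fun φ => by
      obtain ⟨r, hr, hφr⟩ := TF.exists_radius φ
      have hz : Filter.Tendsto (fun n => (∫ x, |φ x|) *
          (K * R (ν n) ^ (-(3 / p)) * r + |moll f (R (ν n)) 0 - c|)) Filter.atTop (nhds 0) := by
        have z1 : Filter.Tendsto (fun n => R (ν n) ^ (-(3 / p))) Filter.atTop (nhds 0) :=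
          (tendsto_rpow_neg_atTop hγ).comp (hRlim.comp hν.tendsto_atTop)
        have z2 := (hlim.sub_const c).abs
        have := (((z1.const_mul K).mul_const r).add z2).const_mul (∫ x, |φ x|)
        simpa using this
      refine squeeze_zero_norm (fun n => ?_) hz
      have h1 : (toDistr f - toDistr fun _ => c) (conv (chi (R (ν n))) φ)
          = ∫ x, φ x * (moll f (R (ν n)) x - c) := by
        change toDistr f _ - toDistr (fun _ => c) _ = _
        rw [toDistr_apply_conv_chi hf, toDistr_apply_conv_chi hcl]
        simp only [moll_const (hR _), mul_sub]
        rw [integral_sub (TF.integrable_mul (smooth_moll hf _).continuous.locallyIntegrable _)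
          ((TF.integrable _).mul_const _)]
      rw [h1]
      refine abs_integral_mul_le (TF.integrable φ) fun x hx => ?_
      have hxr : ‖x‖ ≤ r := not_lt.1 fun h => hx (hφr x h)
      have h2 := hKb (R (ν n)) (hR _) x 0
      rw [sub_zero] at h2
      have h3 : K * R (ν n) ^ (-(3 / p)) * ‖x‖ ≤ K * R (ν n) ^ (-(3 / p)) * r := by
        have := hR (ν n)
        gcongr
      have h4 := abs_sub_le (moll f (R (ν n)) x) (moll f (R (ν n)) 0) c
      linarith
  exact ⟨c, Q, hQ, by rw [← hfQ]; abel⟩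

/-! ### The Navier–Stokes system. -/

lemma MemL2Loc.locallyIntegrable_mul {f g : E3 → ℝ} (hf : MemL2Loc f) (hg : MemL2Loc g) :
    LocallyIntegrable fun x => f x * g x :=
  locallyIntegrable_iff.2 fun K hK => (hf K hK).integrable_mul (hg K hK)

/-- The pressure equation. -/
lemma laplacian_pressure {U : Fin 3 → Distr} {P : Distr} {T : Fin 3 → Fin 3 → Distr}
    (hmom : ∀ i, ∂_{e i} P = ∑ j, ∂_{e j} (T i j) + ∑ j, ∂_{e j} (∂_{e j} (U i)))
    (hdiv : ∑ i, ∂_{e i} (U i) = 0) :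
    ∑ l, ∂_{e l} (∂_{e l} P) = ∑ a, ∑ b, ∂_{e a} (∂_{e b} (T a b)) := by
  -- The viscous term disappears from the divergence because `U` is divergence free.
  have h : ∑ l, ∑ j, ∂_{e l} (∂_{e j} (∂_{e j} (U l))) = 0 := by
    rw [Finset.sum_comm]
    have h1 : ∀ j, ∑ l, ∂_{e l} (∂_{e j} (∂_{e j} (U l)))
        = ∂_{e j} (∂_{e j} (∑ l, ∂_{e l} (U l))) := by
      intro j
      rw [Distr.deriv_sum, Distr.deriv_sum]
      refine Finset.sum_congr rfl fun l _ => ?_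
      rw [Distr.deriv_comm l j, Distr.deriv_comm l j]
    simp only [h1, hdiv, Distr.deriv_zero, Finset.sum_const_zero]
  simp only [hmom, Distr.deriv_add, Distr.deriv_sum, Finset.sum_add_distrib]
  rw [h, add_zero]

/-- The velocity equation after elimination of the pressure. -/
lemma bilap_velocity {U : Fin 3 → Distr} {P : Distr} {T : Fin 3 → Fin 3 → Distr}
    (hmom : ∀ i, ∂_{e i} P = ∑ j, ∂_{e j} (T i j) + ∑ j, ∂_{e j} (∂_{e j} (U i)))
    (hdiv : ∑ i, ∂_{e i} (U i) = 0)
    (i : Fin 3) : Distr.bilap (U i) = div3 fun a b c =>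
    (if a = i then T b c else 0) - (if a = b then T i c else 0) := by
  -- Apply the Laplacian to `Δ U_i = ∂_i P - ∑ ∂_j T_ij`, then replace `ΔP` by the double divergence
  -- of `T`. The two terms give the two conditional summands.
  have h1 : ∑ a, ∂_{e a} (∂_{e a} (U i)) = ∂_{e i} P - ∑ j, ∂_{e j} (T i j) := by
    rw [hmom]; abel
  have h2 : Distr.bilap (U i)
      = ∑ b, ∂_{e b} (∂_{e b} (∑ a, ∂_{e a} (∂_{e a} (U i)))) := by
    simp only [Distr.bilap, Distr.deriv_sum]
    rw [Finset.sum_comm]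
  have h3 : ∑ b, ∂_{e b} (∂_{e b} (∂_{e i} P))
      = ∂_{e i} (∑ l, ∂_{e l} (∂_{e l} P)) := by
    rw [Distr.deriv_sum]
    refine Finset.sum_congr rfl fun l _ => ?_
    rw [Distr.deriv_comm l i, Distr.deriv_comm l i]
  rw [h2, h1]
  simp only [Distr.deriv_sub, Finset.sum_sub_distrib, h3, laplacian_pressure hmom hdiv, div3,
    Distr.deriv_sum]
  have hite : ∀ (i : Fin 3) (q : Prop) [Decidable q] (S : Distr),
      ∂_{e i} (if q then S else 0) = if q then ∂_{e i} S else 0 := by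
    intro i q _ S
    split_ifs
    · rfl
    · exact Distr.deriv_zero i
  congr 1
  · simp only [hite]
    symm
    rw [Finset.sum_eq_single i]
    · simp
    · intro a _ ha; simp [ha]
    · simp
  · simp only [hite]
    refine Finset.sum_congr rfl fun a _ => ?_
    symm
    rw [Finset.sum_eq_single a]
    · simp
    · intro b _ hb; simp [hb.symm]
    · simp

lemma abs_mul_le_sum_sq (u : Fin 3 → ℝ) (i j : Fin 3) : |u i * u j| ≤ ∑ l, u l ^ 2 := by
  have hi := Finset.single_le_sum (f := fun l => u l ^ 2) (fun l _ => sq_nonneg _)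
    (Finset.mem_univ i)
  have hj := Finset.single_le_sum (f := fun l => u l ^ 2) (fun l _ => sq_nonneg _)
    (Finset.mem_univ j)
  rw [abs_le]
  constructor <;> nlinarith [sq_nonneg (u i + u j), sq_nonneg (u i - u j)]

lemma abs_le_sum_sum_abs (F : Fin 3 → Fin 3 → ℝ) (i j : Fin 3) : |F i j| ≤ ∑ a, ∑ b, |F a b| :=
  (Finset.single_le_sum (f := fun b => |F i b|) (fun _ _ => abs_nonneg _)
    (Finset.mem_univ j)).trans
    (Finset.single_le_sum (f := fun a => ∑ b, |F a b|)
      (fun _ _ => Finset.sum_nonneg fun _ _ => abs_nonneg _) (Finset.mem_univ i))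

/-- The tensor `F - U ⊗ U`. -/
def stressTensor (F : Fin 3 → Fin 3 → E3 → ℝ) (U : E3 → E3) (i j : Fin 3) (x : E3) : ℝ :=
  F i j x - U x i * U x j

/-- The components of the tensor `h` in `Δ² U_i = ∑ ∂_a ∂_b ∂_c h_{abc}`. -/
def velocityTensor (H : Fin 3 → Fin 3 → E3 → ℝ) (i a b c : Fin 3) (x : E3) : ℝ :=
  (if a = i then H b c x else 0) - (if a = b then H i c x else 0)

lemma velocityTensor_eq (H : Fin 3 → Fin 3 → E3 → ℝ) (i a b c : Fin 3) :
    velocityTensor H i a b c = fun x => (if a = i then H b c else fun _ => 0) x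
      - (if a = b then H i c else fun _ => 0) x := by
  ext x
  simp only [velocityTensor]
  split_ifs <;> rfl

variable {F : Fin 3 → Fin 3 → E3 → ℝ} {U : E3 → E3} {P : Distr} {p : ℝ}

lemma reg_velocityTensor {S : (E3 → ℝ) → Prop} (hS : IsFunctionSpace S) {m : ℕ}
    {H : Fin 3 → Fin 3 → E3 → ℝ} (hH : ∀ i j, Reg S m (H i j)) (i a b c : Fin 3) :
    Reg S m (velocityTensor H i a b c) := by
  rw [velocityTensor_eq]
  refine Reg.sub hS ?_ ?_ <;> split_ifs
  · exact hH _ _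
  · exact Reg.zero hS m
  · exact hH _ _
  · exact Reg.zero hS m

lemma isFunctionSpace_locallyIntegrable :
    IsFunctionSpace fun f : E3 → ℝ => LocallyIntegrable f where
  locallyIntegrable h := h
  zero := locallyIntegrable_const 0
  add h h' := h.add h'
  const_mul c h := h.smul c

lemma toDistr_velocityTensor {H : Fin 3 → Fin 3 → E3 → ℝ} (hH : ∀ i j, LocallyIntegrable (H i j))
    (i a b c : Fin 3) : toDistr (velocityTensor H i a b c) =
      (if a = i then toDistr (H b c) else 0) - (if a = b then toDistr (H i c) else 0) := by
  have h0 : LocallyIntegrable fun _ : E3 => (0 : ℝ) := locallyIntegrable_const 0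
  have h1 : ∀ (q : Prop) [Decidable q] (f : E3 → ℝ), toDistr (if q then f else fun _ => 0)
      = if q then toDistr f else 0 := by
    intro q _ f
    split_ifs
    · rfl
    · exact toDistr_zero
  rw [velocityTensor_eq, toDistr_sub, h1, h1]
  · split_ifs
    · exact hH _ _
    · exact h0
  · split_ifs
    · exact hH _ _
    · exact h0

lemma IsWeakSolutionNS.locallyIntegrable_stressTensor
    (h : IsWeakSolutionNS (fun i j => toDistr (F i j)) U P)
    (hF : ∀ i j, LocallyIntegrable (F i j)) (i j : Fin 3) :
    LocallyIntegrable (stressTensor F U i j) :=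
  (hF i j).sub ((h.memL2Loc i).locallyIntegrable_mul (h.memL2Loc j))

lemma IsWeakSolutionNS.deriv_pressure (h : IsWeakSolutionNS (fun i j => toDistr (F i j)) U P)
    (hF : ∀ i j, LocallyIntegrable (F i j)) (i : Fin 3) :
    ∂_{e i} P = ∑ j, ∂_{e j} (toDistr (stressTensor F U i j))
      + ∑ j, ∂_{e j} (∂_{e j} (toDistr fun x => U x i)) := by
  have h1 : ∀ j, toDistr (stressTensor F U i j)
      = toDistr (F i j) - toDistr fun x => U x i * U x j := fun j =>
    toDistr_sub (hF i j) ((h.memL2Loc i).locallyIntegrable_mul (h.memL2Loc j))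
  simp only [h1, Distr.deriv_sub, Finset.sum_sub_distrib]
  rw [← h.momentum i]
  abel

lemma IsWeakSolutionNS.bilap_velocity (h : IsWeakSolutionNS (fun i j => toDistr (F i j)) U P)
    (hF : ∀ i j, LocallyIntegrable (F i j)) (i : Fin 3) :
    Distr.bilap (toDistr fun x => U x i)
      = div3 fun a b c => toDistr (velocityTensor (stressTensor F U) i a b c) := by
  simp only [toDistr_velocityTensor (h.locallyIntegrable_stressTensor hF)]
  exact MorreyRegularity.bilap_velocity (U := fun i => toDistr fun x => U x i)
    (h.deriv_pressure hF) h.div_eq_zero i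

/-- Boundedness of the velocity. -/
lemma IsWeakSolutionNS.bdd (hp : 3 < p) (h : IsWeakSolutionNS (fun i j => toDistr (F i j)) U P)
    (hF : ∀ i j, MemMorrey p (F i j)) (hU : ∀ i, MemMorrey p fun x => U x i) (i : Fin 3) :
    Bdd fun x => U x i := by
  have hFl := fun i j => (hF i j).locallyIntegrable
  refine ⟨(hU i).1, exists_ae_bound_of_quadratic hp (U := fun i x => U x i) hU
    (h := fun i a b c => velocityTensor (stressTensor F U) i a b c) (C := 2)
    (f := fun x => 2 * ∑ a, ∑ b, |F a b x|)
    (fun i a b c => reg_velocityTensor isFunctionSpace_locallyIntegrable (m := 0)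
      (h.locallyIntegrable_stressTensor hFl) i a b c)
    ((MemMorrey.sum _ fun a _ => MemMorrey.sum _ fun b _ => (hF a b).abs).const_mul 2)
    (by norm_num) (fun i a b c => Filter.Eventually.of_forall fun x => ?_)
    (h.bilap_velocity hFl) i⟩
  -- Each entry of `F - U ⊗ U` grows at most quadratically in `U`. A component of the velocity
  -- tensor is a difference of two such entries or zeros, hence the factor `2` in `f` and in `C`.
  have hst : ∀ i j, |stressTensor F U i j x| ≤ ∑ a, ∑ b, |F a b x| + ∑ l, U x l ^ 2 :=
    fun i j => (abs_sub _ _).trans (add_le_add (abs_le_sum_sum_abs (fun a b => F a b x) i j)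
      (abs_mul_le_sum_sq (fun l => U x l) i j))
  have h0 : 0 ≤ ∑ a, ∑ b, |F a b x| + ∑ l, U x l ^ 2 := (abs_nonneg _).trans (hst 0 0)
  have hite : ∀ (q : Prop) [Decidable q] (i j : Fin 3),
      |if q then stressTensor F U i j x else 0| ≤ ∑ a, ∑ b, |F a b x| + ∑ l, U x l ^ 2 := by
    intro q _ i j
    split_ifs
    · exact hst i j
    · simpa using h0
  have hle := (abs_sub _ _).trans (add_le_add (hite (a = i) b c) (hite (a = b) i c))
  have hab := le_abs_self (2 * ∑ a, ∑ b, |F a b x|)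
  change |velocityTensor (stressTensor F U) i a b c x| ≤ _
  rw [velocityTensor]
  linarith

/-- Regularity of the velocity. -/
lemma IsWeakSolutionNS.reg_velocity (hp : 3 < p)
    (h : IsWeakSolutionNS (fun i j => toDistr (F i j)) U P) {k : ℕ}
    (hF : ∀ i j, Reg (MemMorrey p) k (F i j)) (hU : ∀ i, MemMorrey p fun x => U x i) :
    ∀ i, Reg (MemMorrey p) (k + 1) fun x => U x i := by
  have hM := isFunctionSpace_memMorrey p
  have hFl := fun i j => (hF i j).base.locallyIntegrable
  have hstep : ∀ m ≤ k, (∀ i, Reg (MemMorrey p) m fun x => U x i) →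
      (∀ i j, Reg (MemMorrey p) m fun x => U x i * U x j) →
      ∀ i, Reg (MemMorrey p) (m + 1) fun x => U x i := fun m hm hUm hUU i =>
    Reg.of_bilap (by linarith) (hUm i)
      (fun a b c => reg_velocityTensor hM
        (fun i j => ((hF i j).mono hm).sub hM (hUU i j)) i a b c) (h.bilap_velocity hFl i)
  have hind : ∀ m ≤ k, ∀ i, Reg (MemMorrey p) (m + 1) fun x => U x i := by
    intro m
    induction m with
    | zero =>
      -- The first derivative uses the boundedness of `U` to place `U ⊗ U` in the Morrey space. From
      -- then on the product rule for `Reg` suffices.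
      exact fun hm => hstep 0 hm hU fun i j =>
        (hU i).mul_bdd (h.bdd hp (fun i j => (hF i j).base) hU j)
    | succ m ih =>
      intro hm
      have hUm := ih (by omega)
      exact hstep (m + 1) hm hUm fun i j => (hUm i).mul hp (hUm j)
  exact hind k le_rfl

/-- Regularity of the pressure. -/
lemma IsWeakSolutionNS.exists_pressure (hp : 3 < p)
    (h : IsWeakSolutionNS (fun i j => toDistr (F i j)) U P) {k : ℕ}
    (hF : ∀ i j, Reg (MemMorrey p) (k + 1) (F i j)) (hU : ∀ i, MemMorrey p fun x => U x i) :
    ∃ (c : ℝ) (Q : E3 → ℝ), P = toDistr (fun x => Q x + c) ∧ Reg (MemMorrey p) (k + 1) Q := by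
  have hM := isFunctionSpace_memMorrey p
  have hFl := fun i j => (hF i j).base.locallyIntegrable
  have hUr := h.reg_velocity hp hF hU
  have hH : ∀ i j, Reg (MemMorrey p) (k + 1) (stressTensor F U i j) := fun i j =>
    (hF i j).sub hM ((hUr i).of_succ.mul hp (hUr j).of_succ)
  have hgrad : ∀ i, ∃ g, ∂_{e i} P = toDistr g ∧ Reg (MemMorrey p) k g := by
    intro i
    choose A hA hAr using fun j => (hH i j).2 j
    choose B hB hBr using fun j => (hUr i).2 j
    choose C hC hCr using fun j => (hBr j).2 j
    refine ⟨fun x => (∑ j, A j x) + ∑ j, C j x, ?_,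
      (Reg.sum hM _ fun j _ => hAr j).add hM (Reg.sum hM _ fun j _ => hCr j)⟩
    have hAl := fun j => (hAr j).base.locallyIntegrable
    have hCl := fun j => (hCr j).base.locallyIntegrable
    rw [toDistr_add (locallyIntegrable_sum _ fun j _ => hAl j)
      (locallyIntegrable_sum _ fun j _ => hCl j), toDistr_sum _ fun j _ => hAl j,
      toDistr_sum _ fun j _ => hCl j, h.deriv_pressure hFl]
    simp only [hA, hB, hC]
  choose g hg hgr using hgrad
  have hlap := laplacian_pressure (U := fun i => toDistr fun x => U x i)
    (h.deriv_pressure hFl) h.div_eq_zero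
  -- A further Laplacian of the pressure equation puts four derivatives on the Morrey functions
  -- `T_ab`, as `exists_memMorrey_add_const` requires.
  have hbilap : Distr.bilap P = ∑ l, ∑ a, ∑ b,
      ∂_{e l} (∂_{e l} (∂_{e a} (∂_{e b} (toDistr (stressTensor F U a b))))) := by
    have h2 : Distr.bilap P = ∑ b, ∂_{e b} (∂_{e b} (∑ a, ∂_{e a} (∂_{e a} P))) := by
      simp only [Distr.bilap, Distr.deriv_sum]
      rw [Finset.sum_comm]
    rw [h2, hlap]
    simp only [Distr.deriv_sum]
  obtain ⟨c, Q, hQ, hPQ⟩ := exists_memMorrey_add_const hp (ι := Fin 3 × Fin 3 × Fin 3)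
    (d := fun n => ![n.2.2, n.2.1, n.1, n.1]) (h := fun n => stressTensor F U n.2.1 n.2.2)
    (fun n => (hH _ _).base) (fun ψ => by
      rw [← Distr.bilap_apply, hbilap]
      simp only [Distr.sum_apply, Distr.deriv_apply, neg_neg, Fintype.sum_prod_type]
      simp [toDistr_apply (hH _ _).base.locallyIntegrable]) (fun i => (hgr i).base) hg
  refine ⟨c, Q, by rw [hPQ, toDistr_add hQ.locallyIntegrable (locallyIntegrable_const c)],
    hQ, fun i => ⟨g i, ?_, hgr i⟩⟩
  rw [← hg i, hPQ, Distr.deriv_add, deriv_toDistr_const, add_zero]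

/-! ### The harmonic map system. -/

/-- The density `|D|² = ∑ D_{ab}²`. -/
def energyDensity (D : Fin 3 → Fin 3 → E3 → ℝ) (x : E3) : ℝ := ∑ a, ∑ b, D a b x ^ 2

lemma reg_energyDensity {p : ℝ} (hp : 3 < p) {m : ℕ} {D : Fin 3 → Fin 3 → E3 → ℝ}
    (hD : ∀ a b, Reg (MemMorrey p) (m + 1) (D a b)) :
    Reg (MemMorrey p) (m + 1) (energyDensity D) := by
  have hM := isFunctionSpace_memMorrey p
  refine Reg.sum hM _ fun a _ => Reg.sum hM _ fun b _ => ?_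
  simpa only [sq] using (hD a b).mul hp (hD a b)

variable {G D : Fin 3 → Fin 3 → E3 → ℝ} {V : E3 → E3} {p : ℝ}

lemma IsWeakGradient.deriv_eq (h : IsWeakGradient V D) (i j : Fin 3) :
    ∂_{e i} (toDistr fun x => V x j) = toDistr (D i j) := by
  have := (h i j).deriv_eq
  rwa [← zero_add (Pi.single i 1), ← multiDeriv_deriv, multiDeriv_zero] at this

lemma IsWeakSolutionHarmonicMap.abs_le_one
    (h : IsWeakSolutionHarmonicMap (fun i j => toDistr (G i j)) V D) (j : Fin 3) :
    ∀ᵐ x, |V x j| ≤ 1 :=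
  h.norm_eq_one.mono fun x hx => by
    rw [← hx]
    exact PiLp.norm_apply_le (V x) j

lemma IsWeakSolutionHarmonicMap.bdd
    (h : IsWeakSolutionHarmonicMap (fun i j => toDistr (G i j)) V D) (j : Fin 3) :
    Bdd fun x => V x j :=
  ⟨(EuclideanSpace.proj (𝕜 := ℝ) j).continuous.comp_aestronglyMeasurable h.measurable,
    1, h.abs_le_one j⟩

lemma IsWeakSolutionHarmonicMap.locallyIntegrable_energyDensity
    (h : IsWeakSolutionHarmonicMap (fun i j => toDistr (G i j)) V D) :
    LocallyIntegrable (energyDensity D) :=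
  locallyIntegrable_sum _ fun a _ => locallyIntegrable_sum _ fun b _ => by
    simpa only [sq] using (h.memL2Loc a b).locallyIntegrable_mul (h.memL2Loc a b)

/-- The right-hand side `|∇V|² V + div G`, where `G'_{jb} = ∂_b G_{jb}`. -/
def tension (D G' : Fin 3 → Fin 3 → E3 → ℝ) (V : E3 → E3) (j : Fin 3) (x : E3) : ℝ :=
  energyDensity D x * V x j + ∑ b, G' j b x

lemma IsWeakSolutionHarmonicMap.locallyIntegrable_tension
    (h : IsWeakSolutionHarmonicMap (fun i j => toDistr (G i j)) V D)
    {G' : Fin 3 → Fin 3 → E3 → ℝ} (hG' : ∀ j b, LocallyIntegrable (G' j b)) (j : Fin 3) :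
    LocallyIntegrable (tension D G' V j) :=
  (h.locallyIntegrable_energyDensity.mul_bdd (h.bdd j)).add
    (locallyIntegrable_sum _ fun b _ => hG' j b)

lemma IsWeakSolutionHarmonicMap.laplacian_eq
    (h : IsWeakSolutionHarmonicMap (fun i j => toDistr (G i j)) V D)
    {G' : Fin 3 → Fin 3 → E3 → ℝ} (hG' : ∀ j b, LocallyIntegrable (G' j b))
    (hGG' : ∀ j b, ∂_{e b} (toDistr (G j b)) = toDistr (G' j b)) (j : Fin 3) :
    ∑ l, ∂_{e l} (∂_{e l} (toDistr fun x => V x j)) = -toDistr (tension D G' V j) := by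
  have h1 : toDistr (tension D G' V j)
      = toDistr (fun x => energyDensity D x * V x j) + ∑ b, ∂_{e b} (toDistr (G j b)) := by
    simp only [hGG']
    rw [← toDistr_sum _ fun b _ => hG' j b]
    exact toDistr_add (h.locallyIntegrable_energyDensity.mul_bdd (h.bdd j))
      (locallyIntegrable_sum _ fun b _ => hG' j b)
  rw [h1, ← h.equation j]
  simp only [energyDensity]
  abel

/-- The components of the tensor `h` in `Δ² ∂_i V_j = ∑ ∂_a ∂_b ∂_c h_{abc}`. -/
def gradientTensor (N : Fin 3 → E3 → ℝ) (i j a b c : Fin 3) : E3 → ℝ :=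
  if a = i ∧ b = c then fun x => -1 * N j x else fun _ => 0

lemma IsWeakSolutionHarmonicMap.bilap_gradient
    (h : IsWeakSolutionHarmonicMap (fun i j => toDistr (G i j)) V D)
    {G' : Fin 3 → Fin 3 → E3 → ℝ} (hG' : ∀ j b, LocallyIntegrable (G' j b))
    (hGG' : ∀ j b, ∂_{e b} (toDistr (G j b)) = toDistr (G' j b)) (i j : Fin 3) :
    Distr.bilap (toDistr (D i j))
      = div3 fun a b c => toDistr (gradientTensor (tension D G' V) i j a b c) := by
  have hN := h.locallyIntegrable_tension hG' j
  have h1 : ∀ a b c, toDistr (gradientTensor (tension D G' V) i j a b c)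
      = if a = i then (if b = c then -toDistr (tension D G' V j) else 0) else 0 := by
    intro a b c
    rw [gradientTensor, ← ite_and]
    split_ifs
    · rw [toDistr_const_mul hN, neg_one_smul]
    · exact toDistr_zero
  have hite : ∀ (i : Fin 3) (q : Prop) [Decidable q] (S : Distr),
      ∂_{e i} (if q then S else 0) = if q then ∂_{e i} S else 0 := by
    intro i q _ S
    split_ifs
    · rfl
    · exact Distr.deriv_zero i
  simp only [h1, div3, hite]
  -- `Δ² ∂_i V_j = Δ ∂_i (ΔV_j)`, and `ΔV_j` is minus the tension. This accounts for the sign and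
  -- for the nonzero entries, those with `a = i` and `b = c`.
  have h2 : Distr.bilap (toDistr (D i j))
      = ∑ b, ∂_{e b} (∂_{e b} (∂_{e i} (∑ a, ∂_{e a} (∂_{e a} (toDistr fun x => V x j))))) := by
    simp only [Distr.bilap, Distr.deriv_sum, ← h.gradient.deriv_eq]
    rw [Finset.sum_comm]
    simp only [Distr.deriv_comm i]
  rw [h2, h.laplacian_eq hG' hGG' j]
  symm
  rw [Finset.sum_eq_single i]
  · refine Finset.sum_congr rfl fun b _ => ?_
    rw [Finset.sum_eq_single b]
    · simp only [if_true]
      rw [Distr.deriv_comm i b, Distr.deriv_comm i b]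
    · intro c _ hc; simp [hc.symm]
    · simp
  · intro a _ ha; simp [ha]
  · simp

lemma reg_gradientTensor {S : (E3 → ℝ) → Prop} (hS : IsFunctionSpace S) {m : ℕ}
    {N : Fin 3 → E3 → ℝ} (hN : ∀ j, Reg S m (N j)) (i j a b c : Fin 3) :
    Reg S m (gradientTensor N i j a b c) := by
  rw [gradientTensor]
  split_ifs
  · exact (hN j).const_mul hS (-1)
  · exact Reg.zero hS m

/-- Boundedness of the gradient. -/
lemma IsWeakSolutionHarmonicMap.bdd_gradient (hp : 3 < p)
    (h : IsWeakSolutionHarmonicMap (fun i j => toDistr (G i j)) V D)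
    {G' : Fin 3 → Fin 3 → E3 → ℝ} (hG' : ∀ j b, MemMorrey p (G' j b))
    (hGG' : ∀ j b, ∂_{e b} (toDistr (G j b)) = toDistr (G' j b))
    (hD : ∀ i j, MemMorrey p (D i j)) (i j : Fin 3) : Bdd (D i j) := by
  have hGl := fun j b => (hG' j b).locallyIntegrable
  refine ⟨(hD i j).1, exists_ae_bound_of_quadratic hp (ι := Fin 3 × Fin 3)
    (U := fun n => D n.1 n.2) (fun n => hD _ _)
    (h := fun n a b c => gradientTensor (tension D G' V) n.1 n.2 a b c) (C := 1)
    (f := fun x => ∑ a, ∑ b, |G' a b x|)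
    (fun n a b c => reg_gradientTensor isFunctionSpace_locallyIntegrable (m := 0)
      (h.locallyIntegrable_tension hGl) _ _ a b c)
    (MemMorrey.sum _ fun a _ => MemMorrey.sum _ fun b _ => (hG' a b).abs)
    zero_le_one (fun n a b c => ?_)
    (fun n => h.bilap_gradient hGl hGG' n.1 n.2) (i, j)⟩
  filter_upwards [h.abs_le_one n.2] with x hx
  have hE : 0 ≤ energyDensity D x :=
    Finset.sum_nonneg fun _ _ => Finset.sum_nonneg fun _ _ => sq_nonneg _
  have hsum : ∑ l : Fin 3 × Fin 3, D l.1 l.2 x ^ 2 = energyDensity D x := by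
    rw [Fintype.sum_prod_type]; rfl
  have hF : 0 ≤ ∑ a, ∑ b, |G' a b x| :=
    Finset.sum_nonneg fun _ _ => Finset.sum_nonneg fun _ _ => abs_nonneg _
  rw [hsum, one_mul, abs_of_nonneg hF]
  -- Since `|V_j| ≤ 1`, the tension is bounded by a Morrey function plus the square of the gradient,
  -- which is the quadratic growth needed.
  have hN : |tension D G' V n.2 x| ≤ ∑ a, ∑ b, |G' a b x| + energyDensity D x := by
    have h1 : |energyDensity D x * V x n.2| ≤ energyDensity D x := by
      rw [abs_mul, abs_of_nonneg hE]
      exact mul_le_of_le_one_right hE hx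
    have h2 : |∑ b, G' n.2 b x| ≤ ∑ a, ∑ b, |G' a b x| :=
      (Finset.abs_sum_le_sum_abs _ _).trans
        (Finset.single_le_sum (f := fun a => ∑ b, |G' a b x|)
          (fun _ _ => Finset.sum_nonneg fun _ _ => abs_nonneg _) (Finset.mem_univ n.2))
    refine (abs_add_le _ _).trans ?_
    linarith
  rw [gradientTensor]
  split_ifs
  · simpa only [neg_one_mul, abs_neg] using hN
  · rw [abs_zero]; positivity

/-- Regularity of the gradient. -/
lemma IsWeakSolutionHarmonicMap.reg_gradient (hp : 3 < p)
    (h : IsWeakSolutionHarmonicMap (fun i j => toDistr (G i j)) V D) {k : ℕ}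
    (hG : ∀ i j, Reg (MemMorrey p) (k + 1) (G i j)) (hD : ∀ i j, MemMorrey p (D i j)) :
    ∀ i j, Reg (MemMorrey p) (k + 1) (D i j) := by
  have hM := isFunctionSpace_memMorrey p
  choose G' hGG' hGr using fun j b => (hG j b).2 b
  have hGl := fun j b => (hGr j b).base.locallyIntegrable
  have hstep : ∀ m ≤ k, (∀ i j, Reg (MemMorrey p) m (D i j)) →
      (∀ j, Reg (MemMorrey p) m fun x => energyDensity D x * V x j) →
      ∀ i j, Reg (MemMorrey p) (m + 1) (D i j) := fun m hm hDm hE i j =>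
    Reg.of_bilap (by linarith) (hDm i j)
      (fun a b c => reg_gradientTensor hM
        (fun j => (hE j).add hM (Reg.sum hM _ fun b _ => (hGr j b).mono hm)) i j a b c)
      (h.bilap_gradient hGl hGG' i j)
  have hind : ∀ m ≤ k, ∀ i j, Reg (MemMorrey p) (m + 1) (D i j) := by
    intro m
    induction m with
    | zero =>
      refine fun hm => hstep 0 hm hD fun j => MemMorrey.mul_bdd ?_ (h.bdd j)
      refine MemMorrey.sum _ fun a _ => MemMorrey.sum _ fun b _ => ?_
      -- One gradient factor is bounded and the other is a Morrey function, so the energy density is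
      -- a Morrey function; multiplying it by the bounded `V` preserves this.
      simpa only [sq] using
        (hD a b).mul_bdd (h.bdd_gradient hp (fun j b => (hGr j b).base) hGG' hD a b)
    | succ m ih =>
      intro hm
      have hDm := ih (by omega)
      refine hstep (m + 1) hm hDm fun j => (reg_energyDensity hp hDm).mul_bdd hp ⟨h.bdd j, ?_⟩
      -- `V` has `m + 1` bounded derivatives: it is bounded itself, and the `m + 1` Morrey
      -- derivatives of its gradient give `m` bounded ones.
      exact fun i => ⟨D i j, h.gradient.deriv_eq i j, (hDm i j).reg_bdd hp⟩
  exact hind k le_rfl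

end MorreyRegularity

end

theorem corollary1 (p : ℝ) (hp : 3 < p) (k : ℕ) :
    (∀ (F : Fin 3 → Fin 3 → MorreyRegularity.E3 → ℝ)
        (U : MorreyRegularity.E3 → MorreyRegularity.E3) (P : MorreyRegularity.Distr),
      MorreyRegularity.ForceCondition k p F →
      MorreyRegularity.IsWeakSolutionNS (fun i j => MorreyRegularity.toDistr (F i j)) U P →
      (∀ i, MorreyRegularity.MemMorrey p (fun x => U x i)) →
      (∀ i, MorreyRegularity.MemSobolevMorrey (k + 2) p (fun x => U x i) ∧
        MorreyRegularity.HolderDerivs (k + 1) (1 - 3 / p).toNNReal (fun x => U x i)) ∧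
      ∃ (c : ℝ) (Q : MorreyRegularity.E3 → ℝ),
        P = MorreyRegularity.toDistr (fun x => Q x + c) ∧
        MorreyRegularity.MemSobolevMorrey (k + 1) p Q ∧
        MorreyRegularity.HolderDerivs k (1 - 3 / p).toNNReal Q) ∧
    (∀ (G : Fin 3 → Fin 3 → MorreyRegularity.E3 → ℝ)
        (V : MorreyRegularity.E3 → MorreyRegularity.E3)
        (D : Fin 3 → Fin 3 → MorreyRegularity.E3 → ℝ),
      MorreyRegularity.ForceCondition k p G →
      MorreyRegularity.IsWeakSolutionHarmonicMap
        (fun i j => MorreyRegularity.toDistr (G i j)) V D →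
      (∀ i j, MorreyRegularity.MemMorrey p (D i j)) →
      ∀ j,
        (∀ α : Fin 3 → ℕ, 1 ≤ MorreyRegularity.order α → MorreyRegularity.order α ≤ k + 2 →
          ∃ g : MorreyRegularity.E3 → ℝ,
            MorreyRegularity.IsWeakDeriv α (fun x => V x j) g ∧
            MorreyRegularity.MemMorrey p g) ∧
        MorreyRegularity.HolderDerivs (k + 1) (1 - 3 / p).toNNReal (fun x => V x j)) := by
  have hM := MorreyRegularity.isFunctionSpace_memMorrey p
  refine ⟨fun F U P hF h hU => ?_, fun G V D hG h hD j => ?_⟩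
  · have hFr := fun i j => (hF i j).1.reg
    have hUr := h.reg_velocity hp hFr hU
    obtain ⟨c, Q, hPQ, hQ⟩ := h.exists_pressure hp hFr hU
    exact ⟨fun i => ⟨(hUr i).memSobolevMorrey, ((hUr i).hasRegGrad hM).holderDerivs hp⟩,
      c, Q, hPQ, hQ.memSobolevMorrey, (hQ.hasRegGrad hM).holderDerivs hp⟩
  · have hDr := h.reg_gradient hp (fun i j => (hG i j).1.reg) hD
    -- Only the gradient of `V` lies in the Morrey scale, so the conclusions are drawn from
    -- `HasRegGrad` and the Morrey claim starts at order one.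
    have hV : MorreyRegularity.HasRegGrad (MorreyRegularity.MemMorrey p) (k + 1)
        (fun x => V x j) :=
      ⟨(h.bdd j).locallyIntegrable, fun i => ⟨D i j, h.gradient.deriv_eq i j, hDr i j⟩⟩
    exact ⟨fun α h1 h2 => hV.exists_isWeakDeriv hM (n := 0) h1 (by omega), hV.holderDerivs hp⟩
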